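/- Let $D\ge 2$ and $p\ge 0$. **Graphs.** A *bubble* $B$ is a finite connected bipartite graph (multiple edges allowed) with edges colored in $[D]=\{1,\dots,D\}$ such that every vertex is incident to exactly one edge of each color. A *pairing* $\Omega$ of $B$ is a partition of its vertices into pairs (white vertex, black vertex). $\mathbb G_p(B)$ is the set of isomorphism classes of finite connected bipartite graphs $G$ with edge colors $\{0,\dots,D\}$ in which every vertex has exactly one edge of each color $1,\dots,D$ and one edge of color $0$, except for $p$ white and $p$ black *free* vertices without edge of color $0$, and in which all connected components (the bubbles of $G$) left after removing the edges of color $0$ are isomorphic to $B$. $\mathbb G_p(B,\Omega)$ is the set of isomorphism classes of such $G$ equipped with a pairing of their vertices induced by $\Omega$, i.e. such that each of these components with its pairs is isomorphic to $(B,\Omega)$. For $i\in[D]$, the *faces of color $i$* of $G$ are the closed chains alternating the colors $0$ and $i$, and the *broken faces* are the open ones (between two free vertices). **Maps.** A combinatorial map is given by the clockwise cyclic order $\sigma$ of the half-edges around the vertices and the involution $\alpha$ which glues them into edges; a *cilium* is a half-edge fixed by $\alpha$ (it carries all colors). Let $\mathcal M$ be a connected map with edges colored in $[D]$, not necessarily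 properly, and with at most one cilium per vertex. $\mathbb W_p(\mathcal M)$ is the set of isomorphism classes of *stuffed Walsh maps*: connected maps $W$ with black and blue vertices such that each black vertex has at least one edge, and its edges lead to blue vertices only; removing the black vertices and replacing their edges by cilia at the blue vertices gives a disjoint union of copies of $\mathcal M$; an edge between a black and a blue vertex carries the set of colors incident to the blue vertex in $\mathcal M$; the cilia of $W$ are $p$ in number, at black vertices, at most one per vertex. The *faces of color $i$* of $W$ are those of the submap $W^{(i)}$ obtained by keeping all the vertices and only the edges whose color set contains $i$; a face with cilia is cut at its cilia into *broken faces*. **The map $\mathcal M(B,\Omega)$.** Let $\tau_i$ be the permutation of the pairs such that an edge of color $i$ joins the white vertex of $x$ to the black vertex of $\tau_i(x)$. $\mathcal M(B,\Omega)$ has one vertex for each pair $x$ and an edge of color $i$ from $x$ to $\tau_i(x)$ whenever $\tau_i(x)\ne x$; going clockwise around the vertex $x$ one meets one cilium, then all outgoing half-edges, then all ingoing half-edges, and the relative order of the colors is arbitrary. A *reduced map* $\widetilde{\mathcal M}(B,\Omega)$ is obtained either by removing, for each $i$, exactly one edge of each cycle of color $i$, or by replacing, for each $i$, each cycle of color $i$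 by a star joining its vertices to a new vertex, with the edges around the new vertex in the order of the cycle $\tau_i$. The choices made (orders, removed edges) are called *symmetric* if they are invariant under the automorphisms of $(B,\Omega)$, e.g. if the colors are ordered in the same way at all vertices and no edge is removed. **Theorem.** Let $\Omega$ be a pairing of a bubble $B$. 1. Forgetting the pairing is a surjection $\mathbb G_p(B,\Omega)\to\mathbb G_p(B)$, and a bijection if $\Omega$ is preserved by all automorphisms of $B$. 2. For symmetric orders (which exist), there is a bijection between $\mathbb G_p(B,\Omega)$ and $\mathbb W_p(\mathcal M(B,\Omega))$. A graph $G$ and a map $W$ are matched by it exactly if there is a correspondence as follows. Pairs of $G$ are sent bijectively to half-edges at black vertices of $W$ (cilia excluded), which carry the colors that do not join the two vertices of the pair. Edges of color $0$ are sent bijectively to corners without cilium at black vertices, each corner going clockwise from the half-edge of the black end to the half-edge of the white end; free vertices are sent to the sides of cilia. Bubbles of $G$ are sent bijectively to blue submaps, compatibly with isomorphisms to $(B,\Omega)$ and to $\mathcal M(B,\Omega)$. For each $i\in[D]$, faces of color $i$ of $G$ are sent bijectively to the faces of color $i$ of $W$ that go along at least one black vertex, and broken faces to broken faces, compatibly with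 the correspondence between edges of color $0$ and corners. 3. For every reduced map $\widetilde{\mathcal M}$ (of both kinds, which exist), each $W\in\mathbb W_p(\widetilde{\mathcal M})$ represents, through a correspondence as in 2 with $\widetilde{\mathcal M}$ in place of $\mathcal M(B,\Omega)$, exactly one element of $\mathbb G_p(B,\Omega)$; every element is represented; and the resulting surjection $\mathbb W_p(\widetilde{\mathcal M})\to\mathbb G_p(B,\Omega)$ is a bijection if the choices are symmetric (which is possible for stars). Moreover all faces are preserved: every face, broken or not, of color $i$ of $W$ goes along a black vertex, where a blue vertex that is isolated in $W^{(i)}$ is not counted as a face. -/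

import Mathlib

/-! ### Edge-colored graphs

In a bipartite properly edge-colored graph, the edges of a given color form a (partial) matching
between the white and the black vertices.  A color which is present at every vertex is therefore a
bijection from white to black vertices, and a color which may be missing at some vertices is a
partial bijection.  Different colors may join the same two vertices (multiple edges). -/

/-- Two vertices are related if they are the ends of an edge of one of the colors `1, …, D`. -/
def ColorAdj {D : ℕ} {V V' : Type} (edge : Fin D → V ≃ V') (u v : V ⊕ V') : Prop :=
  ∃ i x, u = Sum.inl x ∧ v = Sum.inr (edge i x)

/-- A bubble: a finite connected closed graph with the colors `1, …, D` (indexed by `Fin D`). -/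
structure Bubble (D : ℕ) where
  white : Type
  black : Type
  finite_white : Finite white
  finite_black : Finite black
  /-- `edge i x` is the black end of the edge of color `i` at the white vertex `x`. -/
  edge : Fin D → white ≃ black
  nonempty : Nonempty (white ⊕ black)
  connected : ∀ u v : white ⊕ black, Relation.EqvGen (ColorAdj edge) u v

/-- A pairing of the vertices of a bubble: a partition into pairs (white vertex, black vertex). -/
abbrev Bubble.Pairing {D : ℕ} (B : Bubble D) : Type := B.white ≃ B.black

/-- The permutation `τ i` of the pairs (a pair is named by its white vertex): there is an edge of
color `i` from the white vertex of the pair `x` to the black vertex of the pair `τ i x`. -/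
def Bubble.tau {D : ℕ} (B : Bubble D) (Ω : B.Pairing) (i : Fin D) : Equiv.Perm B.white :=
  (B.edge i).trans Ω.symm

/-- A finite graph with colors `0, 1, …, D` in which every vertex has exactly one edge of each of
the colors `1, …, D` and at most one edge of color `0`. -/
structure ColoredGraph (D : ℕ) where
  white : Type
  black : Type
  finite_white : Finite white
  finite_black : Finite black
  edge : Fin D → white ≃ black
  /-- the edges of color `0` -/
  edge0 : white ≃. black

namespace ColoredGraph

variable {D : ℕ} (G : ColoredGraph D)

/-- The vertices of `G`. -/
abbrev Vertex : Type := G.white ⊕ G.black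

/-- A vertex is free if it has no edge of color `0`. -/
def IsFree : G.Vertex → Prop
  | Sum.inl x => G.edge0 x = none
  | Sum.inr y => G.edge0.symm y = none

/-- Two vertices are related if they are the ends of an edge of color `0`. -/
def Adj0 (u v : G.Vertex) : Prop :=
  ∃ x y, G.edge0 x = some y ∧ u = Sum.inl x ∧ v = Sum.inr y

/-- The edges of color `0`, given by their white and black ends. -/
def ZeroEdge : Type := {e : G.white × G.black // G.edge0 e.1 = some e.2}

/-- `G` is connected (and not empty). -/
def Connected : Prop :=
  Nonempty G.Vertex ∧
    ∀ u v : G.Vertex, Relation.EqvGen (fun u v => ColorAdj G.edge u v ∨ G.Adj0 u v) u v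

/-- Being in the same connected component after deletion of all edges of color `0`. -/
def compSetoid : Setoid G.Vertex := Relation.EqvGen.setoid (ColorAdj G.edge)

/-- The connected components of the graph obtained by removing all edges of color `0`. -/
def Comp : Type := Quotient G.compSetoid

/-- The component of a vertex. -/
def comp (v : G.Vertex) : G.Comp := Quotient.mk G.compSetoid v

/-- Being in the same connected component of the subgraph with the colors `0` and `i`. -/
def faceSetoid (i : Fin D) : Setoid G.Vertex :=
  Relation.EqvGen.setoid (fun u v => (∃ x, u = Sum.inl x ∧ v = Sum.inr (G.edge i x)) ∨ G.Adj0 u v)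

/-- The faces of color `i`, broken or not: the maximal chains alternating the colors `0` and `i`. -/
def Face (i : Fin D) : Type := Quotient (G.faceSetoid i)

/-- The face of color `i`, broken or not, through a vertex. -/
def face (i : Fin D) (v : G.Vertex) : G.Face i := Quotient.mk (G.faceSetoid i) v

/-- The face is a closed chain, that is, it has no free vertex.  Otherwise it is a broken face. -/
def IsClosedFace {i : Fin D} (F : G.Face i) : Prop := ∀ v, G.face i v = F → ¬ G.IsFree v

/-- An isomorphism from a bubble to a component of `G` with the edges of color `0` removed. -/
structure CompIso (B : Bubble D) (C : G.Comp) where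
  white : B.white ≃ {x : G.white // G.comp (Sum.inl x) = C}
  black : B.black ≃ {y : G.black // G.comp (Sum.inr y) = C}
  map_edge : ∀ i x, (black (B.edge i x)).1 = G.edge i (white x).1

/-- The members of `𝔾_p(B)`: connected graphs with `p` free white and `p` free black vertices in
which all components left after removing the color `0` are isomorphic to `B`. -/
structure IsBuiltFrom (B : Bubble D) (p : ℕ) : Prop where
  connected : G.Connected
  free_white : Nat.card {x : G.white // G.IsFree (Sum.inl x)} = p
  free_black : Nat.card {y : G.black // G.IsFree (Sum.inr y)} = p
  comp_iso : ∀ C : G.Comp, Nonempty (G.CompIso B C)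

/-- Isomorphisms of colored graphs; they preserve the vertex colors and all edge colors. -/
structure Iso (G H : ColoredGraph D) where
  white : G.white ≃ H.white
  black : G.black ≃ H.black
  map_edge : ∀ i x, black (G.edge i x) = H.edge i (white x)
  map_edge0 : ∀ x y, G.edge0 x = some y ↔ H.edge0 (white x) = some (black y)

theorem Iso.equivalence : Equivalence (fun G H : ColoredGraph D => Nonempty (Iso G H)) where
  refl G := ⟨⟨Equiv.refl _, Equiv.refl _, fun _ _ => rfl, fun _ _ => Iff.rfl⟩⟩
  symm := by
    rintro G H ⟨f⟩
    refine ⟨⟨f.white.symm, f.black.symm, fun i x => ?_, fun x y => ?_⟩⟩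
    · rw [Equiv.symm_apply_eq, f.map_edge, Equiv.apply_symm_apply]
    · rw [f.map_edge0, Equiv.apply_symm_apply, Equiv.apply_symm_apply]
  trans := by
    rintro G H K ⟨f⟩ ⟨g⟩
    refine ⟨⟨f.white.trans g.white, f.black.trans g.black, fun i x => ?_, fun x y => ?_⟩⟩
    · simp [f.map_edge, g.map_edge]
    · simp [f.map_edge0, g.map_edge0]

end ColoredGraph

/-- A colored graph together with a pairing of its white with its black vertices. -/
structure PairedGraph (D : ℕ) extends ColoredGraph D where
  pairing : white ≃ black

namespace PairedGraph

variable {D : ℕ}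

/-- An isomorphism from a bubble equipped with a pairing to a component (with the restricted
pairing) of a paired graph with the edges of color `0` removed. -/
structure CompIso (G : PairedGraph D) (B : Bubble D) (Ω : B.Pairing) (C : G.Comp)
    extends G.toColoredGraph.CompIso B C where
  map_pairing : ∀ x, (black (Ω x)).1 = G.pairing (white x).1

/-- `G` is a member of `𝔾_p(B)` and its pairing is induced by `Ω`: every component left after
removing the color `0`, with its pairs, is isomorphic to `B` equipped with `Ω`. -/
structure IsBuiltFrom (G : PairedGraph D) (B : Bubble D) (Ω : B.Pairing) (p : ℕ) : Prop where
  graph : G.toColoredGraph.IsBuiltFrom B p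
  comp_iso : ∀ C : G.Comp, Nonempty (G.CompIso B Ω C)

/-- Isomorphisms of paired graphs. -/
structure Iso (G H : PairedGraph D) extends ColoredGraph.Iso G.toColoredGraph H.toColoredGraph where
  map_pairing : ∀ x, black (G.pairing x) = H.pairing (white x)

theorem Iso.equivalence : Equivalence (fun G H : PairedGraph D => Nonempty (Iso G H)) where
  refl G := ⟨⟨⟨Equiv.refl _, Equiv.refl _, fun _ _ => rfl, fun _ _ => Iff.rfl⟩, fun _ => rfl⟩⟩
  symm := by
    rintro G H ⟨f⟩
    refine ⟨⟨⟨f.white.symm, f.black.symm, fun i x => ?_, fun x y => ?_⟩, fun x => ?_⟩⟩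
    · rw [Equiv.symm_apply_eq, f.map_edge, Equiv.apply_symm_apply]
    · rw [f.map_edge0, Equiv.apply_symm_apply, Equiv.apply_symm_apply]
    · rw [Equiv.symm_apply_eq, f.map_pairing, Equiv.apply_symm_apply]
  trans := by
    rintro G H K ⟨f⟩ ⟨g⟩
    refine ⟨⟨⟨f.white.trans g.white, f.black.trans g.black, fun i x => ?_, fun x y => ?_⟩,
      fun x => ?_⟩⟩
    · simp [f.map_edge, g.map_edge]
    · simp [f.map_edge0, g.map_edge0]
    · simp [f.map_pairing, g.map_pairing]

end PairedGraph

/-- Isomorphism of graphs in `𝔾_p(B)`. -/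
def graphSetoid {D : ℕ} (B : Bubble D) (p : ℕ) :
    Setoid {G : ColoredGraph D // G.IsBuiltFrom B p} where
  r G H := Nonempty (ColoredGraph.Iso G.1 H.1)
  iseqv := ColoredGraph.Iso.equivalence.comap Subtype.val

/-- Isomorphism of graphs in `𝔾_p(B)` with the pairing induced by `Ω`. -/
def pairedGraphSetoid {D : ℕ} (B : Bubble D) (Ω : B.Pairing) (p : ℕ) :
    Setoid {G : PairedGraph D // G.IsBuiltFrom B Ω p} where
  r G H := Nonempty (PairedGraph.Iso G.1 H.1)
  iseqv := PairedGraph.Iso.equivalence.comap Subtype.val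

/-- The set `𝔾_p(B)` of (unlabeled) graphs built from the bubble `B`. -/
def GraphClass {D : ℕ} (B : Bubble D) (p : ℕ) : Type 1 := Quotient (graphSetoid B p)

/-- The set `𝔾_p(B)` of (unlabeled) graphs built from the bubble `B` equipped with `Ω`. -/
def PairedGraphClass {D : ℕ} (B : Bubble D) (Ω : B.Pairing) (p : ℕ) : Type 1 :=
  Quotient (pairedGraphSetoid B Ω p)

/-- Forgetting the induced pairing. -/
def forgetPairing {D : ℕ} (B : Bubble D) (Ω : B.Pairing) (p : ℕ) :
    PairedGraphClass B Ω p → GraphClass B p :=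
  Quotient.map (fun G => ⟨G.1.toColoredGraph, G.2.graph⟩) (fun _ _ ⟨f⟩ => ⟨f.toIso⟩)

/-- The pairing is preserved by all automorphisms of the bubble. -/
def Bubble.Pairing.IsInvariant {D : ℕ} {B : Bubble D} (Ω : B.Pairing) : Prop :=
  ∀ (f : Equiv.Perm B.white) (g : Equiv.Perm B.black),
    (∀ i x, g (B.edge i x) = B.edge i (f x)) → ∀ x, g (Ω x) = Ω (f x)

/-- The automorphisms of the bubble `B` equipped with the pairing `Ω`, acting on the white
vertices, that is, on the pairs (they act on the black vertices through the pairing). -/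
def Bubble.IsPairAut {D : ℕ} (B : Bubble D) (Ω : B.Pairing) (f : Equiv.Perm B.white) : Prop :=
  ∃ g : Equiv.Perm B.black, (∀ i x, g (B.edge i x) = B.edge i (f x)) ∧ ∀ x, g (Ω x) = Ω (f x)

/-! ### Combinatorial maps with colored edges and cilia -/

/-- A finite combinatorial map given by its half-edges (darts): `σ` sends a half-edge to the next
one clockwise around its vertex, `α` exchanges the two half-edges of an edge, and a cilium is a
dart fixed by `α`.  Each edge carries a set of colors (a singleton for an ordinary edge-colored
map); a cilium is considered as having all colors.  Vertices are the cycles of `σ`. -/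
structure CMap (D : ℕ) where
  dart : Type
  finite_dart : Finite dart
  σ : Equiv.Perm dart
  α : dart → dart
  α_invol : Function.Involutive α
  color : dart → Finset (Fin D)
  color_α : ∀ d, color (α d) = color d

namespace CMap

variable {D : ℕ} (M : CMap D)

/-- Cilia are the darts fixed by `α`. -/
def IsCilium (d : M.dart) : Prop := M.α d = d

/-- Being in the same connected component. -/
def compSetoid : Setoid M.dart := Relation.EqvGen.setoid (fun d d' => d' = M.σ d ∨ d' = M.α d)

/-- The connected components of the map. -/
def Comp : Type := Quotient M.compSetoid

/-- The connected component of a dart. -/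
def comp (d : M.dart) : M.Comp := Quotient.mk M.compSetoid d

/-- The map is connected (and not empty). -/
def Connected : Prop := Nonempty M.dart ∧ ∀ d d' : M.dart, M.comp d = M.comp d'

/-- An isomorphism of maps from `M` to a connected component of the map `N`. -/
structure CompIso (M N : CMap D) (C : N.Comp) where
  toEquiv : M.dart ≃ {d : N.dart // N.comp d = C}
  map_σ : ∀ d, (toEquiv (M.σ d)).1 = N.σ (toEquiv d).1
  map_α : ∀ d, (toEquiv (M.α d)).1 = N.α (toEquiv d).1
  map_color : ∀ d, N.color (toEquiv d).1 = M.color d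

/-- Follow a face of color `i`.  A dart `d` stands for the corner between `d` and `σ d`.  One goes
clockwise along this corner; the edge reached at its end is followed if it carries the color `i`
and ignored (it has been removed from the monochromatic submap) otherwise. -/
def faceStep (i : Fin D) (d : M.dart) : M.dart :=
  if i ∈ M.color (M.σ d) then M.α (M.σ d) else M.σ d

/-- Two corners are in the same (broken or closed) face of color `i`: the faces of the
monochromatic submap of color `i`, cut at the cilia.  The cilium `d` stands for the corner which
starts at `d`, so that a broken face begins with a cilium and ends before the next one. -/
def faceSetoid (i : Fin D) : Setoid M.dart :=
  Relation.EqvGen.setoid (fun d d' => d' = M.faceStep i d ∧ ¬ M.IsCilium d')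

/-- The faces of color `i` of the map, broken or not, including those which consist of all the
corners of a vertex that is isolated in the monochromatic submap of color `i`. -/
def Face (i : Fin D) : Type := Quotient (M.faceSetoid i)

/-- The face of color `i`, broken or not, along a corner. -/
def face (i : Fin D) (d : M.dart) : M.Face i := Quotient.mk (M.faceSetoid i) d

/-- The face is a closed one, that is, it meets no cilium.  Otherwise it is a broken face. -/
def IsClosedFace {i : Fin D} (F : M.Face i) : Prop := ∀ d, M.face i d = F → ¬ M.IsCilium d

end CMap

/-- A map whose vertices are black or blue. -/
structure WalshMap (D : ℕ) extends CMap D where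
  /-- the darts at black vertices; the other darts are at blue vertices -/
  black : Set dart
  black_σ : ∀ d, σ d ∈ black ↔ d ∈ black

namespace WalshMap

variable {D : ℕ}

open Classical in
/-- The map obtained by removing the black vertices and replacing the edges incident to them by
cilia at the blue vertices. -/
noncomputable def blueMap (W : WalshMap D) : CMap D where
  dart := {d : W.dart // d ∉ W.black}
  finite_dart := have := W.finite_dart; inferInstance
  σ := W.σ.subtypePerm (fun d => not_congr (W.black_σ d))
  α d := if h : W.α d.1 ∈ W.black then d else ⟨W.α d.1, h⟩
  α_invol := by
    intro d
    by_cases h : W.α d.1 ∈ W.black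
    · simp [h]
    · have h2 : W.α (W.α d.1) ∉ W.black := by rw [W.α_invol]; exact d.2
      simp only [h, dite_false, h2]
      exact Subtype.ext (W.α_invol d.1)
  color d := if W.α d.1 ∈ W.black then Finset.univ else W.color d.1
  color_α := by
    intro d
    by_cases h : W.α d.1 ∈ W.black
    · simp [h]
    · have h2 : W.α (W.α d.1) ∉ W.black := by rw [W.α_invol]; exact d.2
      simp [h, h2, W.color_α]

/-- The half-edges at black vertices which belong to an edge (and are not a cilium). -/
def BlackHalfEdge (W : WalshMap D) : Type := {d : W.dart // d ∈ W.black ∧ ¬ W.IsCilium d}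

/-- The corners at black vertices between two consecutive half-edges `d` and `σ d` without a cilium
in it (a corner with a cilium represents a missing edge of color `0`). -/
def BlackCorner (W : WalshMap D) : Type :=
  {d : W.dart // d ∈ W.black ∧ ¬ W.IsCilium d ∧ ¬ W.IsCilium (W.σ d)}

/-- The face goes along at least one black vertex. -/
def MeetsBlack (W : WalshMap D) {i : Fin D} (F : W.Face i) : Prop :=
  ∃ d ∈ W.black, W.face i d = F

/-- The face consists of corners of blue vertices with no incident edge of color `i`, that is, it is
a blue vertex which is isolated in the monochromatic submap of color `i`. -/
def IsIsolatedBlue (W : WalshMap D) {i : Fin D} (F : W.Face i) : Prop :=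
  ∀ d, W.face i d = F → d ∉ W.black ∧ ∀ d', W.σ.SameCycle d d' → i ∉ W.color d'

/-- The members of `𝕎_p(M)`: stuffed Walsh maps with submaps `M` and with `p` cilia. -/
structure IsStuffed (W : WalshMap D) (M : CMap D) (p : ℕ) : Prop where
  connected : W.Connected
  /-- black vertices are only connected to blue vertices -/
  bipartite : ∀ d ∈ W.black, ¬ W.IsCilium d → W.α d ∉ W.black
  /-- the blue submaps are all isomorphic to `M` -/
  submaps : ∀ C : W.blueMap.Comp, Nonempty (CMap.CompIso M W.blueMap C)
  /-- an edge between a black and a blue vertex carries the set of all colors of the edges of the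
  blue submap at the blue vertex -/
  label : ∀ d, d ∉ W.black → W.α d ∈ W.black → ∀ i,
    (i ∈ W.color d ↔ ∃ d', W.σ.SameCycle d d' ∧ W.α d' ∉ W.black ∧ i ∈ W.color d')
  /-- cilia are attached to black vertices -/
  cilium_black : ∀ d, W.IsCilium d → d ∈ W.black
  /-- a vertex has at most one cilium -/
  cilium_unique : ∀ d d', W.IsCilium d → W.IsCilium d' → W.σ.SameCycle d d' → d = d'
  /-- a black vertex is always connected to a blue vertex (it does not consist of just a cilium) -/
  cilium_ne : ∀ d, W.IsCilium d → W.σ d ≠ d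
  /-- a cilium has all colors -/
  cilium_color : ∀ d, W.IsCilium d → W.color d = Finset.univ
  card_cilia : Nat.card {d : W.dart // W.IsCilium d} = p

/-- Isomorphisms of maps with black and blue vertices. -/
structure Iso (W W' : WalshMap D) where
  toEquiv : W.dart ≃ W'.dart
  map_σ : ∀ d, toEquiv (W.σ d) = W'.σ (toEquiv d)
  map_α : ∀ d, toEquiv (W.α d) = W'.α (toEquiv d)
  map_color : ∀ d, W'.color (toEquiv d) = W.color d
  map_black : ∀ d, toEquiv d ∈ W'.black ↔ d ∈ W.black

theorem Iso.equivalence : Equivalence (fun W W' : WalshMap D => Nonempty (Iso W W')) where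
  refl W := ⟨⟨Equiv.refl _, fun _ => rfl, fun _ => rfl, fun _ => rfl, fun _ => Iff.rfl⟩⟩
  symm := by
    rintro W W' ⟨f⟩
    refine ⟨⟨f.toEquiv.symm, fun d => ?_, fun d => ?_, fun d => ?_, fun d => ?_⟩⟩
    · rw [Equiv.symm_apply_eq, f.map_σ, Equiv.apply_symm_apply]
    · rw [Equiv.symm_apply_eq, f.map_α, Equiv.apply_symm_apply]
    · rw [← f.map_color, Equiv.apply_symm_apply]
    · rw [← f.map_black, Equiv.apply_symm_apply]
  trans := by
    rintro W W' W'' ⟨f⟩ ⟨g⟩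
    refine ⟨⟨f.toEquiv.trans g.toEquiv, fun d => ?_, fun d => ?_, fun d => ?_, fun d => ?_⟩⟩
    · simp [f.map_σ, g.map_σ]
    · simp [f.map_α, g.map_α]
    · simp [f.map_color, g.map_color]
    · simp [f.map_black, g.map_black]

end WalshMap

/-- Isomorphism of stuffed Walsh maps. -/
def walshSetoid {D : ℕ} (M : CMap D) (p : ℕ) :
    Setoid {W : WalshMap D // W.IsStuffed M p} where
  r W W' := Nonempty (WalshMap.Iso W.1 W'.1)
  iseqv := WalshMap.Iso.equivalence.comap Subtype.val

/-- The set `𝕎_p(M)` of (unlabeled) stuffed Walsh maps. -/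
def WalshClass {D : ℕ} (M : CMap D) (p : ℕ) : Type 1 := Quotient (walshSetoid M p)

/-! ### The map of a bubble with a pairing, and the reduced maps -/

section BubbleMap

variable {D : ℕ} (B : Bubble D) (Ω : B.Pairing)

/-- The darts of the map of `(B, Ω)` from which the edges listed in `R` have been removed.  There is
one vertex with one cilium for each pair `x`, and an edge of color `i` from `x` to `τ i x` whenever
`τ i x ≠ x`; this edge is removed if `x ∈ R i`. -/
inductive BubbleDart (R : Fin D → Set B.white) : Type
  | cilium (x : B.white)
  | out (i : Fin D) (x : B.white) (h : B.tau Ω i x ≠ x ∧ x ∉ R i)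
  | inc (i : Fin D) (x : B.white) (h : B.tau Ω i x ≠ x ∧ (B.tau Ω i).symm x ∉ R i)

namespace BubbleDart

variable {B Ω} {R : Fin D → Set B.white}

/-- The vertex (pair) of a dart. -/
def vertex : BubbleDart B Ω R → B.white
  | cilium x => x
  | out _ x _ => x
  | inc _ x _ => x

/-- The kind of a dart: cilium, outgoing of color `i` or ingoing of color `i`. -/
def kind : BubbleDart B Ω R → Option (Fin D × Bool)
  | cilium _ => none
  | out i _ _ => some (i, true)
  | inc i _ _ => some (i, false)

/-- The edge of color `i` which goes out at `x` goes in at `τ i x`. -/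
def flip : BubbleDart B Ω R → BubbleDart B Ω R
  | cilium x => cilium x
  | out i x h => inc i (B.tau Ω i x) ⟨fun e => h.1 ((B.tau Ω i).injective e), by simpa using h.2⟩
  | inc i x h => out i ((B.tau Ω i).symm x)
      ⟨fun e => h.1 (by
        have := congrArg (B.tau Ω i) e
        simpa only [Equiv.apply_symm_apply] using this), h.2⟩

/-- The set of colors of a dart. -/
def color : BubbleDart B Ω R → Finset (Fin D)
  | cilium _ => Finset.univ
  | out i _ _ => {i}
  | inc i _ _ => {i}

theorem flip_flip (d : BubbleDart B Ω R) : d.flip.flip = d := by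
  cases d <;> simp [flip]

theorem color_flip (d : BubbleDart B Ω R) : d.flip.color = d.color := by
  cases d <;> rfl

theorem finite : Finite (BubbleDart B Ω R) := by
  have := B.finite_white
  refine Finite.of_injective (fun d => (d.vertex, d.kind)) ?_
  rintro (x | ⟨i, x, h⟩ | ⟨i, x, h⟩) (y | ⟨j, y, h'⟩ | ⟨j, y, h'⟩) e <;>
    simp [vertex, kind] at e <;> grind

end BubbleDart

/-- `σ` is an admissible cyclic order of the darts around the vertices: its cycles are the vertices,
and going clockwise around a vertex one meets the cilium, then all the outgoing half-edges, then all
the ingoing ones.  The relative order between the colors is arbitrary. -/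
def IsRotation (R : Fin D → Set B.white) (σ : Equiv.Perm (BubbleDart B Ω R)) : Prop :=
  (∀ d d', σ.SameCycle d d' ↔ d.vertex = d'.vertex) ∧
    ∀ d i, d.kind = some (i, false) →
      (σ d).kind = none ∨ ∃ j, (σ d).kind = some (j, false)

/-- The symmetries of `(B, Ω)` preserve the set of removed edges and the order around the vertices
(for instance, no edge is removed and the colors are ordered in the same way at all vertices). -/
def IsSymmRotation (R : Fin D → Set B.white) (σ : Equiv.Perm (BubbleDart B Ω R)) : Prop :=
  ∀ f, B.IsPairAut Ω f → (∀ i x, f x ∈ R i ↔ x ∈ R i) ∧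
    ∀ d d', d'.vertex = f d.vertex → d'.kind = d.kind → (σ d').kind = (σ d).kind

/-- The map of `(B, Ω)` from which the edges in `R` have been removed. -/
def bubbleMap (R : Fin D → Set B.white) (σ : Equiv.Perm (BubbleDart B Ω R)) : CMap D where
  dart := BubbleDart B Ω R
  finite_dart := BubbleDart.finite
  σ := σ
  α := BubbleDart.flip
  α_invol := BubbleDart.flip_flip
  color := BubbleDart.color
  color_α := BubbleDart.color_flip

/-- No edge is removed: `bubbleMap B Ω (noCut B) σ` is the map `M(B, Ω)`. -/
def noCut : Fin D → Set B.white := fun _ => ∅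

/-- `R` consists of exactly one edge of color `i` of each cycle of color `i`, for each `i`: then
`bubbleMap B Ω R σ` is a reduced map. -/
def IsCut (R : Fin D → Set B.white) : Prop :=
  ∀ i, (∀ x ∈ R i, B.tau Ω i x ≠ x) ∧
    ∀ x, B.tau Ω i x ≠ x → ∃! y, (B.tau Ω i).SameCycle x y ∧ y ∈ R i

/-- The darts at the ciliated vertices of the other reduced map, in which each cycle of color `i` is
replaced by a star: the cilium and one half-edge of color `i` whenever `τ i x ≠ x`. -/
inductive StarDart : Type
  | cilium (x : B.white)
  | leaf (i : Fin D) (x : B.white) (h : B.tau Ω i x ≠ x)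

namespace StarDart

variable {B Ω}

/-- The vertex (pair) of a dart. -/
def vertex : StarDart B Ω → B.white
  | cilium x => x
  | leaf _ x _ => x

/-- The kind of a dart: cilium or half-edge of color `i`. -/
def kind : StarDart B Ω → Option (Fin D)
  | cilium _ => none
  | leaf i _ _ => some i

theorem finite : Finite (StarDart B Ω) := by
  have := B.finite_white
  refine Finite.of_injective (fun d => (d.vertex, d.kind)) ?_
  rintro (x | ⟨i, x, h⟩) (y | ⟨j, y, h'⟩) e <;> simp [vertex, kind] at e <;> grind

end StarDart

/-- The darts at the added vertices (the centers of the stars): one for each pair `x` and each color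
`i` with `τ i x ≠ x`. -/
def CenterDart : Type := {c : Fin D × B.white // B.tau Ω c.1 c.2 ≠ c.2}

/-- The order of the edges around the center of a star is the order along the cycle. -/
def centerRotation : Equiv.Perm (CenterDart B Ω) where
  toFun c := ⟨(c.1.1, B.tau Ω c.1.1 c.1.2), fun e => c.2 ((B.tau Ω c.1.1).injective e)⟩
  invFun c := ⟨(c.1.1, (B.tau Ω c.1.1).symm c.1.2), fun e => c.2 (by
    have := congrArg (B.tau Ω c.1.1) e
    simpa only [Equiv.apply_symm_apply] using this)⟩
  left_inv c := Subtype.ext (by simp)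
  right_inv c := Subtype.ext (by simp)

/-- `σ` is a cyclic order of the darts around the ciliated vertices. -/
def IsStarRotation (σ : Equiv.Perm (StarDart B Ω)) : Prop :=
  ∀ d d', σ.SameCycle d d' ↔ d.vertex = d'.vertex

/-- The symmetries of `(B, Ω)` preserve the order around the ciliated vertices. -/
def IsSymmStarRotation (σ : Equiv.Perm (StarDart B Ω)) : Prop :=
  ∀ f, B.IsPairAut Ω f →
    ∀ d d', d'.vertex = f d.vertex → d'.kind = d.kind → (σ d').kind = (σ d).kind

/-- The reduced map of `(B, Ω)` in which the cycles of each color are replaced by stars. -/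
def starMap (σ : Equiv.Perm (StarDart B Ω)) : CMap D where
  dart := StarDart B Ω ⊕ CenterDart B Ω
  finite_dart := by
    have := B.finite_white
    have := StarDart.finite (B := B) (Ω := Ω)
    have : Finite (CenterDart B Ω) := by unfold CenterDart; infer_instance
    infer_instance
  σ := Equiv.sumCongr σ (centerRotation B Ω)
  α
    | Sum.inl (StarDart.cilium x) => Sum.inl (StarDart.cilium x)
    | Sum.inl (StarDart.leaf i x h) => Sum.inr ⟨(i, x), h⟩
    | Sum.inr c => Sum.inl (StarDart.leaf c.1.1 c.1.2 c.2)
  α_invol := by rintro ((x | ⟨i, x, h⟩) | c) <;> rfl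
  color
    | Sum.inl (StarDart.cilium _) => Finset.univ
    | Sum.inl (StarDart.leaf i _ _) => {i}
    | Sum.inr c => {c.1.1}
  color_α := by rintro ((x | ⟨i, x, h⟩) | c) <;> rfl

end BubbleMap

/-! ### The correspondence between graphs and maps -/

/-- The way in which a stuffed Walsh map `W` represents a graph `G` built from the bubble `B` with
the pairing `Ω`, where the blue submaps of `W` are copies of the map `M` whose cilium for the pair
`x` of `Ω` is `cil x`. -/
structure Correspondence {D : ℕ} (B : Bubble D) (Ω : B.Pairing) (M : CMap D)
    (cil : B.white → M.dart) (G : PairedGraph D) (W : WalshMap D) where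
  /-- pairs of vertices of `G` (named by the white vertex) are sent to the half-edges at the black
  vertices of `W` -/
  pair : G.white ≃ W.BlackHalfEdge
  /-- the half-edge is labeled by the colors which do not join the two vertices of the pair -/
  label : ∀ x i, i ∈ W.color (pair x).1 ↔ G.edge i x ≠ G.pairing x
  /-- edges of color `0` are sent to the corners of black vertices … -/
  corner : G.ZeroEdge ≃ W.BlackCorner
  /-- … which go clockwise from the half-edge of the pair of the black end … -/
  corner_black : ∀ e, (corner e).1 = (pair (G.pairing.symm e.1.2)).1
  /-- … to the half-edge of the pair of the white end -/
  corner_white : ∀ e, W.σ (corner e).1 = (pair e.1.1).1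
  /-- free vertices are sent to the two sides of the cilia -/
  free_white : ∀ x, G.IsFree (Sum.inl x) ↔ W.IsCilium (W.σ.symm (pair x).1)
  free_black : ∀ x, G.IsFree (Sum.inr (G.pairing x)) ↔ W.IsCilium (W.σ (pair x).1)
  /-- bubbles are sent to blue submaps … -/
  bubble : G.Comp ≃ W.blueMap.Comp
  /-- … so that the pairs of a bubble are sent to the edges incident to its submap … -/
  bubble_pair : ∀ x (d : W.blueMap.dart), d.1 = W.α (pair x).1 →
    bubble (G.comp (Sum.inl x)) = W.blueMap.comp d
  /-- … and a copy of `B` is sent to a copy of `M`, each pair to its cilium -/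
  bubble_iso : ∀ C, ∃ (f : G.CompIso B Ω C) (g : CMap.CompIso M W.blueMap (bubble C)),
    ∀ x, (g.toEquiv (cil x)).1.1 = W.α (pair (f.white x).1).1
  /-- the faces of color `i` are sent to the faces of color `i` along at least one black vertex -/
  face : ∀ i, G.Face i ≃ {F : W.Face i // W.MeetsBlack F}
  /-- the face through a vertex is sent to the face along the corner which represents the edge of
  color `0` at this vertex (or the side of a cilium, if the vertex is free) -/
  face_white : ∀ i x, (face i (G.face i (Sum.inl x))).1 = W.face i (W.σ.symm (pair x).1)
  face_black : ∀ i x, (face i (G.face i (Sum.inr (G.pairing x)))).1 = W.face i (pair x).1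
  /-- closed faces are sent to closed faces, hence broken faces to broken faces -/
  face_closed : ∀ i F, G.IsClosedFace F ↔ W.IsClosedFace (face i F).1

/-- All faces of `W` are along black vertices, except for the blue vertices which are isolated in
the monochromatic submap of the color of the face. -/
def WalshMap.AllFacesMeetBlack {D : ℕ} (W : WalshMap D) : Prop :=
  ∀ (i : Fin D) (F : W.Face i), W.MeetsBlack F ∨ W.IsIsolatedBlue F

/-! ### Following the faces of a map from cilium to cilium -/

/-! A paired graph and a stuffed Walsh map are two ways to draw the same data on the set of pairs.
In the graph, the color `0` is a partial permutation of the pairs (from the pair of the black end to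
the pair of the white end), and the color `i` acts by a permutation, which is `τ i` in each bubble.
In the map, pairs are half-edges at black vertices. The rotation there gives the partial
permutation: black vertices are its cycles and its open chains, each chain being closed by one
cilium. The action of the color `i` is read off inside a blue submap, by following the face of color
`i` from one cilium to the next. `CoreCorrespondence` records just this agreement; labels, bubbles,
corners and faces follow from it (`toCorrespondence`), and every correspondence contains it
(`toCore`).

All that matters about the submap `M` is collected in `RepresentsBubble`, so the full map and both
kinds of reduced maps are handled together by `exists_representation`. A map determines its graph up
to isomorphism (`exists_core`, `isoOfSameMap`). Conversely, a graph gives a map by closing the open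
chains (`PEquiv.exists_closure`) and gluing in one copy of `M` for each bubble (`exists_stuffed`).
Two maps of the same graph can differ only because the copies of `M` were attached through different
isomorphisms with `(B, Ω)`, that is, up to an automorphism of `(B, Ω)`. If the automorphisms act on
`M`, the maps are isomorphic (`nonempty_iso_of_same_graph`); this is where symmetric choices are
needed.

It remains to see that the broken face starting at the cilium of `x` leads to the cilium of `τ i x`.
With the order cilium, outgoing, ingoing, it leaves by the outgoing edge and arrives by the ingoing
one, after which the next dart of color `i` is the cilium. If the edge was removed, it runs
backwards along the remaining path, whose other end is `τ i x` (`nextCilium_chain`). In a star it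
turns around the center. In a reduced map no face stays inside a blue submap, apart from isolated
vertices (`FacesMeetCilia`), so all faces are preserved.

For the pairings, `Ω` is transported to each bubble by a chosen isomorphism; if `Ω` is invariant,
the choice is irrelevant. -/

theorem Relation.EqvGen.apply_eq {α : Type*} {T : Sort*} {r : α → α → Prop} (F : α → T)
    (hF : ∀ a b, r a b → F a = F b) {a b : α} (h : Relation.EqvGen r a b) : F a = F b := by
  induction h with
  | rel x y h => exact hF x y h
  | refl => rfl
  | symm x y _ ih => exact ih.symm
  | trans x y z _ _ ih1 ih2 => exact ih1.trans ih2

namespace CMap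

variable {D : ℕ} {M N : CMap D} {i : Fin D}

/-- `c` is the next cilium that one meets when following the face of color `i` from the corner
which starts at `d`. -/
inductive NextCilium (M : CMap D) (i : Fin D) : M.dart → M.dart → Prop
  | here (d : M.dart) (h : M.IsCilium (M.faceStep i d)) : NextCilium M i d (M.faceStep i d)
  | step (d c : M.dart) (h : ¬ M.IsCilium (M.faceStep i d))
      (hc : NextCilium M i (M.faceStep i d) c) : NextCilium M i d c

theorem NextCilium.of_isCilium {d c : M.dart} (h : M.faceStep i d = c) (hc : M.IsCilium c) :
    M.NextCilium i d c := by
  subst h; exact .here d hc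

theorem NextCilium.isCilium {d c : M.dart} (h : M.NextCilium i d c) : M.IsCilium c := by
  induction h with
  | here d h => exact h
  | step d c h hc ih => exact ih

theorem NextCilium.unique {d c c' : M.dart} (h : M.NextCilium i d c) (h' : M.NextCilium i d c') :
    c = c' := by
  induction h with
  | here d h =>
    cases h' with
    | here => rfl
    | step _ _ h2 _ => exact absurd h h2
  | step d c h hc ih =>
    cases h' with
    | here _ h2 => exact absurd h2 h
    | step _ _ _ h2 => exact ih h2

theorem nextCilium_step_iff {d c : M.dart} (h : ¬ M.IsCilium (M.faceStep i d)) :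
    M.NextCilium i (M.faceStep i d) c ↔ M.NextCilium i d c := by
  refine ⟨.step d c h, fun h' => ?_⟩
  cases h' with
  | here _ h2 => exact absurd h2 h
  | step _ _ _ h2 => exact h2

theorem comp_σ (d : M.dart) : M.comp (M.σ d) = M.comp d :=
  (Quotient.sound (s := M.compSetoid) (Relation.EqvGen.rel d (M.σ d) (Or.inl rfl))).symm

theorem comp_α (d : M.dart) : M.comp (M.α d) = M.comp d :=
  (Quotient.sound (s := M.compSetoid) (Relation.EqvGen.rel d (M.α d) (Or.inr rfl))).symm

theorem comp_faceStep (d : M.dart) : M.comp (M.faceStep i d) = M.comp d := by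
  unfold faceStep; split_ifs <;> simp [comp_σ, comp_α]

theorem NextCilium.comp_eq {d c : M.dart} (h : M.NextCilium i d c) : M.comp c = M.comp d := by
  induction h with
  | here d h => exact comp_faceStep d
  | step d c h hc ih => rw [ih, comp_faceStep]

/-- A function which is invariant under `σ` and `α` is constant on the components. -/
theorem eq_of_comp_eq {T : Sort*} (F : M.dart → T) (hσ : ∀ d, F (M.σ d) = F d)
    (hα : ∀ d, F (M.α d) = F d) {d d' : M.dart} (h : M.comp d = M.comp d') : F d = F d' := by
  refine Relation.EqvGen.apply_eq F ?_ (Quotient.exact h)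
  rintro x y (rfl | rfl) <;> simp [hσ, hα]

theorem iterate_of_sameCycle {d d' : M.dart} (h : M.σ.SameCycle d d') :
    ∃ n : ℕ, (M.σ ^ n) d = d' := by
  have := M.finite_dart
  have := Fintype.ofFinite M.dart
  obtain ⟨n, -, hn⟩ := h.exists_pow_eq'
  exact ⟨n, hn⟩

/-- A function which is invariant under `σ` is constant on the vertices. -/
theorem eq_of_sameCycle {T : Sort*} (F : M.dart → T) (hσ : ∀ d, F (M.σ d) = F d)
    {d d' : M.dart} (h : M.σ.SameCycle d d') : F d = F d' := by
  obtain ⟨n, rfl⟩ := iterate_of_sameCycle h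
  induction n with
  | zero => rfl
  | succ n ih =>
    rw [pow_succ', Equiv.Perm.mul_apply, hσ]
    exact ih ⟨n, by simp⟩

theorem comp_eq_of_sameCycle {d d' : M.dart} (h : M.σ.SameCycle d d') : M.comp d = M.comp d' :=
  eq_of_sameCycle _ comp_σ h

theorem isCilium_α {d : M.dart} : M.IsCilium (M.α d) ↔ M.IsCilium d := by
  unfold IsCilium
  rw [M.α_invol d]
  exact eq_comm

/-- The face relation is invariant. -/
theorem face_faceStep {d : M.dart} (h : ¬ M.IsCilium (M.faceStep i d)) :
    M.face i (M.faceStep i d) = M.face i d :=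
  (Quotient.sound (s := M.faceSetoid i) (Relation.EqvGen.rel _ _ ⟨rfl, h⟩)).symm

/-- A function which is invariant along the corners of the faces of color `i`, cut at the cilia, is
constant on the faces. -/
theorem eq_of_face_eq {T : Sort*} (F : M.dart → T)
    (hF : ∀ d, ¬ M.IsCilium (M.faceStep i d) → F (M.faceStep i d) = F d) {d d' : M.dart}
    (h : M.face i d = M.face i d') : F d = F d' := by
  refine Relation.EqvGen.apply_eq F ?_ (Quotient.exact h)
  rintro x y ⟨rfl, h⟩
  exact (hF _ h).symm

/-- Both ends of an edge have the same colors, so the image of a dart shows whether its edge was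
followed or skipped. The two branches thus have disjoint images, and each is injective. -/
theorem faceStep_injective : Function.Injective (M.faceStep i) := by
  intro d d' h
  apply M.σ.injective
  unfold faceStep at h
  split_ifs at h with h1 h2 h2
  · exact M.α_invol.injective h
  · rw [← h, M.color_α] at h2; exact absurd h1 h2
  · rw [h, M.color_α] at h1; exact absurd h2 h1
  · exact h

/-- A face which ends at a cilium begins with a cilium. -/
theorem exists_isCilium_of_faceStep {d : M.dart} (h : M.IsCilium (M.faceStep i d)) :
    ∃ c, M.face i c = M.face i d ∧ M.IsCilium c := by
  by_contra! hno
  have := M.finite_dart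
  have hbij : Function.Bijective (M.faceStep i) := Finite.injective_iff_bijective.1 faceStep_injective
  let φ := Equiv.ofBijective _ hbij
  -- In a face without cilia no cut occurs, so the predecessor under `faceStep` is an injective
  -- self-map of the face. By finiteness it is surjective, hence `d` is the predecessor of a dart of
  -- the same face; but the successor of `d` is a cilium.
  have hback : ∀ c : {c // M.face i c = M.face i d}, M.face i (φ.symm c.1) = M.face i d := by
    rintro ⟨c, hc⟩
    have e : M.faceStep i (φ.symm c) = c := φ.apply_symm_apply c
    have := face_faceStep (M := M) (i := i) (d := φ.symm c) (by rw [e]; exact hno c hc)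
    rw [← this, e, hc]
  have hinj : Function.Injective (fun c : {c // M.face i c = M.face i d} =>
      (⟨φ.symm c.1, hback c⟩ : {c // M.face i c = M.face i d})) := by
    intro a b hab
    exact Subtype.ext (φ.symm.injective (congrArg Subtype.val hab))
  obtain ⟨⟨c, hc⟩, hcd⟩ := (Finite.injective_iff_surjective.1 hinj) ⟨d, rfl⟩
  have hcd' : φ.symm c = d := congrArg Subtype.val hcd
  have : M.faceStep i d = c := by rw [← hcd']; exact φ.apply_symm_apply c
  exact hno c hc (this ▸ h)

/-- A map of darts which is compatible with the structure of combinatorial maps. -/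
structure Hom (M N : CMap D) where
  toFun : M.dart → N.dart
  map_σ : ∀ d, toFun (M.σ d) = N.σ (toFun d)
  map_α : ∀ d, toFun (M.α d) = N.α (toFun d)
  map_color : ∀ d, N.color (toFun d) = M.color d

namespace Hom

variable (φ : Hom M N)

theorem map_faceStep (d : M.dart) : φ.toFun (M.faceStep i d) = N.faceStep i (φ.toFun d) := by
  unfold faceStep
  rw [← φ.map_σ, φ.map_color]
  split_ifs <;> simp [φ.map_α, φ.map_σ]

theorem comp_eq {d d' : M.dart} (h : M.comp d = M.comp d') :
    N.comp (φ.toFun d) = N.comp (φ.toFun d') :=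
  eq_of_comp_eq (fun d => N.comp (φ.toFun d)) (fun d => by simp [φ.map_σ, comp_σ])
    (fun d => by simp [φ.map_α, comp_α]) h

theorem map_σ_pow (n : ℕ) (d : M.dart) : φ.toFun ((M.σ ^ n) d) = (N.σ ^ n) (φ.toFun d) := by
  induction n with
  | zero => rfl
  | succ n ih => rw [pow_succ', pow_succ', Equiv.Perm.mul_apply, Equiv.Perm.mul_apply, φ.map_σ, ih]

theorem sameCycle {d d' : M.dart} (h : M.σ.SameCycle d d') :
    N.σ.SameCycle (φ.toFun d) (φ.toFun d') := by
  obtain ⟨n, rfl⟩ := iterate_of_sameCycle h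
  exact ⟨n, by simp [φ.map_σ_pow]⟩

theorem exists_of_sameCycle {d : M.dart} {e : N.dart} (h : N.σ.SameCycle (φ.toFun d) e) :
    ∃ d', φ.toFun d' = e ∧ M.σ.SameCycle d d' := by
  obtain ⟨n, rfl⟩ := iterate_of_sameCycle h
  exact ⟨(M.σ ^ n) d, by simp [φ.map_σ_pow], n, by simp⟩

/-- The range of a morphism is stable under `σ`, its inverse and `α`, so it is a union of
components. -/
theorem mem_range_of_comp_eq (d : M.dart) {e : N.dart} (h : N.comp (φ.toFun d) = N.comp e) :
    e ∈ Set.range φ.toFun := by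
  have := M.finite_dart
  have hσ : ∀ e, (N.σ e ∈ Set.range φ.toFun) = (e ∈ Set.range φ.toFun) := by
    intro e
    refine propext ⟨?_, ?_⟩
    · rintro ⟨d, hd⟩
      refine ⟨M.σ.symm d, N.σ.injective ?_⟩
      rw [← φ.map_σ, Equiv.apply_symm_apply, hd]
    · rintro ⟨d, rfl⟩
      exact ⟨M.σ d, φ.map_σ d⟩
  have hα : ∀ e, (N.α e ∈ Set.range φ.toFun) = (e ∈ Set.range φ.toFun) := by
    intro e
    refine propext ⟨?_, ?_⟩
    · rintro ⟨d, hd⟩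
      exact ⟨M.α d, by rw [φ.map_α, hd, N.α_invol]⟩
    · rintro ⟨d, rfl⟩
      exact ⟨M.α d, φ.map_α d⟩
  have : (φ.toFun d ∈ Set.range φ.toFun) = (e ∈ Set.range φ.toFun) :=
    eq_of_comp_eq (fun e => e ∈ Set.range φ.toFun) hσ hα h
  exact this ▸ ⟨d, rfl⟩

theorem isCilium_iff (hφ : Function.Injective φ.toFun) {d : M.dart} : N.IsCilium (φ.toFun d) ↔ M.IsCilium d := by
  unfold IsCilium
  rw [← φ.map_α]
  exact hφ.eq_iff

theorem nextCilium (hφ : Function.Injective φ.toFun) {d c : M.dart} (h : M.NextCilium i d c) :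
    N.NextCilium i (φ.toFun d) (φ.toFun c) := by
  induction h with
  | here d h =>
    refine .of_isCilium (φ.map_faceStep d).symm ((φ.isCilium_iff hφ).2 h)
  | step d c h hc ih =>
    refine .step _ _ ?_ ?_
    · rwa [← φ.map_faceStep, φ.isCilium_iff hφ]
    · rwa [← φ.map_faceStep]

end Hom

/-- The map of darts of an isomorphism to a component. -/
def CompIso.toHom {C : N.Comp} (g : CompIso M N C) : Hom M N where
  toFun d := (g.toEquiv d).1
  map_σ := g.map_σ
  map_α := g.map_α
  map_color := g.map_color

theorem CompIso.injective {C : N.Comp} (g : CompIso M N C) : Function.Injective g.toHom.toFun :=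
  Subtype.val_injective.comp g.toEquiv.injective

/-- An injective morphism from a connected map is an isomorphism to a component. -/
noncomputable def Hom.toCompIso (φ : Hom M N) (hφ : Function.Injective φ.toFun)
    (hM : ∀ d d', M.comp d = M.comp d') (C : N.Comp) (d₀ : M.dart) (h₀ : N.comp (φ.toFun d₀) = C) :
    CompIso M N C where
  toEquiv := Equiv.ofBijective (fun d => ⟨φ.toFun d, (φ.comp_eq (hM d d₀)).trans h₀⟩) ⟨
    fun a b h => hφ (congrArg Subtype.val h), by
      rintro ⟨e, he⟩
      obtain ⟨d, hd⟩ := φ.mem_range_of_comp_eq d₀ (h₀.trans he.symm)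
      exact ⟨d, Subtype.ext hd⟩⟩
  map_σ := φ.map_σ
  map_α := φ.map_α
  map_color := φ.map_color

end CMap

/-! ### Maps that encode a bubble through their cilia -/

namespace Bubble

variable {D : ℕ} (B : Bubble D) (Ω : B.Pairing)

/-- Contracting each pair to a point turns the connected graph `B` into a connected graph on the
pairs, whose edges go from `x` to `τ i x`. -/
theorem eq_of_tau_invariant {T : Sort*} (h : B.white → T) (hh : ∀ i x, h (B.tau Ω i x) = h x)
    (x y : B.white) : h x = h y :=
  Relation.EqvGen.apply_eq (Sum.elim h (h ∘ Ω.symm))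
    (by rintro _ _ ⟨i, x, rfl, rfl⟩; exact (hh i x).symm) (B.connected (.inl x) (.inl y))

include Ω in
theorem nonempty_white : Nonempty B.white := by
  obtain ⟨x | y⟩ := B.nonempty
  exacts [⟨x⟩, ⟨Ω.symm y⟩]

theorem pairing_tau (i : Fin D) (x : B.white) : Ω (B.tau Ω i x) = B.edge i x :=
  Ω.apply_symm_apply _

theorem tau_eq_iff {i : Fin D} {x y : B.white} : B.tau Ω i x = y ↔ B.edge i x = Ω y := by
  rw [← B.pairing_tau Ω, Ω.apply_eq_iff_eq]

variable {B Ω} in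
theorem IsPairAut.map_tau {f : Equiv.Perm B.white} (hf : B.IsPairAut Ω f) (i : Fin D)
    (x : B.white) : f (B.tau Ω i x) = B.tau Ω i (f x) := by
  obtain ⟨g, hg, hg'⟩ := hf
  rw [eq_comm, tau_eq_iff, ← hg, ← B.pairing_tau Ω, hg']

end Bubble

/-- The map `M` has one cilium `cil x` for each pair `x`, the noncilia at the vertex of this cilium
carry the colors which do not join the two vertices of the pair, and for each color, the broken face
which starts at the cilium of `x` leads to the cilium of `τ i x`. -/
structure CMap.RepresentsBubble {D : ℕ} (M : CMap D) (B : Bubble D) (Ω : B.Pairing)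
    (cil : B.white → M.dart) : Prop where
  cil_injective : Function.Injective cil
  isCilium_iff : ∀ d, M.IsCilium d ↔ ∃ x, cil x = d
  color_cil : ∀ x, M.color (cil x) = Finset.univ
  exists_comp_eq : ∀ d, ∃ x, M.comp d = M.comp (cil x)
  label : ∀ x i, (∃ d, M.σ.SameCycle (cil x) d ∧ ¬ M.IsCilium d ∧ i ∈ M.color d) ↔
    B.tau Ω i x ≠ x
  next : ∀ i x, M.NextCilium i (cil x) (cil (B.tau Ω i x))

/-- Following a face stays inside a component, so the cilia of `x` and of `τ i x` are in the same
one, and each component contains a cilium. -/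
theorem CMap.RepresentsBubble.connected {D : ℕ} {M : CMap D} {B : Bubble D} {Ω : B.Pairing}
    {cil : B.white → M.dart} (hM : M.RepresentsBubble B Ω cil) (d d' : M.dart) :
    M.comp d = M.comp d' := by
  obtain ⟨x, hx⟩ := hM.exists_comp_eq d
  obtain ⟨y, hy⟩ := hM.exists_comp_eq d'
  rw [hx, hy]
  exact B.eq_of_tau_invariant Ω (fun x => M.comp (cil x)) (fun i x => (hM.next i x).comp_eq) x y

/-! ### Copies of the submap and the half-edges leading to them -/

namespace WalshMap

variable {D : ℕ} {W : WalshMap D}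

theorem blueMap_σ (d : W.blueMap.dart) : (W.blueMap.σ d).1 = W.σ d.1 := rfl

theorem blueMap_α_of_mem {d : W.blueMap.dart} (h : W.α d.1 ∈ W.black) : W.blueMap.α d = d :=
  dif_pos h

theorem blueMap_α_of_notMem {d : W.blueMap.dart} (h : W.α d.1 ∉ W.black) :
    (W.blueMap.α d).1 = W.α d.1 :=
  congrArg Subtype.val (dif_neg h : W.blueMap.α d = ⟨W.α d.1, h⟩)

theorem blueMap_color_of_mem {d : W.blueMap.dart} (h : W.α d.1 ∈ W.black) :
    W.blueMap.color d = Finset.univ :=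
  if_pos h

theorem blueMap_color_of_notMem {d : W.blueMap.dart} (h : W.α d.1 ∉ W.black) :
    W.blueMap.color d = W.color d.1 :=
  if_neg h

theorem blueMap_sameCycle {d d' : W.blueMap.dart} :
    W.blueMap.σ.SameCycle d d' ↔ W.σ.SameCycle d.1 d'.1 :=
  Equiv.Perm.sameCycle_subtypePerm (f := W.σ) (p := fun d => d ∉ W.black)
    (h := fun d => not_congr (W.black_σ d))

theorem black_iff_of_sameCycle {d d' : W.dart} (h : W.σ.SameCycle d d') :
    d ∈ W.black ↔ d' ∈ W.black :=
  iff_of_eq (CMap.eq_of_sameCycle (M := W.toCMap) (fun d => d ∈ W.black)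
    (fun d => propext (W.black_σ d)) h)

namespace IsStuffed

variable {M : CMap D} {p : ℕ} (hW : W.IsStuffed M p)
include hW

/-- The other candidates for fixed points, the genuine cilia of `W`, sit at black vertices and have
disappeared. -/
theorem isCilium_blueMap (d : W.blueMap.dart) : W.blueMap.IsCilium d ↔ W.α d.1 ∈ W.black := by
  by_cases h : W.α d.1 ∈ W.black
  · exact iff_of_true (blueMap_α_of_mem h) h
  · refine iff_of_false (fun h2 => ?_) h
    have h3 : W.α d.1 = d.1 := by rw [← blueMap_α_of_notMem h]; exact congrArg Subtype.val h2
    exact d.2 (hW.cilium_black d.1 h3)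

/-- The half-edge at a blue vertex opposite to a half-edge at a black vertex. -/
def foot (b : W.BlackHalfEdge) : W.blueMap.dart := ⟨W.α b.1, hW.bipartite b.1 b.2.1 b.2.2⟩

theorem foot_val (b : W.BlackHalfEdge) : (hW.foot b).1 = W.α b.1 := rfl

theorem α_foot (b : W.BlackHalfEdge) : W.α (hW.foot b).1 = b.1 := W.α_invol b.1

theorem foot_injective : Function.Injective hW.foot := fun _ _ h =>
  Subtype.ext (W.α_invol.injective (congrArg Subtype.val h))

theorem isCilium_foot (b : W.BlackHalfEdge) : W.blueMap.IsCilium (hW.foot b) := by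
  rw [hW.isCilium_blueMap, α_foot]; exact b.2.1

theorem exists_foot_eq {d : W.blueMap.dart} (h : W.blueMap.IsCilium d) : ∃ b, hW.foot b = d := by
  rw [hW.isCilium_blueMap] at h
  refine ⟨⟨W.α d.1, h, fun h2 => d.2 ?_⟩, Subtype.ext (W.α_invol d.1)⟩
  rw [CMap.isCilium_α] at h2
  exact hW.cilium_black _ h2

variable {B : Bubble D} {Ω : B.Pairing} {cil : B.white → M.dart}
  (hM : M.RepresentsBubble B Ω cil) {C : W.blueMap.Comp} (g : CMap.CompIso M W.blueMap C)
include hM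

theorem exists_hub (x : B.white) : ∃ b, hW.foot b = (g.toEquiv (cil x)).1 :=
  hW.exists_foot_eq ((g.toHom.isCilium_iff g.injective).2 ((hM.isCilium_iff _).2 ⟨x, rfl⟩))

/-- The half-edge at a black vertex which leads to the cilium of `x` of a copy of `M`. -/
noncomputable def hub (x : B.white) : W.BlackHalfEdge := (hW.exists_hub hM g x).choose

theorem foot_hub (x : B.white) : hW.foot (hW.hub hM g x) = (g.toEquiv (cil x)).1 :=
  (hW.exists_hub hM g x).choose_spec

theorem hub_injective : Function.Injective (hW.hub hM g) := by
  intro x y h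
  have := congrArg hW.foot h
  rw [foot_hub, foot_hub] at this
  exact hM.cil_injective (g.injective this)

theorem comp_foot_hub (x : B.white) : W.blueMap.comp (hW.foot (hW.hub hM g x)) = C := by
  rw [foot_hub]; exact (g.toEquiv (cil x)).2

theorem exists_hub_eq {b : W.BlackHalfEdge} (h : W.blueMap.comp (hW.foot b) = C) :
    ∃ x, hW.hub hM g x = b := by
  obtain ⟨d, hd⟩ := g.toEquiv.surjective ⟨_, h⟩
  have hd' : g.toHom.toFun d = hW.foot b := congrArg Subtype.val hd
  have := hW.isCilium_foot b
  rw [← hd', g.toHom.isCilium_iff g.injective, hM.isCilium_iff] at this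
  obtain ⟨x, rfl⟩ := this
  refine ⟨x, hW.foot_injective ?_⟩
  rw [foot_hub]; exact hd'

/-- An isomorphism with a blue submap transports the faces of `M`. The converse direction holds
because the next cilium is unique when it exists. -/
theorem nextCilium_hub {i : Fin D} {x : B.white} {b : W.BlackHalfEdge} :
    W.blueMap.NextCilium i (hW.foot (hW.hub hM g x)) (hW.foot b) ↔
      b = hW.hub hM g (B.tau Ω i x) := by
  have h : W.blueMap.NextCilium i (hW.foot (hW.hub hM g x))
      (hW.foot (hW.hub hM g (B.tau Ω i x))) := by
    rw [foot_hub, foot_hub]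
    exact g.toHom.nextCilium g.injective (hM.next i x)
  refine ⟨fun h' => hW.foot_injective (h'.unique h), ?_⟩
  rintro rfl
  exact h

/-- The edge to the black vertex carries the colors of the edges of the blue submap at its blue end;
in `M` these are the colors which do not join the two vertices of the pair. -/
theorem mem_color_hub {i : Fin D} {x : B.white} :
    i ∈ W.color (hW.hub hM g x).1 ↔ B.tau Ω i x ≠ x := by
  have hα := hW.α_foot (hW.hub hM g x)
  rw [← hα, W.color_α, hW.label _ (hW.foot _).2 (by rw [hα]; exact (hW.hub hM g x).2.1),
    ← hM.label, foot_hub]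
  constructor
  · rintro ⟨d, hs, hd, hi⟩
    have hblue : d ∉ W.black := by
      rw [← black_iff_of_sameCycle hs]; exact (g.toEquiv (cil x)).1.2
    obtain ⟨e, rfl⟩ : ∃ e : W.blueMap.dart, e.1 = d := ⟨⟨d, hblue⟩, rfl⟩
    obtain ⟨m, rfl, hs'⟩ := g.toHom.exists_of_sameCycle (blueMap_sameCycle.2 hs)
    refine ⟨m, hs', ?_, ?_⟩
    · rw [← g.toHom.isCilium_iff g.injective, hW.isCilium_blueMap]; exact hd
    · rw [← g.toHom.map_color, blueMap_color_of_notMem hd]; exact hi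
  · rintro ⟨m, hs, hm, hi⟩
    have hd : W.α (g.toHom.toFun m).1 ∉ W.black := by
      rwa [← hW.isCilium_blueMap, g.toHom.isCilium_iff g.injective]
    refine ⟨(g.toHom.toFun m).1, blueMap_sameCycle.1 (g.toHom.sameCycle hs), hd, ?_⟩
    rw [← blueMap_color_of_notMem hd, g.toHom.map_color]; exact hi

/-- Every half-edge at a black vertex leads to a copy of `M`. -/
theorem exists_eq_hub (b : W.BlackHalfEdge) :
    ∃ (C : W.blueMap.Comp) (g : CMap.CompIso M W.blueMap C) (x : B.white),
      W.blueMap.comp (hW.foot b) = C ∧ hW.hub hM g x = b := by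
  obtain ⟨g⟩ := hW.submaps (W.blueMap.comp (hW.foot b))
  obtain ⟨x, hx⟩ := hW.exists_hub_eq hM g rfl
  exact ⟨_, g, x, rfl, hx⟩

end IsStuffed

end WalshMap

/-- The part of a correspondence between a paired graph and a map which determines the rest of it:
pairs are sent to half-edges at black vertices, in such a way that the edges of color `0` give the
order around the black vertices and the other edges give the broken faces of the blue submaps. -/
structure CoreCorrespondence {D : ℕ} (G : PairedGraph D) (W : WalshMap D) where
  pair : G.white ≃ W.BlackHalfEdge
  succ : ∀ x y, W.σ (pair x).1 = (pair y).1 ↔ G.edge0 y = some (G.pairing x)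
  next : ∀ i x y (d d' : W.blueMap.dart), d.1 = W.α (pair x).1 → d'.1 = W.α (pair y).1 →
    (W.blueMap.NextCilium i d d' ↔ G.edge i x = G.pairing y)

/-! ### Invariant functions on graphs, and the neighbors of a cilium -/

namespace ColoredGraph

variable {D : ℕ} {G : ColoredGraph D} {i : Fin D}

theorem comp_edge (i : Fin D) (x : G.white) :
    G.comp (Sum.inr (G.edge i x)) = G.comp (Sum.inl x) :=
  (Quotient.sound (s := G.compSetoid) (Relation.EqvGen.rel _ _ ⟨i, x, rfl, rfl⟩)).symm

theorem eq_of_comp_eq {T : Sort*} (F : G.Vertex → T)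
    (hF : ∀ i x, F (Sum.inr (G.edge i x)) = F (Sum.inl x)) {u v : G.Vertex}
    (h : G.comp u = G.comp v) : F u = F v := by
  refine Relation.EqvGen.apply_eq F ?_ (Quotient.exact h)
  rintro _ _ ⟨i, x, rfl, rfl⟩
  exact (hF i x).symm

theorem face_edge (x : G.white) : G.face i (Sum.inr (G.edge i x)) = G.face i (Sum.inl x) :=
  (Quotient.sound (s := G.faceSetoid i) (Relation.EqvGen.rel _ _ (.inl ⟨x, rfl, rfl⟩))).symm

theorem face_edge0 {x : G.white} {y : G.black} (h : G.edge0 x = some y) :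
    G.face i (Sum.inr y) = G.face i (Sum.inl x) :=
  (Quotient.sound (s := G.faceSetoid i)
    (Relation.EqvGen.rel _ _ (.inr ⟨x, y, h, rfl, rfl⟩))).symm

theorem eq_of_face_eq {T : Sort*} (F : G.Vertex → T)
    (hF : ∀ x, F (Sum.inr (G.edge i x)) = F (Sum.inl x))
    (hF0 : ∀ x y, G.edge0 x = some y → F (Sum.inr y) = F (Sum.inl x)) {u v : G.Vertex}
    (h : G.face i u = G.face i v) : F u = F v := by
  refine Relation.EqvGen.apply_eq F ?_ (Quotient.exact h)
  rintro _ _ (⟨x, rfl, rfl⟩ | ⟨x, y, h, rfl, rfl⟩)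
  exacts [(hF x).symm, (hF0 x y h).symm]

theorem Connected.eq_of_invariant (hG : G.Connected) {T : Sort*} (F : G.Vertex → T)
    (hF : ∀ i x, F (Sum.inr (G.edge i x)) = F (Sum.inl x))
    (hF0 : ∀ x y, G.edge0 x = some y → F (Sum.inr y) = F (Sum.inl x)) (u v : G.Vertex) :
    F u = F v := by
  refine Relation.EqvGen.apply_eq F ?_ (hG.2 u v)
  rintro _ _ (⟨i, x, rfl, rfl⟩ | ⟨x, y, h, rfl, rfl⟩)
  exacts [(hF i x).symm, (hF0 x y h).symm]

/-- A nonempty graph is connected if every function invariant along the edges is constant. -/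
theorem connected_of_forall [Nonempty G.Vertex]
    (h : ∀ F : G.Vertex → Prop, (∀ i x, F (Sum.inr (G.edge i x)) = F (Sum.inl x)) →
      (∀ x y, G.edge0 x = some y → F (Sum.inr y) = F (Sum.inl x)) → ∀ u v, F u = F v) :
    G.Connected := by
  refine ⟨inferInstance, fun u v => ?_⟩
  have hr : ∀ a b, (ColorAdj G.edge a b ∨ G.Adj0 a b) →
      Relation.EqvGen (fun u v => ColorAdj G.edge u v ∨ G.Adj0 u v) u b =
      Relation.EqvGen (fun u v => ColorAdj G.edge u v ∨ G.Adj0 u v) u a := fun a b hab =>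
    propext ⟨fun h => h.trans _ _ _ (.symm _ _ (.rel _ _ hab)), fun h => h.trans _ _ _ (.rel _ _ hab)⟩
  -- The invariant predicate to test is reachability from `u` itself.
  have := h (fun v => Relation.EqvGen (fun u v => ColorAdj G.edge u v ∨ G.Adj0 u v) u v)
    (fun i x => hr _ _ (.inl ⟨i, x, rfl, rfl⟩)) (fun x y h => hr _ _ (.inr ⟨x, y, h, rfl, rfl⟩)) u v
  exact this ▸ .refl u

end ColoredGraph

namespace WalshMap.IsStuffed

variable {D : ℕ} {W : WalshMap D} {M : CMap D} {p : ℕ} (hW : W.IsStuffed M p)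
include hW

/-- A second cilium right after `c` would be `c` itself, and a black vertex does not consist of just
a cilium. -/
theorem exists_σ_eq {c : W.dart} (hc : W.IsCilium c) : ∃ b : W.BlackHalfEdge, W.σ c = b.1 := by
  refine ⟨⟨W.σ c, (W.black_σ c).2 (hW.cilium_black c hc), fun h => ?_⟩, rfl⟩
  exact hW.cilium_ne c hc (hW.cilium_unique _ _ hc h ⟨1, by simp⟩).symm

theorem exists_eq_σ {c : W.dart} (hc : W.IsCilium c) : ∃ b : W.BlackHalfEdge, W.σ b.1 = c := by
  refine ⟨⟨W.σ.symm c, ?_, fun h => ?_⟩, W.σ.apply_symm_apply c⟩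
  · rw [← W.black_σ, Equiv.apply_symm_apply]; exact hW.cilium_black c hc
  · have := hW.cilium_unique _ _ h hc ⟨1, by simp⟩
    refine hW.cilium_ne c hc ?_
    conv_lhs => rw [← this]
    simp

end WalshMap.IsStuffed

/-! ### Bubbles, free vertices and labels from the core -/

namespace CoreCorrespondence

variable {D : ℕ} {B : Bubble D} {Ω : B.Pairing} {M : CMap D} {cil : B.white → M.dart} {p : ℕ}
  {G : PairedGraph D} {W : WalshMap D} (K : CoreCorrespondence G W)
  (hM : M.RepresentsBubble B Ω cil) (hW : W.IsStuffed M p)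

section Bubbles

variable {C : W.blueMap.Comp} (g : CMap.CompIso M W.blueMap C)

theorem edge_hub (i : Fin D) (x : B.white) : G.edge i (K.pair.symm (hW.hub hM g x)) =
    G.pairing (K.pair.symm (hW.hub hM g (B.tau Ω i x))) := by
  rw [← K.next i _ _ (hW.foot (hW.hub hM g x)) (hW.foot (hW.hub hM g (B.tau Ω i x)))
    (by simp [hW.foot_val]) (by simp [hW.foot_val]), hW.nextCilium_hub]

/-- By `edge_hub`, the pairs leading to one copy of `M` form an image of `B` in `G`, and `B` is
connected. -/
theorem comp_hub_black (x x' : B.white) :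
    G.comp (Sum.inr (G.pairing (K.pair.symm (hW.hub hM g x')))) =
      G.comp (Sum.inl (K.pair.symm (hW.hub hM g x))) := by
  have := Relation.EqvGen.apply_eq (fun v => G.comp (Sum.map
    (fun x => K.pair.symm (hW.hub hM g x))
    (fun y => G.pairing (K.pair.symm (hW.hub hM g (Ω.symm y)))) v)) ?_
    (B.connected (.inr (Ω x')) (.inl x))
  · simpa using this
  · rintro _ _ ⟨i, x, rfl, rfl⟩
    simp only [Sum.map_inl, Sum.map_inr]
    rw [← B.pairing_tau Ω, Equiv.symm_apply_apply, ← K.edge_hub hM hW, G.comp_edge]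

theorem comp_hub (x x' : B.white) : G.comp (Sum.inl (K.pair.symm (hW.hub hM g x'))) =
      G.comp (Sum.inl (K.pair.symm (hW.hub hM g x))) := by
  rw [← K.comp_hub_black hM hW g x x, ← K.comp_hub_black hM hW g x' x]

end Bubbles

include K hM hW in
-- The core does not postulate that a pair lies in a single bubble; it follows from the
-- connectedness of `B`.
theorem comp_pairing (x : G.white) : G.comp (Sum.inr (G.pairing x)) = G.comp (Sum.inl x) := by
  obtain ⟨C, g, x₀, -, hx⟩ := hW.exists_eq_hub hM (K.pair x)
  have := K.comp_hub_black hM hW g x₀ x₀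
  rwa [hx, Equiv.symm_apply_apply] at this

/-- The blue component to which a vertex is sent. -/
noncomputable def blueComp (v : G.Vertex) : W.blueMap.Comp :=
  W.blueMap.comp (hW.foot (K.pair (Sum.elim id G.pairing.symm v)))

theorem blueComp_edge (i : Fin D) (x : G.white) :
    K.blueComp hW (Sum.inr (G.edge i x)) = K.blueComp hW (Sum.inl x) := by
  refine ((K.next i x (G.pairing.symm (G.edge i x)) _ _ rfl rfl).2 ?_ :
    W.blueMap.NextCilium i (hW.foot (K.pair x)) (hW.foot _)).comp_eq
  simp

include K hM hW in
-- Edges of the colors of `B` follow faces inside one blue submap. Conversely, the pairs leading to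
-- the same blue submap are images of the pairs of one copy of `B`.
theorem comp_eq_iff (u v : G.Vertex) :
    G.comp u = G.comp v ↔ K.blueComp hW u = K.blueComp hW v := by
  refine ⟨G.eq_of_comp_eq (K.blueComp hW) (K.blueComp_edge hW), fun h => ?_⟩
  have key : ∀ u : G.Vertex, G.comp u = G.comp (Sum.inl (Sum.elim id G.pairing.symm u)) := by
    rintro (x | y)
    · rfl
    · rw [← K.comp_pairing hM hW]; simp
  rw [key u, key v]
  unfold blueComp at h
  generalize Sum.elim id G.pairing.symm u = x at h
  generalize Sum.elim id G.pairing.symm v = y at h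
  obtain ⟨C, g, x₀, hC, hx⟩ := hW.exists_eq_hub hM (K.pair x)
  obtain ⟨y₀, hy⟩ := hW.exists_hub_eq hM g (h.symm.trans hC)
  have := K.comp_hub hM hW g y₀ x₀
  rwa [hx, hy, Equiv.symm_apply_apply, Equiv.symm_apply_apply] at this

include K hM hW in
theorem exists_blueComp_eq (C : W.blueMap.Comp) : ∃ x, K.blueComp hW (Sum.inl x) = C := by
  obtain ⟨g⟩ := hW.submaps C
  obtain ⟨x₀⟩ := B.nonempty_white Ω
  exact ⟨K.pair.symm (hW.hub hM g x₀), by simp [blueComp, hW.comp_foot_hub]⟩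

/-- Bubbles are sent to blue submaps. -/
noncomputable def bubbleEquiv : G.Comp ≃ W.blueMap.Comp :=
  Equiv.ofBijective (Quotient.lift (s := G.compSetoid) (K.blueComp hW)
      fun _ _ h => (K.comp_eq_iff hM hW _ _).1 (Quotient.sound h)) <| by
    constructor
    · rintro ⟨u⟩ ⟨v⟩ h
      exact (K.comp_eq_iff hM hW u v).2 h
    · intro C
      obtain ⟨x, hx⟩ := K.exists_blueComp_eq hM hW C
      exact ⟨G.comp (Sum.inl x), hx⟩

theorem bubbleEquiv_comp (v : G.Vertex) :
    K.bubbleEquiv hM hW (G.comp v) = K.blueComp hW v := rfl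

section CompIso

variable {C : G.Comp} (g : CMap.CompIso M W.blueMap (K.bubbleEquiv hM hW C))

theorem comp_hub_eq (x : B.white) : G.comp (Sum.inl (K.pair.symm (hW.hub hM g x))) = C := by
  apply (K.bubbleEquiv hM hW).injective
  rw [bubbleEquiv_comp, blueComp]
  simp [hW.comp_foot_hub]

theorem comp_pairing_hub_eq (x : B.white) :
    G.comp (Sum.inr (G.pairing (K.pair.symm (hW.hub hM g x)))) = C := by
  rw [K.comp_pairing hM hW, comp_hub_eq]

theorem exists_hub_eq_of_comp {x : G.white} (hx : G.comp (Sum.inl x) = C) :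
    ∃ x₀, K.pair.symm (hW.hub hM g x₀) = x := by
  have h := congrArg (K.bubbleEquiv hM hW) hx
  obtain ⟨x₀, h₀⟩ := hW.exists_hub_eq hM g (b := K.pair x) h
  exact ⟨x₀, by simp [h₀]⟩

/-- An isomorphism from `M` to a blue submap gives an isomorphism from `B` to a bubble. -/
noncomputable def compIso : G.CompIso B Ω C where
  white := Equiv.ofBijective (fun x => ⟨K.pair.symm (hW.hub hM g x), K.comp_hub_eq hM hW g x⟩) <| by
    constructor
    · intro x y h
      exact hW.hub_injective hM g (K.pair.symm.injective (congrArg Subtype.val h))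
    · rintro ⟨x, hx⟩
      obtain ⟨x₀, h₀⟩ := K.exists_hub_eq_of_comp hM hW g hx
      exact ⟨x₀, Subtype.ext h₀⟩
  black := Equiv.ofBijective (fun y => ⟨G.pairing (K.pair.symm (hW.hub hM g (Ω.symm y))),
      K.comp_pairing_hub_eq hM hW g _⟩) <| by
    constructor
    · intro x y h
      exact Ω.symm.injective (hW.hub_injective hM g (K.pair.symm.injective
        (G.pairing.injective (congrArg Subtype.val h))))
    · rintro ⟨y, hy⟩
      obtain ⟨x, rfl⟩ := G.pairing.surjective y
      rw [K.comp_pairing hM hW] at hy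
      obtain ⟨x₀, h₀⟩ := K.exists_hub_eq_of_comp hM hW g hy
      exact ⟨Ω x₀, Subtype.ext (by simp [h₀])⟩
  map_edge i x := (K.edge_hub hM hW g i x).symm
  map_pairing x := by
    change G.pairing (K.pair.symm (hW.hub hM g (Ω.symm (Ω x)))) = _
    rw [Equiv.symm_apply_apply]
    rfl

theorem compIso_white (x : B.white) :
    ((K.compIso hM hW g).white x).1 = K.pair.symm (hW.hub hM g x) := rfl

end CompIso

section Free

theorem isFree_white_iff {x : G.white} :
    G.IsFree (Sum.inl x) ↔ W.IsCilium (W.σ.symm (K.pair x).1) := by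
  change G.edge0 x = none ↔ _
  constructor
  · intro h
    by_contra hc
    have hb : W.σ.symm (K.pair x).1 ∈ W.black := by
      rw [← W.black_σ, Equiv.apply_symm_apply]; exact (K.pair x).2.1
    obtain ⟨x', hx'⟩ := K.pair.surjective ⟨_, hb, hc⟩
    have := (K.succ x' x).1 (by rw [hx']; simp)
    simp [h] at this
  · intro h
    rcases he : G.edge0 x with _ | y
    · rfl
    · have := (K.succ (G.pairing.symm y) x).2 (by simp [he])
      rw [← this, Equiv.symm_apply_apply] at h
      exact absurd h (K.pair _).2.2

theorem isFree_black_iff {x : G.white} :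
    G.IsFree (Sum.inr (G.pairing x)) ↔ W.IsCilium (W.σ (K.pair x).1) := by
  change G.edge0.symm (G.pairing x) = none ↔ _
  constructor
  · intro h
    by_contra hc
    have hb : W.σ (K.pair x).1 ∈ W.black := by
      rw [W.black_σ]; exact (K.pair x).2.1
    obtain ⟨x', hx'⟩ := K.pair.surjective ⟨_, hb, hc⟩
    have := (K.succ x x').1 (by rw [hx'])
    rw [← PEquiv.eq_some_iff] at this
    simp [h] at this
  · intro h
    rcases he : G.edge0.symm (G.pairing x) with _ | x'
    · rfl
    · have := (K.succ x x').2 (PEquiv.eq_some_iff _|>.1 he)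
      rw [this] at h
      exact absurd h (K.pair _).2.2

end Free

include K hM hW in
-- Inside a copy of `B`, both sides say that `τ i` moves the pair.
theorem label {i : Fin D} {x : G.white} : i ∈ W.color (K.pair x).1 ↔ G.edge i x ≠ G.pairing x := by
  obtain ⟨C, g, x₀, -, hx⟩ := hW.exists_eq_hub hM (K.pair x)
  obtain rfl : K.pair.symm (hW.hub hM g x₀) = x := by rw [hx, Equiv.symm_apply_apply]
  rw [K.edge_hub hM hW, G.pairing.injective.ne_iff, K.pair.symm.injective.ne_iff,
    (hW.hub_injective hM g).ne_iff, Equiv.apply_symm_apply]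
  exact hW.mem_color_hub hM g

end CoreCorrespondence

/-! ### Faces of the map compared with faces of its blue submaps -/

namespace WalshMap

variable {D : ℕ} {W : WalshMap D} {i : Fin D}

/-- The dart reached is a cilium of `blueMap`, fixed by its involution, so following it and skipping
it give the same result. -/
theorem blueMap_faceStep_of_mem {e : W.blueMap.dart} (h : W.α (W.σ e.1) ∈ W.black) :
    W.blueMap.faceStep i e = W.blueMap.σ e := by
  unfold CMap.faceStep
  split_ifs
  · exact blueMap_α_of_mem h
  · rfl

theorem blueMap_faceStep_of_notMem {e : W.blueMap.dart} (h : W.α (W.σ e.1) ∉ W.black) :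
    (W.blueMap.faceStep i e).1 = W.faceStep i e.1 := by
  unfold CMap.faceStep
  rw [blueMap_color_of_notMem h, blueMap_σ]
  split_ifs
  · exact blueMap_α_of_notMem h
  · rfl

namespace IsStuffed

variable {M : CMap D} {p : ℕ} (hW : W.IsStuffed M p)
include hW

theorem not_isCilium_blue (e : W.blueMap.dart) : ¬ W.IsCilium e.1 :=
  fun h => e.2 (hW.cilium_black _ h)

theorem isCilium_blueMap_faceStep {e : W.blueMap.dart} :
    W.blueMap.IsCilium (W.blueMap.faceStep i e) ↔ W.α (W.σ e.1) ∈ W.black := by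
  by_cases h : W.α (W.σ e.1) ∈ W.black
  · rw [blueMap_faceStep_of_mem h, hW.isCilium_blueMap]; rfl
  · refine iff_of_false ?_ h
    rw [hW.isCilium_blueMap, blueMap_faceStep_of_notMem h]
    unfold CMap.faceStep
    split_ifs
    · rw [W.α_invol]
      exact (W.blueMap.σ e).2
    · exact h

/-- The part of a face inside a blue submap leads to the black vertex next to the next cilium. -/
theorem face_eq_of_nextCilium {e c : W.blueMap.dart} (h : W.blueMap.NextCilium i e c)
    (hc : i ∈ W.color c.1) : W.face i e.1 = W.face i (W.α c.1) := by
  induction h with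
  | here e h =>
    have h2 := hW.isCilium_blueMap_faceStep.1 h
    rw [blueMap_faceStep_of_mem h2] at hc ⊢
    have h3 : W.faceStep i e.1 = W.α (W.blueMap.σ e).1 := if_pos hc
    rw [← h3, CMap.face_faceStep]
    rw [h3, CMap.isCilium_α]
    exact hW.not_isCilium_blue _
  | step e c h _ ih =>
    rw [hW.isCilium_blueMap_faceStep] at h
    rw [← ih hc, blueMap_faceStep_of_notMem h, CMap.face_faceStep]
    rw [← blueMap_faceStep_of_notMem h]
    exact hW.not_isCilium_blue _

end IsStuffed

end WalshMap

/-! ### The correspondence of faces and corners -/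

namespace CoreCorrespondence

variable {D : ℕ} {B : Bubble D} {Ω : B.Pairing} {M : CMap D} {cil : B.white → M.dart} {p : ℕ}
  {G : PairedGraph D} {W : WalshMap D} (K : CoreCorrespondence G W)
  (hM : M.RepresentsBubble B Ω cil) (hW : W.IsStuffed M p) (i : Fin D)

/-- The face of the map along the corner which represents the edge of color `0` at a vertex. -/
def vertexFace (v : G.Vertex) : W.Face i :=
  Sum.elim (fun x => W.face i (W.σ.symm (K.pair x).1))
    (fun y => W.face i (K.pair (G.pairing.symm y)).1) v

theorem vertexFace_black (x : G.white) :
    K.vertexFace i (Sum.inr (G.pairing x)) = W.face i (K.pair x).1 := by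
  simp [vertexFace]

theorem nextCilium_foot {x y : G.white} :
    W.blueMap.NextCilium i (hW.foot (K.pair x)) (hW.foot (K.pair y)) ↔
      G.edge i x = G.pairing y :=
  K.next i x y _ _ rfl rfl

theorem exists_edge_eq (x : G.white) : ∃ y, G.edge i x = G.pairing y :=
  ⟨G.pairing.symm (G.edge i x), by simp⟩

theorem vertexFace_edge0 {x : G.white} {y : G.black} (h : G.edge0 x = some y) :
    K.vertexFace i (Sum.inr y) = K.vertexFace i (Sum.inl x) := by
  obtain ⟨z, rfl⟩ := G.pairing.surjective y
  rw [vertexFace_black, vertexFace, Sum.elim_inl, ← (K.succ z x).2 h, Equiv.symm_apply_apply]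

variable {i} in
include K hM hW in
-- Only a pair that is a fixed point of the color `i` lacks this label, and the successor of a moved
-- pair is moved as well.
theorem mem_color_of_edge {x y : G.white} (h : G.edge i x = G.pairing y)
    (hx : i ∈ W.color (K.pair x).1) : i ∈ W.color (K.pair y).1 := by
  rw [K.label hM hW] at hx ⊢
  intro h2
  rw [← h] at h2
  have := (G.edge i).injective h2
  subst this
  exact hx h

include K hM hW in
-- If the half-edge of `x` carries `i`, the face enters the blue submap there, follows it to the
-- cilium of the next pair, and comes out at the black end because that half-edge also carries `i`.
-- If not, the color `i` joins the two vertices of the pair, and the face passes the half-edge by.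
theorem vertexFace_edge (x : G.white) :
    K.vertexFace i (Sum.inr (G.edge i x)) = K.vertexFace i (Sum.inl x) := by
  obtain ⟨y, hy⟩ := exists_edge_eq (G := G) i x
  rw [hy, vertexFace_black, vertexFace, Sum.elim_inl]
  by_cases hx : i ∈ W.color (K.pair x).1
  · have h1 : W.faceStep i (W.σ.symm (K.pair x).1) = (hW.foot (K.pair x)).1 := by
      unfold CMap.faceStep
      rw [Equiv.apply_symm_apply, if_pos hx, hW.foot_val]
    have h2 := CMap.face_faceStep (M := W.toCMap) (i := i) (d := W.σ.symm (K.pair x).1)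
      (by rw [h1]; exact hW.not_isCilium_blue _)
    rw [← h2, h1, hW.face_eq_of_nextCilium ((K.nextCilium_foot hW i).2 hy), hW.α_foot]
    rw [hW.foot_val, W.color_α]
    exact K.mem_color_of_edge hM hW hy hx
  · have h1 : W.faceStep i (W.σ.symm (K.pair x).1) = (K.pair x).1 := by
      unfold CMap.faceStep
      rw [Equiv.apply_symm_apply, if_neg hx]
    rw [K.label hM hW, not_not, hy] at hx
    obtain rfl := G.pairing.injective hx
    rw [← CMap.face_faceStep (d := W.σ.symm (K.pair y).1), h1]
    rw [h1]
    exact (K.pair y).2.2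

/-- The faces of the graph which correspond to the face along a corner of the map (there is at
most one). -/
def dartFaces (d : W.dart) : Set (G.Face i) :=
  {F | ∃ x, (d = (K.pair x).1 ∨ ∃ e : W.blueMap.dart, e.1 = d ∧
      W.blueMap.NextCilium i e (hW.foot (K.pair x))) ∧ F = G.face i (Sum.inr (G.pairing x))} ∪
    {F | ∃ x, W.IsCilium d ∧ W.σ d = (K.pair x).1 ∧ F = G.face i (Sum.inl x)}

theorem dartFaces_pair (x : G.white) :
    K.dartFaces hW i (K.pair x).1 = {G.face i (Sum.inr (G.pairing x))} := by
  ext F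
  constructor
  · rintro (⟨y, h | ⟨e, he, -⟩, rfl⟩ | ⟨y, h, -, -⟩)
    · rw [K.pair.injective (Subtype.ext h)]; rfl
    · exact absurd (he ▸ (K.pair x).2.1) e.2
    · exact absurd h (K.pair x).2.2
  · rintro rfl
    exact .inl ⟨x, .inl rfl, rfl⟩

theorem dartFaces_cilium {d : W.dart} {x : G.white} (hd : W.IsCilium d)
    (h : W.σ d = (K.pair x).1) : K.dartFaces hW i d = {G.face i (Sum.inl x)} := by
  ext F
  constructor
  · rintro (⟨y, rfl | ⟨e, rfl, -⟩, rfl⟩ | ⟨y, -, h2, rfl⟩)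
    · exact absurd hd (K.pair y).2.2
    · exact absurd hd (hW.not_isCilium_blue _)
    · rw [h] at h2
      rw [K.pair.injective (Subtype.ext h2)]; rfl
  · rintro rfl
    exact .inr ⟨x, hd, h, rfl⟩

theorem dartFaces_of_σ_eq {d : W.dart} {x : G.white} (h : W.σ d = (K.pair x).1) :
    K.dartFaces hW i d = {G.face i (Sum.inl x)} := by
  by_cases hd : W.IsCilium d
  · exact K.dartFaces_cilium hW i hd h
  · have hb : d ∈ W.black := by rw [← W.black_σ, h]; exact (K.pair x).2.1
    obtain ⟨y, hy⟩ := K.pair.surjective ⟨d, hb, hd⟩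
    obtain rfl : (K.pair y).1 = d := by rw [hy]
    rw [dartFaces_pair, G.face_edge0 ((K.succ y x).1 h)]

theorem dartFaces_blue {e : W.blueMap.dart} {x : G.white}
    (h : W.blueMap.NextCilium i e (hW.foot (K.pair x))) :
    K.dartFaces hW i e.1 = {G.face i (Sum.inr (G.pairing x))} := by
  ext F
  constructor
  · rintro (⟨y, h2 | ⟨e', he, h2⟩, rfl⟩ | ⟨y, h, -, -⟩)
    · exact absurd (h2 ▸ (K.pair y).2.1) e.2
    · rw [Subtype.ext he] at h2
      rw [K.pair.injective (hW.foot_injective (h2.unique h))]; rfl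
    · exact absurd h (hW.not_isCilium_blue _)
  · rintro rfl
    exact .inl ⟨x, .inr ⟨e, rfl, h⟩, rfl⟩

/-- Both sets may be empty: from a corner on the cilium-free side of an uncut cycle of `M` no cilium
is reached. -/
theorem dartFaces_blue_eq {e e' : W.blueMap.dart}
    (h : ∀ c, W.blueMap.NextCilium i e c ↔ W.blueMap.NextCilium i e' c) :
    K.dartFaces hW i e.1 = K.dartFaces hW i e'.1 := by
  by_cases hx : ∃ x, W.blueMap.NextCilium i e (hW.foot (K.pair x))
  · obtain ⟨x, hx⟩ := hx
    rw [K.dartFaces_blue hW i hx, K.dartFaces_blue hW i ((h _).1 hx)]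
  · have key : ∀ e : W.blueMap.dart, (¬ ∃ x, W.blueMap.NextCilium i e (hW.foot (K.pair x))) →
        K.dartFaces hW i e.1 = ∅ := by
      intro e hx
      rw [Set.eq_empty_iff_forall_notMem]
      rintro F (⟨y, h2 | ⟨e', he, h2⟩, rfl⟩ | ⟨y, h, -, -⟩)
      · exact absurd (h2 ▸ (K.pair y).2.1) e.2
      · rw [Subtype.ext he] at h2
        exact hx ⟨y, h2⟩
      · exact absurd h (hW.not_isCilium_blue _)
    rw [key e hx, key e' (by simpa only [h] using hx)]

include hM in
-- This invariance makes `dartFaces` well defined on the faces of `W`. It recovers the face of `G`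
-- from its image, which gives the injectivity in `vertexFace_eq_iff`.
theorem dartFaces_faceStep (d : W.dart) (hd : ¬ W.IsCilium (W.faceStep i d)) :
    K.dartFaces hW i (W.faceStep i d) = K.dartFaces hW i d := by
  by_cases hb : d ∈ W.black
  · have hc : ¬ W.IsCilium (W.σ d) := by
      intro hc
      apply hd
      unfold CMap.faceStep
      split_ifs
      · rwa [CMap.isCilium_α]
      · exact hc
    obtain ⟨x, hx⟩ := K.pair.surjective ⟨W.σ d, (W.black_σ d).2 hb, hc⟩
    have hσ : W.σ d = (K.pair x).1 := by rw [hx]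
    rw [K.dartFaces_of_σ_eq hW i hσ, ← G.face_edge]
    obtain ⟨y, hy⟩ := exists_edge_eq (G := G) i x
    rw [hy]
    unfold CMap.faceStep
    rw [hσ]
    split_ifs with hi
    · rw [← hW.foot_val]
      exact K.dartFaces_blue hW i ((K.nextCilium_foot hW i).2 hy)
    · rw [K.label hM hW, not_not, hy] at hi
      obtain rfl := G.pairing.injective hi
      exact K.dartFaces_pair hW i y
  · obtain ⟨e, rfl⟩ : ∃ e : W.blueMap.dart, e.1 = d := ⟨⟨d, hb⟩, rfl⟩
    by_cases hα : W.α (W.σ e.1) ∈ W.black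
    · have hcil : W.blueMap.IsCilium (W.blueMap.σ e) := (hW.isCilium_blueMap _).2 hα
      obtain ⟨b, hb'⟩ := hW.exists_foot_eq hcil
      obtain ⟨x, rfl⟩ := K.pair.surjective b
      have hn : W.blueMap.NextCilium i e (hW.foot (K.pair x)) := by
        rw [hb']
        exact .of_isCilium (WalshMap.blueMap_faceStep_of_mem hα) hcil
      rw [K.dartFaces_blue hW i hn]
      have hσ : W.σ e.1 = (hW.foot (K.pair x)).1 := by rw [hb']; rfl
      unfold CMap.faceStep
      rw [hσ]
      split_ifs with hi
      · rw [hW.α_foot]; exact K.dartFaces_pair hW i x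
      -- Without the color `i` the face stays at the blue vertex and goes on from the half-edge just
      -- passed. The next cilium from there is that of the pair `y` joined to `x`, and the missing
      -- label forces `y = x`.
      · obtain ⟨y, hy⟩ := exists_edge_eq (G := G) i x
        rw [K.dartFaces_blue hW i ((K.nextCilium_foot hW i).2 hy)]
        rw [hW.foot_val, W.color_α, K.label hM hW, not_not, hy] at hi
        rw [G.pairing.injective hi]
    · rw [← WalshMap.blueMap_faceStep_of_notMem hα]
      refine K.dartFaces_blue_eq hW i fun c => CMap.nextCilium_step_iff ?_
      rwa [hW.isCilium_blueMap_faceStep]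

include hW in
theorem exists_vertexFace_eq {d : W.dart} (hd : d ∈ W.black) :
    ∃ v, K.vertexFace i v = W.face i d := by
  by_cases hc : W.IsCilium d
  · obtain ⟨b, hb⟩ := hW.exists_σ_eq hc
    obtain ⟨x, rfl⟩ := K.pair.surjective b
    exact ⟨Sum.inl x, by rw [vertexFace, Sum.elim_inl, ← hb, Equiv.symm_apply_apply]⟩
  · obtain ⟨x, hx⟩ := K.pair.surjective ⟨d, hd, hc⟩
    exact ⟨Sum.inr (G.pairing x), by rw [vertexFace_black, hx]⟩

include hM hW in
-- Each vertex is represented by a corner whose set `dartFaces` is the singleton of its face, so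
-- equal faces in `W` give equal singletons.
theorem vertexFace_eq_iff {u v : G.Vertex} :
    K.vertexFace i u = K.vertexFace i v ↔ G.face i u = G.face i v := by
  refine ⟨fun h => ?_, G.eq_of_face_eq _ (K.vertexFace_edge hM hW i)
    (fun _ _ => K.vertexFace_edge0 i)⟩
  have key : ∀ v, ∃ d, K.vertexFace i v = W.face i d ∧ K.dartFaces hW i d = {G.face i v} := by
    rintro (x | y)
    · exact ⟨_, rfl, K.dartFaces_of_σ_eq hW i (by simp)⟩
    · obtain ⟨x, rfl⟩ := G.pairing.surjective y
      exact ⟨_, K.vertexFace_black i x, K.dartFaces_pair hW i x⟩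
  obtain ⟨d, hd, hd'⟩ := key u
  obtain ⟨e, he, he'⟩ := key v
  rw [hd, he] at h
  have := CMap.eq_of_face_eq _ (K.dartFaces_faceStep hM hW i) h
  rw [hd', he'] at this
  exact Set.singleton_injective this

theorem meetsBlack_vertexFace (v : G.Vertex) : W.MeetsBlack (K.vertexFace i v) := by
  rcases v with x | y
  · exact ⟨_, by rw [← W.black_σ, Equiv.apply_symm_apply]; exact (K.pair x).2.1, rfl⟩
  · exact ⟨_, (K.pair (G.pairing.symm y)).2.1, rfl⟩

/-- Faces are sent to faces which go along a black vertex. -/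
noncomputable def faceEquiv : G.Face i ≃ {F : W.Face i // W.MeetsBlack F} :=
  Equiv.ofBijective (Quotient.lift (s := G.faceSetoid i)
      (fun v => ⟨K.vertexFace i v, K.meetsBlack_vertexFace i v⟩)
      fun _ _ h => Subtype.ext ((K.vertexFace_eq_iff hM hW i).2 (Quotient.sound h))) <| by
    constructor
    · rintro ⟨u⟩ ⟨v⟩ h
      exact (K.vertexFace_eq_iff hM hW i).1 (congrArg Subtype.val h)
    · rintro ⟨F, d, hd, rfl⟩
      obtain ⟨v, hv⟩ := K.exists_vertexFace_eq hW i hd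
      exact ⟨G.face i v, Subtype.ext hv⟩

theorem faceEquiv_face (v : G.Vertex) :
    (K.faceEquiv hM hW i (G.face i v)).1 = K.vertexFace i v := rfl

theorem isClosedFace_iff (F : G.Face i) :
    G.IsClosedFace F ↔ W.IsClosedFace (K.faceEquiv hM hW i F).1 := by
  obtain ⟨u, rfl⟩ : ∃ u, G.face i u = F := Quotient.exists_rep F
  rw [faceEquiv_face]
  constructor
  · intro h d hd hc
    obtain ⟨b, hb⟩ := hW.exists_σ_eq hc
    obtain ⟨x, rfl⟩ := K.pair.surjective b
    have hd' : W.σ.symm (K.pair x).1 = d := by rw [← hb, Equiv.symm_apply_apply]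
    refine h (Sum.inl x) ?_ ?_
    · rw [← K.vertexFace_eq_iff hM hW, ← hd, ← hd']; rfl
    · rw [K.isFree_white_iff, hd']; exact hc
  · intro h v hv hf
    rw [← K.vertexFace_eq_iff hM hW] at hv
    rcases v with x | y
    · exact h _ hv (K.isFree_white_iff.1 hf)
    · obtain ⟨x, rfl⟩ := G.pairing.surjective y
      rw [vertexFace_black] at hv
      have hc := K.isFree_black_iff.1 hf
      have hc' : W.IsCilium (W.faceStep i (K.pair x).1) := by
        unfold CMap.faceStep
        split_ifs
        · rwa [CMap.isCilium_α]
        · exact hc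
      -- A free black vertex is at the end of a broken face. The cilium met there stands for the
      -- start of a broken face, perhaps another one, so the cilium at which the present face starts
      -- has to be found.
      obtain ⟨c, hc, hcil⟩ := CMap.exists_isCilium_of_faceStep hc'
      exact h c (hc.trans hv) hcil

/-- Edges of color `0` are sent to corners of black vertices without cilium. -/
noncomputable def cornerEquiv : G.ZeroEdge ≃ W.BlackCorner :=
  Equiv.ofBijective (fun e => ⟨(K.pair (G.pairing.symm e.1.2)).1, (K.pair _).2.1, (K.pair _).2.2, by
      rw [(K.succ (G.pairing.symm e.1.2) e.1.1).2 (by simp [e.2])]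
      exact (K.pair _).2.2⟩) <| by
    constructor
    · rintro ⟨⟨x, y⟩, h⟩ ⟨⟨x', y'⟩, h'⟩ he
      have he' : (K.pair (G.pairing.symm y)).1 = (K.pair (G.pairing.symm y')).1 :=
        congrArg (fun c : W.BlackCorner => c.1) he
      have : y = y' := G.pairing.symm.injective (K.pair.injective (Subtype.ext he'))
      subst this
      obtain rfl : x = x' := G.edge0.inj h h'
      rfl
    · rintro ⟨d, hd, hc, hc'⟩
      obtain ⟨x, hx⟩ := K.pair.surjective ⟨d, hd, hc⟩
      obtain ⟨y, hy⟩ := K.pair.surjective ⟨W.σ d, (W.black_σ d).2 hd, hc'⟩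
      refine ⟨⟨(y, G.pairing x), (K.succ x y).1 (by rw [hx, hy])⟩, Subtype.ext ?_⟩
      simp [hx]

/-- The correspondence determined by its core. -/
noncomputable def toCorrespondence : Correspondence B Ω M cil G W where
  pair := K.pair
  label x i := K.label hM hW
  corner := K.cornerEquiv
  corner_black e := rfl
  corner_white e := (K.succ (G.pairing.symm e.1.2) e.1.1).2 (by simp [e.2])
  free_white x := K.isFree_white_iff
  free_black x := K.isFree_black_iff
  bubble := K.bubbleEquiv hM hW
  bubble_pair x d hd := by
    rw [bubbleEquiv_comp, blueComp]
    congr 1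
    exact Subtype.ext hd.symm
  bubble_iso C := by
    obtain ⟨g⟩ := hW.submaps (K.bubbleEquiv hM hW C)
    refine ⟨K.compIso hM hW g, g, fun x => ?_⟩
    rw [compIso_white, Equiv.apply_symm_apply, ← hW.foot_val, hW.foot_hub]
  face i := K.faceEquiv hM hW i
  face_white i x := rfl
  face_black i x := K.vertexFace_black i x
  face_closed i F := K.isClosedFace_iff hM hW i F

end CoreCorrespondence

/-- A correspondence determines its core. -/
noncomputable def Correspondence.toCore {D : ℕ} {B : Bubble D} {Ω : B.Pairing} {M : CMap D}
    {cil : B.white → M.dart} {G : PairedGraph D} {W : WalshMap D}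
    (Γ : Correspondence B Ω M cil G W) (hM : M.RepresentsBubble B Ω cil) :
    CoreCorrespondence G W where
  pair := Γ.pair
  succ x y := by
    constructor
    · intro h
      obtain ⟨e, he⟩ := Γ.corner.surjective
        ⟨(Γ.pair x).1, (Γ.pair x).2.1, (Γ.pair x).2.2, by rw [h]; exact (Γ.pair y).2.2⟩
      have h1 := Γ.corner_black e
      have h2 := Γ.corner_white e
      rw [he] at h1 h2
      have hx := Γ.pair.injective (Subtype.ext h1)
      have hy := Γ.pair.injective (Subtype.ext (h.symm.trans h2))
      rw [hx, hy, Equiv.apply_symm_apply]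
      exact e.2
    · intro h
      have h1 := Γ.corner_black ⟨(y, G.pairing x), h⟩
      have h2 := Γ.corner_white ⟨(y, G.pairing x), h⟩
      rw [h1] at h2
      simpa using h2
  next i x y d d' hd hd' := by
    obtain ⟨f, g, hfg⟩ := Γ.bubble_iso (G.comp (Sum.inl x))
    obtain ⟨x₀, hx₀⟩ := f.white.surjective ⟨x, rfl⟩
    obtain rfl : g.toHom.toFun (cil x₀) = d := Subtype.ext <| by
      rw [hd]; refine (hfg x₀).trans ?_; rw [hx₀]
    -- The isomorphisms `f` and `g` match the cilia of the copy of `M` with the pairs of the copy of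
    -- `B`, so the faces of `M` tell where the edge of color `i` goes.
    have h := g.toHom.nextCilium g.injective (hM.next i x₀)
    have h2 : W.blueMap.NextCilium i (g.toHom.toFun (cil x₀)) d' ↔
        g.toHom.toFun (cil (B.tau Ω i x₀)) = d' :=
      ⟨fun h' => h.unique h', fun h' => h' ▸ h⟩
    have h3 : G.edge i x = G.pairing (f.white (B.tau Ω i x₀)).1 := by
      rw [← f.map_pairing, B.pairing_tau, f.map_edge, hx₀]
    rw [h2, h3, G.pairing.apply_eq_iff_eq]
    constructor
    · rintro rfl
      exact Γ.pair.injective (Subtype.ext (W.α_invol.injective ((hfg _).symm.trans hd')))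
    · rintro rfl
      exact Subtype.ext ((hfg _).trans hd'.symm)

/-! ### The graph represented by a map -/

namespace WalshMap

variable {D : ℕ} (W : WalshMap D)

open Classical in
/-- A dart at a black vertex as a half-edge, if it is not a cilium. -/
noncomputable def toHalfEdge (d : W.dart) (hd : d ∈ W.black) : Option W.BlackHalfEdge :=
  if h : W.IsCilium d then none else some ⟨d, hd, h⟩

theorem toHalfEdge_eq_some_iff {d : W.dart} {hd : d ∈ W.black} {b : W.BlackHalfEdge} :
    W.toHalfEdge d hd = some b ↔ d = b.1 := by
  unfold toHalfEdge
  split_ifs with h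
  · exact iff_of_false nofun fun h2 => b.2.2 (h2 ▸ h)
  · exact ⟨fun h2 => congrArg (fun b : W.BlackHalfEdge => b.1) (Option.some.inj h2),
      fun h2 => congrArg some (Subtype.ext h2)⟩

/-- The half-edge before a given one around a black vertex, if there is no cilium in between. -/
noncomputable def blackPred : W.BlackHalfEdge ≃. W.BlackHalfEdge where
  toFun b := W.toHalfEdge (W.σ.symm b.1)
    (by rw [← W.black_σ, Equiv.apply_symm_apply]; exact b.2.1)
  invFun b := W.toHalfEdge (W.σ b.1) ((W.black_σ _).2 b.2.1)
  inv a b := by rw [toHalfEdge_eq_some_iff, toHalfEdge_eq_some_iff, Equiv.symm_apply_eq, eq_comm]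

theorem blackPred_eq_some_iff {a b : W.BlackHalfEdge} :
    W.blackPred b = some a ↔ W.σ a.1 = b.1 := by
  have hb : W.σ.symm b.1 ∈ W.black := by rw [← W.black_σ, Equiv.apply_symm_apply]; exact b.2.1
  exact (W.toHalfEdge_eq_some_iff (hd := hb)).trans (by rw [Equiv.symm_apply_eq, eq_comm])

end WalshMap

namespace WalshMap.IsStuffed

variable {D : ℕ} {W : WalshMap D} {M : CMap D} {p : ℕ} (hW : W.IsStuffed M p)
include hW

/-- A function which is constant along the chains of half-edges at the black vertices takes the same
value at the half-edge before and at the half-edge after a cilium. -/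
theorem eq_of_invariant_of_cilium {T : Sort*} (F : W.BlackHalfEdge → T)
    (hF : ∀ b b' : W.BlackHalfEdge, W.σ b.1 = b'.1 → F b' = F b) {c : W.dart} (hc : W.IsCilium c)
    {b b' : W.BlackHalfEdge} (hb : W.σ b.1 = c) (hb' : W.σ c = b'.1) : F b = F b' := by
  by_contra hne
  -- Turning from `b'`, the value of `F` persists until a cilium is met. The only cilium of the
  -- vertex is `c`, which is preceded by `b`, where the value is different. So `c` would never be
  -- reached, although it lies on the cycle.
  have key : ∀ n : ℕ, ∃ a : W.BlackHalfEdge, (W.σ ^ n) b'.1 = a.1 ∧ F a = F b' := by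
    intro n
    induction n with
    | zero => exact ⟨b', rfl, rfl⟩
    | succ n ih =>
      obtain ⟨a, ha, hFa⟩ := ih
      rw [pow_succ', Equiv.Perm.mul_apply, ha]
      by_cases hcil : W.IsCilium (W.σ a.1)
      · have hs : W.σ.SameCycle c (W.σ a.1) := by
          refine ⟨n + 1 + 1, ?_⟩
          have : (W.σ ^ (n + 1 + 1)) c = W.σ a.1 := by
            rw [pow_succ, Equiv.Perm.mul_apply, hb', pow_succ', Equiv.Perm.mul_apply, ha]
          exact_mod_cast this
        have h1 := hW.cilium_unique _ _ hc hcil hs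
        rw [← hb] at h1
        rw [← Subtype.ext (W.σ.injective h1)] at hFa
        exact absurd hFa hne
      · obtain ⟨a', ha'⟩ : ∃ a' : W.BlackHalfEdge, W.σ a.1 = a'.1 :=
          ⟨⟨W.σ a.1, (W.black_σ _).2 a.2.1, hcil⟩, rfl⟩
        exact ⟨a', ha', (hF a a' ha').trans hFa⟩
  have hs : W.σ.SameCycle b'.1 c := by
    rw [← hb', Equiv.Perm.sameCycle_apply_left]
  obtain ⟨n, hn⟩ := CMap.iterate_of_sameCycle (M := W.toCMap) hs
  obtain ⟨a, ha, -⟩ := key n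
  exact a.2.2 (by rw [← ha, hn]; exact hc)

variable {B : Bubble D} {Ω : B.Pairing} {cil : B.white → M.dart}
  (hM : M.RepresentsBubble B Ω cil)
include hM

theorem exists_nextCilium (i : Fin D) (b : W.BlackHalfEdge) :
    ∃ b', W.blueMap.NextCilium i (hW.foot b) (hW.foot b') := by
  obtain ⟨C, g, x, -, rfl⟩ := hW.exists_eq_hub hM b
  exact ⟨_, (hW.nextCilium_hub hM g).2 rfl⟩

/-- A face does not leave its blue submap before the next cilium, so both half-edges lead to the
same copy of `M`, where injectivity of `τ i` decides. -/
theorem nextCilium_left_unique {i : Fin D} {b b' c : W.BlackHalfEdge}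
    (h : W.blueMap.NextCilium i (hW.foot b) (hW.foot c))
    (h' : W.blueMap.NextCilium i (hW.foot b') (hW.foot c)) : b = b' := by
  obtain ⟨C, g, x, hC, rfl⟩ := hW.exists_eq_hub hM b
  have hC' := h'.comp_eq.symm.trans (h.comp_eq.trans hC)
  obtain ⟨y, rfl⟩ := hW.exists_hub_eq hM g hC'
  rw [hW.nextCilium_hub hM g] at h h'
  have := hW.hub_injective hM g (h.symm.trans h')
  rw [(B.tau Ω i).injective this]

/-- The permutation of the half-edges at black vertices which describes the edges of color `i`. -/
noncomputable def nextPerm (i : Fin D) : Equiv.Perm W.BlackHalfEdge :=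
  Equiv.ofBijective (fun b => (hW.exists_nextCilium hM i b).choose) <| by
    have := W.finite_dart
    have : Finite W.BlackHalfEdge := Subtype.finite
    refine Finite.injective_iff_bijective.1 fun b b' h => ?_
    have h1 := (hW.exists_nextCilium hM i b).choose_spec
    have h2 := (hW.exists_nextCilium hM i b').choose_spec
    rw [show (hW.exists_nextCilium hM i b).choose = _ from h] at h1
    exact hW.nextCilium_left_unique hM h1 h2

theorem nextPerm_eq_iff {i : Fin D} {b b' : W.BlackHalfEdge} :
    hW.nextPerm hM i b = b' ↔ W.blueMap.NextCilium i (hW.foot b) (hW.foot b') := by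
  have h := (hW.exists_nextCilium hM i b).choose_spec
  refine ⟨?_, fun h' => hW.foot_injective (h.unique h')⟩
  rintro rfl
  exact h

omit hM in
/-- The paired graph represented by a stuffed Walsh map. -/
noncomputable def toGraph (hM : M.RepresentsBubble B Ω cil) : PairedGraph D where
  white := W.BlackHalfEdge
  black := W.BlackHalfEdge
  finite_white := have := W.finite_dart; Subtype.finite
  finite_black := have := W.finite_dart; Subtype.finite
  edge := hW.nextPerm hM
  edge0 := W.blackPred
  pairing := Equiv.refl _

omit hM in
/-- A stuffed Walsh map represents a graph. -/
theorem exists_core (hM : M.RepresentsBubble B Ω cil) :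
    ∃ G : PairedGraph D, Nonempty (CoreCorrespondence G W) := by
  refine ⟨hW.toGraph hM, ⟨⟨Equiv.refl _, fun x y => ?_, fun i x y d d' hd hd' => ?_⟩⟩⟩
  · exact (W.blackPred_eq_some_iff (a := x) (b := y)).symm
  · obtain rfl : hW.foot x = d := Subtype.ext hd.symm
    obtain rfl : hW.foot y = d' := Subtype.ext hd'.symm
    exact (hW.nextPerm_eq_iff hM).symm

end WalshMap.IsStuffed

/-! ### Transport to isomorphic graphs, and connectedness of the represented graph -/

namespace CoreCorrespondence

variable {D : ℕ} {B : Bubble D} {Ω : B.Pairing} {M : CMap D} {cil : B.white → M.dart} {p : ℕ}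
  {G G' : PairedGraph D} {W W' : WalshMap D} (K : CoreCorrespondence G W)
  (hM : M.RepresentsBubble B Ω cil) (hW : W.IsStuffed M p)

/-- Two graphs represented by the same map are isomorphic. -/
noncomputable def isoOfSameMap (hW : W.IsStuffed M p) (K' : CoreCorrespondence G' W) :
    G.Iso G' where
  white := K.pair.trans K'.pair.symm
  black := (G.pairing.symm.trans (K.pair.trans K'.pair.symm)).trans G'.pairing
  map_edge i x := by
    obtain ⟨y, hy⟩ := exists_edge_eq (G := G) i x
    have h := (K.nextCilium_foot hW i).2 hy
    rw [hy]
    refine (Eq.trans ?_ ((K'.nextCilium_foot hW i (x := K'.pair.symm (K.pair x))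
      (y := K'.pair.symm (K.pair y))).1 ?_).symm)
    · simp
    · simpa using h
  map_edge0 x y := by
    obtain ⟨z, rfl⟩ := G.pairing.surjective y
    rw [← K.succ]
    simp only [Equiv.trans_apply, Equiv.symm_apply_apply]
    rw [← K'.succ, Equiv.apply_symm_apply, Equiv.apply_symm_apply]
  map_pairing x := by simp

/-- Transport along an isomorphism of graphs. -/
def ofGraphIso (f : G.Iso G') : CoreCorrespondence G' W where
  pair := f.white.symm.trans K.pair
  succ x y := by
    obtain ⟨x, rfl⟩ := f.white.surjective x
    obtain ⟨y, rfl⟩ := f.white.surjective y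
    rw [← f.map_pairing, ← f.map_edge0, ← K.succ]
    simp
  next i x y d d' hd hd' := by
    obtain ⟨x, rfl⟩ := f.white.surjective x
    obtain ⟨y, rfl⟩ := f.white.surjective y
    rw [← f.map_pairing, ← f.map_edge, f.black.apply_eq_iff_eq]
    exact K.next i x y d d' (by simpa using hd) (by simpa using hd')

end CoreCorrespondence

theorem CMap.Hom.nextCilium_of_map {D : ℕ} {M N : CMap D} {i : Fin D} (φ : CMap.Hom M N)
    (hφ : Function.Injective φ.toFun) {d c : M.dart}
    (h : N.NextCilium i (φ.toFun d) (φ.toFun c)) : M.NextCilium i d c := by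
  generalize hd : φ.toFun d = a at h
  generalize hc : φ.toFun c = b at h
  induction h generalizing d with
  | here a h =>
    rw [← hd, ← φ.map_faceStep] at hc h
    rw [φ.isCilium_iff hφ] at h
    exact .of_isCilium (hφ hc).symm (hφ hc ▸ h)
  | step a b h _ ih =>
    rw [← hd, ← φ.map_faceStep, φ.isCilium_iff hφ] at h
    exact .step _ _ h (ih (by rw [φ.map_faceStep, hd]) hc)

namespace CoreCorrespondence

variable {D : ℕ} {B : Bubble D} {Ω : B.Pairing} {M : CMap D} {cil : B.white → M.dart} {p : ℕ}
  {G : PairedGraph D} {W : WalshMap D} (K : CoreCorrespondence G W)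
  (hM : M.RepresentsBubble B Ω cil) (hW : W.IsStuffed M p)

/-- The pair `x` lies next to the dart `d`: it is sent to `d`, or to the half-edge after the
cilium `d`, or to a half-edge leading to the blue submap of `d`. -/
def Near (d : W.dart) (x : G.white) : Prop :=
  d = (K.pair x).1 ∨ (W.IsCilium d ∧ W.σ d = (K.pair x).1) ∨
    ∃ e : W.blueMap.dart, e.1 = d ∧ K.blueComp hW (Sum.inl x) = W.blueMap.comp e

theorem near_pair_iff {x y : G.white} : K.Near hW (K.pair x).1 y ↔ y = x := by
  constructor
  · rintro (h | ⟨h, -⟩ | ⟨e, he, -⟩)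
    · exact (K.pair.injective (Subtype.ext h)).symm
    · exact absurd h (K.pair x).2.2
    · exact absurd (he ▸ (K.pair x).2.1) e.2
  · rintro rfl
    exact .inl rfl

theorem near_cilium_iff {d : W.dart} (hd : W.IsCilium d) {y : G.white} :
    K.Near hW d y ↔ W.σ d = (K.pair y).1 := by
  constructor
  · rintro (rfl | ⟨-, h⟩ | ⟨e, rfl, -⟩)
    · exact absurd hd (K.pair y).2.2
    · exact h
    · exact absurd hd (hW.not_isCilium_blue _)
  · exact fun h => .inr (.inl ⟨hd, h⟩)

theorem near_blue_iff {e : W.blueMap.dart} {y : G.white} :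
    K.Near hW e.1 y ↔ K.blueComp hW (Sum.inl y) = W.blueMap.comp e := by
  constructor
  · rintro (h | ⟨h, -⟩ | ⟨e', he, h⟩)
    · exact absurd (h ▸ (K.pair y).2.1) e.2
    · exact absurd h (hW.not_isCilium_blue _)
    · rw [h, Subtype.ext he]
  · exact fun h => .inr (.inr ⟨e, rfl, h⟩)

include hM in
theorem exists_near (d : W.dart) : ∃ x, K.Near hW d x := by
  by_cases hb : d ∈ W.black
  · by_cases hc : W.IsCilium d
    · obtain ⟨b, hb⟩ := hW.exists_σ_eq hc
      exact ⟨K.pair.symm b, .inr (.inl ⟨hc, by simpa using hb⟩)⟩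
    · obtain ⟨x, hx⟩ := K.pair.surjective ⟨d, hb, hc⟩
      exact ⟨x, .inl (by rw [hx])⟩
  · obtain ⟨x, hx⟩ := K.exists_blueComp_eq hM hW (W.blueMap.comp ⟨d, hb⟩)
    exact ⟨x, .inr (.inr ⟨⟨d, hb⟩, rfl, hx⟩)⟩

section Invariant

variable {T : Sort*} (F : G.Vertex → T) (hF : ∀ i x, F (Sum.inr (G.edge i x)) = F (Sum.inl x))
  (hF0 : ∀ x y, G.edge0 x = some y → F (Sum.inr y) = F (Sum.inl x))
include K hM hW hF

theorem apply_eq_of_blueComp_eq {u v : G.Vertex} (h : K.blueComp hW u = K.blueComp hW v) :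
    F u = F v :=
  G.eq_of_comp_eq F hF ((K.comp_eq_iff hM hW u v).2 h)

/-- Several pairs are near a blue dart if its copy of `M` has several cilia, but all of them belong
to one bubble, on which `F` is constant. -/
theorem near_unique {d : W.dart} {x y : G.white} (hx : K.Near hW d x) (hy : K.Near hW d y) :
    F (Sum.inl x) = F (Sum.inl y) := by
  rcases id hx with rfl | ⟨hc, -⟩ | ⟨e, rfl, h⟩
  · rw [(K.near_pair_iff hW).1 hy]
  · rw [K.near_cilium_iff hW hc] at hx hy
    rw [K.pair.injective (Subtype.ext (hx.symm.trans hy))]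
  · rw [near_blue_iff] at hx hy
    exact K.apply_eq_of_blueComp_eq hM hW F hF (hx.trans hy.symm)

theorem near_α {d : W.dart} {x : G.white} (hx : K.Near hW d x) : 
    ∃ y, K.Near hW (W.α d) y ∧ F (Sum.inl y) = F (Sum.inl x) := by
  rcases id hx with rfl | ⟨hc, -⟩ | ⟨e, rfl, h⟩
  · exact ⟨x, .inr (.inr ⟨hW.foot (K.pair x), rfl, rfl⟩), rfl⟩
  · exact ⟨x, by rwa [show W.α d = d from hc], rfl⟩
  · by_cases hα : W.α e.1 ∈ W.black
    · obtain ⟨b, rfl⟩ := hW.exists_foot_eq ((hW.isCilium_blueMap e).2 hα)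
      obtain ⟨y, rfl⟩ := K.pair.surjective b
      refine ⟨y, .inl (hW.α_foot _), K.apply_eq_of_blueComp_eq hM hW F hF ?_⟩
      rw [h]; rfl
    · refine ⟨x, ?_, rfl⟩
      rw [← WalshMap.blueMap_α_of_notMem hα, near_blue_iff, CMap.comp_α, h]

include hF0

theorem apply_eq_of_succ {x y : G.white} (h : W.σ (K.pair x).1 = (K.pair y).1) :
    F (Sum.inl y) = F (Sum.inl x) := by
  rw [← hF0 _ _ ((K.succ x y).1 h)]
  exact G.eq_of_comp_eq F hF (K.comp_pairing hM hW x)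

theorem near_σ {d : W.dart} {x : G.white} (hx : K.Near hW d x) :
    ∃ y, K.Near hW (W.σ d) y ∧ F (Sum.inl y) = F (Sum.inl x) := by
  rcases id hx with rfl | ⟨hc, h⟩ | ⟨e, rfl, h⟩
  · by_cases hc : W.IsCilium (W.σ (K.pair x).1)
    · obtain ⟨b, hb⟩ := hW.exists_σ_eq hc
      obtain ⟨y, rfl⟩ := K.pair.surjective b
      refine ⟨y, .inr (.inl ⟨hc, hb⟩), ?_⟩
      -- Across a cilium there is no edge of color `0`; the two pairs are compared along the rest of
      -- the black vertex, which joins them by the chain.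
      have := hW.eq_of_invariant_of_cilium (fun b => F (Sum.inl (K.pair.symm b))) ?_ hc rfl hb
      · simpa using this.symm
      · intro b b' h
        refine K.apply_eq_of_succ hM hW F hF hF0 ?_
        rwa [Equiv.apply_symm_apply, Equiv.apply_symm_apply]
    · obtain ⟨y, hy⟩ := K.pair.surjective ⟨_, (W.black_σ _).2 (K.pair x).2.1, hc⟩
      have hy' : W.σ (K.pair x).1 = (K.pair y).1 := by rw [hy]
      exact ⟨y, .inl hy', K.apply_eq_of_succ hM hW F hF hF0 hy'⟩
  · exact ⟨x, .inl h, rfl⟩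
  · refine ⟨x, ?_, rfl⟩
    rw [← WalshMap.blueMap_σ, near_blue_iff, CMap.comp_σ, h]

/-- An invariant function on `G` is moved to the darts of `W` by evaluating it at a near pair. The
result depends on no choice and is invariant under `σ` and `α`, so the connectedness of `W` makes it
constant. -/
theorem apply_eq_of_connected (u v : G.Vertex) : F u = F v := by
  have key : ∀ d d', W.comp d = W.comp d' →
      ∀ x y, K.Near hW d x → K.Near hW d' y → F (Sum.inl x) = F (Sum.inl y) := by
    intro d d' h x y hx hy
    choose r hr using K.exists_near hM hW
    have h1 := CMap.eq_of_comp_eq (M := W.toCMap) (fun d => F (Sum.inl (r d))) (fun d => by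
      obtain ⟨z, hz, hz'⟩ := K.near_σ hM hW F hF hF0 (hr d)
      exact (K.near_unique hM hW F hF (hr _) hz).trans hz') (fun d => by
      obtain ⟨z, hz, hz'⟩ := K.near_α hM hW F hF (hr d)
      exact (K.near_unique hM hW F hF (hr _) hz).trans hz') h
    exact (K.near_unique hM hW F hF hx (hr d)).trans
      (h1.trans (K.near_unique hM hW F hF (hr d') hy))
  have key2 : ∀ x y : G.white, F (Sum.inl x) = F (Sum.inl y) := fun x y =>
    key _ _ (hW.connected.2 (K.pair x).1 (K.pair y).1) _ _ (.inl rfl) (.inl rfl)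
  have key3 : ∀ u : G.Vertex, ∃ x, F u = F (Sum.inl x) := by
    rintro (x | y)
    · exact ⟨x, rfl⟩
    · obtain ⟨x, rfl⟩ := G.pairing.surjective y
      exact ⟨x, G.eq_of_comp_eq F hF (K.comp_pairing hM hW x)⟩
  obtain ⟨x, hx⟩ := key3 u
  obtain ⟨y, hy⟩ := key3 v
  rw [hx, hy, key2 x y]

end Invariant

include K in
/-- Cilia are sent to free white vertices. -/
theorem card_free_white (hW : W.IsStuffed M p) :
    Nat.card {x : G.white // G.IsFree (Sum.inl x)} = p := by
  rw [← hW.card_cilia]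
  refine Nat.card_congr (Equiv.ofBijective
    (fun x => ⟨W.σ.symm (K.pair x.1).1, K.isFree_white_iff.1 x.2⟩) ⟨?_, ?_⟩)
  · rintro ⟨x, hx⟩ ⟨y, hy⟩ h
    exact Subtype.ext (K.pair.injective (Subtype.ext (W.σ.symm.injective (congrArg Subtype.val h))))
  · rintro ⟨c, hc⟩
    obtain ⟨b, hb⟩ := hW.exists_σ_eq hc
    obtain ⟨x, rfl⟩ := K.pair.surjective b
    have h : W.σ.symm (K.pair x).1 = c := by rw [← hb, Equiv.symm_apply_apply]
    exact ⟨⟨x, K.isFree_white_iff.2 (h ▸ hc)⟩, Subtype.ext h⟩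

include K in
theorem card_free_black (hW : W.IsStuffed M p) :
    Nat.card {y : G.black // G.IsFree (Sum.inr y)} = p := by
  rw [← hW.card_cilia]
  refine Nat.card_congr (Equiv.ofBijective
    (fun y => ⟨W.σ (K.pair (G.pairing.symm y.1)).1, K.isFree_black_iff.1 (by simpa using y.2)⟩)
    ⟨?_, ?_⟩)
  · rintro ⟨x, hx⟩ ⟨y, hy⟩ h
    exact Subtype.ext (G.pairing.symm.injective (K.pair.injective
      (Subtype.ext (W.σ.injective (congrArg Subtype.val h)))))
  · rintro ⟨c, hc⟩
    obtain ⟨b, hb⟩ := hW.exists_eq_σ hc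
    obtain ⟨x, rfl⟩ := K.pair.surjective b
    exact ⟨⟨G.pairing x, K.isFree_black_iff.2 (hb ▸ hc)⟩, Subtype.ext (by simpa using hb)⟩

include K hM hW in
theorem isBuiltFrom : G.IsBuiltFrom B Ω p := by
  have hiso : ∀ C : G.Comp, Nonempty (G.CompIso B Ω C) := fun C => by
    obtain ⟨g⟩ := hW.submaps (K.bubbleEquiv hM hW C)
    exact ⟨K.compIso hM hW g⟩
  have : Nonempty G.Vertex := by
    obtain ⟨d⟩ := hW.connected.1
    obtain ⟨x, -⟩ := K.exists_near hM hW d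
    exact ⟨Sum.inl x⟩
  exact ⟨⟨G.connected_of_forall fun F hF hF0 => K.apply_eq_of_connected hM hW F hF hF0,
    K.card_free_white hW, K.card_free_black hW, fun C => (hiso C).map fun f => f.toCompIso⟩, hiso⟩

end CoreCorrespondence

/-! ### Isomorphic maps, and uniqueness of the map of a graph -/

namespace WalshMap

variable {D : ℕ} {W W' : WalshMap D}

/-- The action of an isomorphism on the darts of the blue submaps. -/
def Iso.blueFun (f : W.Iso W') (d : W.blueMap.dart) : W'.blueMap.dart :=
  ⟨f.toEquiv d.1, fun h => d.2 ((f.map_black _).1 h)⟩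

theorem Iso.blueFun_val (f : W.Iso W') (d : W.blueMap.dart) :
    (f.blueFun d).1 = f.toEquiv d.1 := rfl

theorem Iso.α_blueFun_mem (f : W.Iso W') {d : W.blueMap.dart} :
    W'.α (f.blueFun d).1 ∈ W'.black ↔ W.α d.1 ∈ W.black := by
  rw [f.blueFun_val, ← f.map_α, f.map_black]

/-- An isomorphism of maps with black and blue vertices is a morphism of the blue submaps. -/
def Iso.blueHom (f : W.Iso W') : CMap.Hom W.blueMap W'.blueMap where
  toFun := f.blueFun
  map_σ d := Subtype.ext (f.map_σ d.1)
  map_α d := by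
    apply Subtype.ext
    by_cases h : W.α d.1 ∈ W.black
    · rw [blueMap_α_of_mem h, blueMap_α_of_mem (f.α_blueFun_mem.2 h)]
    · rw [blueMap_α_of_notMem (mt f.α_blueFun_mem.1 h), f.blueFun_val, f.blueFun_val,
        blueMap_α_of_notMem h, f.map_α]
  map_color d := by
    by_cases h : W.α d.1 ∈ W.black
    · rw [blueMap_color_of_mem h, blueMap_color_of_mem (f.α_blueFun_mem.2 h)]
    · rw [blueMap_color_of_notMem h, blueMap_color_of_notMem (mt f.α_blueFun_mem.1 h)]
      exact f.map_color _

theorem Iso.isCilium_iff (f : W.Iso W') {d : W.dart} : W'.IsCilium (f.toEquiv d) ↔ W.IsCilium d := by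
  unfold CMap.IsCilium
  rw [← f.map_α, f.toEquiv.apply_eq_iff_eq]

end WalshMap

namespace CoreCorrespondence

variable {D : ℕ} {B : Bubble D} {Ω : B.Pairing} {M : CMap D} {cil : B.white → M.dart} {p : ℕ}
  {G : PairedGraph D} {W W' : WalshMap D} (K : CoreCorrespondence G W)
  (hM : M.RepresentsBubble B Ω cil) (hW : W.IsStuffed M p)

/-- Transport along an isomorphism of maps. -/
def ofMapIso (f : W.Iso W') : CoreCorrespondence G W' where
  pair := K.pair.trans (f.toEquiv.subtypeEquiv fun d =>
    and_congr (f.map_black d).symm (not_congr f.isCilium_iff.symm))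
  succ x y := by
    rw [← K.succ]
    change W'.σ (f.toEquiv (K.pair x).1) = f.toEquiv (K.pair y).1 ↔ _
    rw [← f.map_σ, f.toEquiv.apply_eq_iff_eq]
  next i x y d d' hd hd' := by
    have key : ∀ (x : G.white) (d : W'.blueMap.dart), d.1 = W'.α (f.toEquiv (K.pair x).1) →
        ∃ e : W.blueMap.dart, f.blueHom.toFun e = d ∧ e.1 = W.α (K.pair x).1 := by
      intro x d hd
      rw [← f.map_α] at hd
      exact ⟨⟨_, fun h => d.2 (hd ▸ (f.map_black _).2 h)⟩, Subtype.ext hd.symm, rfl⟩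
    obtain ⟨e, rfl, he⟩ := key x d hd
    obtain ⟨e', rfl, he'⟩ := key y d' hd'
    rw [← K.next i x y e e' he he']
    have hinj : Function.Injective f.blueHom.toFun := fun a b h =>
      Subtype.ext (f.toEquiv.injective (congrArg Subtype.val h))
    exact ⟨f.blueHom.nextCilium_of_map hinj, f.blueHom.nextCilium hinj⟩

end CoreCorrespondence

/-- The automorphisms of `(B, Ω)` act on the map `M`. -/
def CMap.IsSymmetric {D : ℕ} (M : CMap D) (B : Bubble D) (Ω : B.Pairing)
    (cil : B.white → M.dart) : Prop :=
  ∀ f, B.IsPairAut Ω f → ∃ φ : CMap.Hom M M, ∀ x, φ.toFun (cil x) = cil (f x)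

/-- Composition of morphisms of maps. -/
def CMap.Hom.comp {D : ℕ} {L M N : CMap D} (ψ : CMap.Hom M N) (φ : CMap.Hom L M) :
    CMap.Hom L N where
  toFun d := ψ.toFun (φ.toFun d)
  map_σ d := by rw [φ.map_σ, ψ.map_σ]
  map_α d := by rw [φ.map_α, ψ.map_α]
  map_color d := by rw [ψ.map_color, φ.map_color]

theorem CMap.Hom.surjective {D : ℕ} {M N : CMap D} (φ : CMap.Hom M N) (hM : Nonempty M.dart)
    (hN : ∀ d d', N.comp d = N.comp d') : Function.Surjective φ.toFun := fun e => by
  obtain ⟨d⟩ := hM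
  exact φ.mem_range_of_comp_eq d (hN _ e)

/-- Measures how much two identifications of a bubble with `(B, Ω)` differ; this is the ambiguity
which symmetry of `M` has to absorb. -/
theorem ColoredGraph.CompIso.isPairAut {D : ℕ} {B : Bubble D} {Ω : B.Pairing} {G : PairedGraph D}
    {C : G.Comp} (f f' : G.CompIso B Ω C) : B.IsPairAut Ω (f.white.trans f'.white.symm) := by
  have hw : ∀ x, (f'.white ((f.white.trans f'.white.symm) x)).1 = (f.white x).1 := fun x => by simp
  refine ⟨f.black.trans f'.black.symm, fun i x => ?_, fun x => ?_⟩
  · rw [Equiv.trans_apply, Equiv.symm_apply_eq]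
    apply Subtype.ext
    rw [f'.map_edge, f.map_edge, hw]
  · rw [Equiv.trans_apply, Equiv.symm_apply_eq]
    apply Subtype.ext
    rw [f'.map_pairing, f.map_pairing, hw]

namespace CoreCorrespondence

variable {D : ℕ} {B : Bubble D} {Ω : B.Pairing} {M : CMap D} {cil : B.white → M.dart} {p : ℕ}
  {G : PairedGraph D} {W W' : WalshMap D} (K : CoreCorrespondence G W)
  (K' : CoreCorrespondence G W')
  (hM : M.RepresentsBubble B Ω cil) (hW : W.IsStuffed M p) (hW' : W'.IsStuffed M p)
  (hsymm : M.IsSymmetric B Ω cil)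

include hsymm in
-- Chosen isomorphisms from `M` to the two submaps of the same bubble may match the pairs
-- differently. The difference is an automorphism of `(B, Ω)`; composing with its action on `M`
-- corrects it.
theorem exists_compIso_hom (C : W.blueMap.Comp) :
    ∃ (g : CMap.CompIso M W.blueMap C) (h : CMap.Hom M W'.blueMap), Function.Injective h.toFun ∧
      ∀ x, h.toFun (cil x) = hW'.foot (K'.pair (K.pair.symm (hW.hub hM g x))) := by
  obtain ⟨C, rfl⟩ := (K.bubbleEquiv hM hW).surjective C
  obtain ⟨g⟩ := hW.submaps (K.bubbleEquiv hM hW C)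
  obtain ⟨g'⟩ := hW'.submaps (K'.bubbleEquiv hM hW' C)
  have ha := ColoredGraph.CompIso.isPairAut (K.compIso hM hW g) (K'.compIso hM hW' g')
  obtain ⟨φ, hφ⟩ := hsymm _ ha
  -- A morphism to a connected map is surjective, hence injective here because `M` is finite.
  have hφinj : Function.Injective φ.toFun := by
    have := M.finite_dart
    obtain ⟨x⟩ := B.nonempty_white Ω
    exact Finite.injective_iff_surjective.2 (φ.surjective ⟨cil x⟩ hM.connected)
  refine ⟨g, g'.toHom.comp φ, g'.injective.comp hφinj, fun x => ?_⟩
  change g'.toHom.toFun (φ.toFun (cil x)) = _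
  rw [hφ]
  refine (hW'.foot_hub hM g' _).symm.trans (congrArg _ ?_)
  rw [← Equiv.symm_apply_eq, ← K'.compIso_white hM hW' g', ← K.compIso_white hM hW g]
  simp

include K K' hM hW hW' hsymm in
/-- Two maps which represent the same graph have the same blue submaps. -/
theorem exists_blueHom : ∃ h : CMap.Hom W.blueMap W'.blueMap,
    (∀ e, W'.blueMap.IsCilium (h.toFun e) ↔ W.blueMap.IsCilium e) ∧
      ∀ x, h.toFun (hW.foot (K.pair x)) = hW'.foot (K'.pair x) := by
  choose g h hinj hcil using K.exists_compIso_hom K' hM hW hW' hsymm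
  -- The blue submaps are disjoint, so the morphisms found for the single components are put
  -- together.
  let H : W.blueMap.dart → W'.blueMap.dart := fun e =>
    (h (W.blueMap.comp e)).toFun ((g (W.blueMap.comp e)).toEquiv.symm ⟨e, rfl⟩)
  have hH : ∀ C e m, W.blueMap.comp e = C → (g C).toHom.toFun m = e → H e = (h C).toFun m := by
    rintro C e m rfl hm
    refine congrArg (h (W.blueMap.comp e)).toFun ?_
    rw [Equiv.symm_apply_eq]
    exact Subtype.ext hm.symm
  have hH' : ∀ C m, H ((g C).toHom.toFun m) = (h C).toFun m := fun C m =>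
    hH C _ m ((g C).toEquiv m).2 rfl
  have hrep : ∀ e, ∃ C m, e = (g C).toHom.toFun m := fun e =>
    ⟨W.blueMap.comp e, (g _).toEquiv.symm ⟨e, rfl⟩, by simp [CMap.CompIso.toHom]⟩
  refine ⟨⟨H, fun e => ?_, fun e => ?_, fun e => ?_⟩, fun e => ?_, fun x => ?_⟩
  · obtain ⟨C, m, rfl⟩ := hrep e
    rw [← CMap.Hom.map_σ, hH', hH', CMap.Hom.map_σ]
  · obtain ⟨C, m, rfl⟩ := hrep e
    rw [← CMap.Hom.map_α, hH', hH', CMap.Hom.map_α]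
  · obtain ⟨C, m, rfl⟩ := hrep e
    rw [hH', CMap.Hom.map_color, CMap.Hom.map_color]
  · obtain ⟨C, m, rfl⟩ := hrep e
    change W'.blueMap.IsCilium (H _) ↔ _
    rw [hH', (h C).isCilium_iff (hinj C), (g C).toHom.isCilium_iff (g C).injective]
  · obtain ⟨x₀, hx₀⟩ := hW.exists_hub_eq hM (g (W.blueMap.comp (hW.foot (K.pair x)))) rfl
    have h1 := hW.foot_hub hM (g (W.blueMap.comp (hW.foot (K.pair x)))) x₀
    rw [hx₀] at h1
    change H _ = _
    rw [hH _ _ (cil x₀) rfl h1.symm, hcil, hx₀, Equiv.symm_apply_apply]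

include K K' hW hW' in
/-- The end and the beginning of a chain are next to the same cilium in both maps. -/
theorem σ_σ_pair_eq {x y : G.white} (hc : W.IsCilium (W.σ (K.pair x).1))
    (h : W.σ (W.σ (K.pair x).1) = (K.pair y).1) :
    W'.IsCilium (W'.σ (K'.pair x).1) ∧ W'.σ (W'.σ (K'.pair x).1) = (K'.pair y).1 := by
  have hc' : W'.IsCilium (W'.σ (K'.pair x).1) := by
    rw [← K'.isFree_black_iff, K.isFree_black_iff]; exact hc
  refine ⟨hc', ?_⟩
  -- Being at the same black vertex of `W'` is invariant along the chains, which are the same in `W`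
  -- and `W'`. So both ends of the chain lie at one vertex of `W'`, and this vertex has only one
  -- cilium.
  have h1 := hW.eq_of_invariant_of_cilium
    (fun b => W'.σ.SameCycle (K'.pair x).1 (K'.pair (K.pair.symm b)).1) ?_ hc rfl h
  · simp only [Equiv.symm_apply_apply] at h1
    have h2 : W'.σ.SameCycle (K'.pair x).1 (K'.pair y).1 := h1 ▸ Equiv.Perm.SameCycle.refl _ _
    have hy : W'.IsCilium (W'.σ.symm (K'.pair y).1) := by
      rw [← K'.isFree_white_iff, K.isFree_white_iff, ← h, Equiv.symm_apply_apply]; exact hc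
    have h3 := hW'.cilium_unique _ _ hc' hy (by
      rw [Equiv.Perm.sameCycle_apply_left]
      exact (Equiv.Perm.sameCycle_symm_apply_right).2 h2)
    rw [h3, Equiv.apply_symm_apply]
  · intro b b' hb
    obtain ⟨z, rfl⟩ := K.pair.surjective b
    obtain ⟨z', rfl⟩ := K.pair.surjective b'
    rw [K.succ, ← K'.succ] at hb
    rw [Equiv.symm_apply_apply, Equiv.symm_apply_apply, ← hb, Equiv.Perm.sameCycle_apply_right]

include K K' hM hW hW' hsymm in
-- The morphism is forced: half-edges follow their pairs, a cilium follows the half-edge after it,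
-- and blue darts follow `exists_blueHom`. It is given by the functional relation `R`, so that
-- compatibility with `σ` and `α` is checked by exhibiting both values as related to the same dart.
theorem exists_hom : ∃ h : CMap.Hom W.toCMap W'.toCMap,
    ∀ d, h.toFun d ∈ W'.black ↔ d ∈ W.black := by
  obtain ⟨h, hcil, hfoot⟩ := K.exists_blueHom K' hM hW hW' hsymm
  let R : W.dart → W'.dart → Prop := fun d d' =>
    (∃ x, d = (K.pair x).1 ∧ d' = (K'.pair x).1) ∨
      (∃ x, W.IsCilium d ∧ W.σ d = (K.pair x).1 ∧ W'.σ d' = (K'.pair x).1) ∨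
      ∃ e, d = e.1 ∧ d' = (h.toFun e).1
  have hex : ∀ d, ∃ d', R d d' := by
    intro d
    by_cases hb : d ∈ W.black
    · by_cases hc : W.IsCilium d
      · obtain ⟨b, hb⟩ := hW.exists_σ_eq hc
        obtain ⟨x, rfl⟩ := K.pair.surjective b
        exact ⟨W'.σ.symm (K'.pair x).1, .inr (.inl ⟨x, hc, hb, by simp⟩)⟩
      · obtain ⟨x, hx⟩ := K.pair.surjective ⟨d, hb, hc⟩
        exact ⟨_, .inl ⟨x, by rw [hx], rfl⟩⟩
    · exact ⟨_, .inr (.inr ⟨⟨d, hb⟩, rfl, rfl⟩)⟩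
  have huniq : ∀ d d' d'', R d d' → R d d'' → d' = d'' := by
    rintro d d' d'' (⟨x, rfl, rfl⟩ | ⟨x, hc, hx, hx'⟩ | ⟨e, rfl, rfl⟩)
      (⟨y, hy, rfl⟩ | ⟨y, hc', hy, hy'⟩ | ⟨e', he, rfl⟩)
    · rw [K.pair.injective (Subtype.ext hy)]
    · exact absurd hc' (K.pair x).2.2
    · exact absurd (he ▸ (K.pair x).2.1) e'.2
    · exact absurd (hy ▸ hc) (K.pair y).2.2
    · apply W'.σ.injective
      rw [hx', hy', K.pair.injective (Subtype.ext (hx.symm.trans hy))]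
    · exact absurd (he ▸ hc) (hW.not_isCilium_blue _)
    · exact absurd (hy ▸ (K.pair y).2.1) e.2
    · exact absurd hc' (hW.not_isCilium_blue _)
    · rw [Subtype.ext he]
  have hcil' : ∀ {x d d'}, W.IsCilium d → W.σ d = (K.pair x).1 → W'.σ d' = (K'.pair x).1 →
      W'.IsCilium d' := by
    intro x d d' hc hx hx'
    have := K'.isFree_white_iff (x := x)
    rw [K.isFree_white_iff, ← hx, ← hx', Equiv.symm_apply_apply, Equiv.symm_apply_apply] at this
    exact this.1 hc
  choose H hH using hex
  refine ⟨⟨H, fun d => huniq _ _ _ (hH _) ?_, fun d => huniq _ _ _ (hH _) ?_, fun d => ?_⟩,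
    fun d => ?_⟩
  · obtain ⟨x, rfl, hx⟩ | ⟨x, hc, hx, hx'⟩ | ⟨e, rfl, he⟩ := hH d
    · rw [hx]
      by_cases hc : W.IsCilium (W.σ (K.pair x).1)
      · obtain ⟨b, hb⟩ := hW.exists_σ_eq hc
        obtain ⟨y, rfl⟩ := K.pair.surjective b
        exact .inr (.inl ⟨y, hc, hb, (K.σ_σ_pair_eq K' hW hW' hc hb).2⟩)
      · obtain ⟨y, hy⟩ := K.pair.surjective ⟨_, (W.black_σ _).2 (K.pair x).2.1, hc⟩
        have hy' : W.σ (K.pair x).1 = (K.pair y).1 := by rw [hy]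
        exact .inl ⟨y, hy', (K'.succ x y).2 ((K.succ x y).1 hy')⟩
    · exact .inl ⟨x, hx, hx'⟩
    · rw [he]
      exact .inr (.inr ⟨W.blueMap.σ e, rfl, by rw [h.map_σ]; rfl⟩)
  · obtain ⟨x, rfl, hx⟩ | ⟨x, hc, hx, hx'⟩ | ⟨e, rfl, he⟩ := hH d
    · rw [hx]
      exact .inr (.inr ⟨hW.foot (K.pair x), rfl, by rw [hfoot]; rfl⟩)
    · rw [show W.α d = d from hc, show W'.α (H d) = H d from hcil' hc hx hx']
      exact hH d
    · rw [he]
      by_cases hα : W.α e.1 ∈ W.black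
      · obtain ⟨b, rfl⟩ := hW.exists_foot_eq ((hW.isCilium_blueMap e).2 hα)
        obtain ⟨x, rfl⟩ := K.pair.surjective b
        rw [hfoot, hW.α_foot, hW'.α_foot]
        exact .inl ⟨x, rfl, rfl⟩
      · refine .inr (.inr ⟨W.blueMap.α e, (WalshMap.blueMap_α_of_notMem hα).symm, ?_⟩)
        rw [h.map_α, WalshMap.blueMap_α_of_notMem]
        rwa [← hW'.isCilium_blueMap, hcil, hW.isCilium_blueMap]
  · obtain ⟨x, rfl, hx⟩ | ⟨x, hc, hx, hx'⟩ | ⟨e, rfl, he⟩ := hH d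
    · rw [hx]
      ext i
      rw [K.label hM hW, K'.label hM hW']
    · rw [hW.cilium_color _ hc, hW'.cilium_color _ (hcil' hc hx hx')]
    · rw [he]
      by_cases hα : W.α e.1 ∈ W.black
      · obtain ⟨b, rfl⟩ := hW.exists_foot_eq ((hW.isCilium_blueMap e).2 hα)
        obtain ⟨x, rfl⟩ := K.pair.surjective b
        rw [hfoot, hW.foot_val, hW'.foot_val, W.color_α, W'.color_α]
        ext i
        rw [K.label hM hW, K'.label hM hW']
      · rw [← WalshMap.blueMap_color_of_notMem hα, ← h.map_color,
          WalshMap.blueMap_color_of_notMem]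
        rwa [← hW'.isCilium_blueMap, hcil, hW.isCilium_blueMap]
  · change H d ∈ _ ↔ _
    obtain ⟨x, hx, hx'⟩ | ⟨x, hc, hx, hx'⟩ | ⟨e, rfl, he⟩ := hH d
    · rw [hx']
      exact iff_of_true (K'.pair x).2.1 (hx ▸ (K.pair x).2.1)
    · exact iff_of_true (hW'.cilium_black _ (hcil' hc hx hx')) (hW.cilium_black _ hc)
    · rw [he]
      exact iff_of_false (h.toFun e).2 e.2

include K K' hM hW hW' hsymm in
/-- Two maps which represent the same graph are isomorphic. -/
theorem nonempty_iso_of_same_graph : Nonempty (W.Iso W') := by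
  have := W.finite_dart
  have := W'.finite_dart
  obtain ⟨h, hb⟩ := K.exists_hom K' hM hW hW' hsymm
  obtain ⟨h', -⟩ := K'.exists_hom K hM hW' hW hsymm
  -- Morphisms to connected maps are surjective, and surjections both ways between finite sets are
  -- bijections.
  have hs := h.surjective hW.connected.1 hW'.connected.2
  have hs' := h'.surjective hW'.connected.1 hW.connected.2
  have hbij := hs.bijective_of_nat_card_le (Nat.card_le_card_of_surjective _ hs')
  exact ⟨⟨Equiv.ofBijective _ hbij, h.map_σ, h.map_α, h.map_color, hb⟩⟩

end CoreCorrespondence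

/-! ### Closing the chains of a partial permutation -/

namespace PEquiv

variable {S : Type} (s : S ≃. S)

/-- `b` is reached from `a` by iteration of `s`. -/
def Reaches : S → S → Prop := Relation.ReflTransGen fun a b => s a = some b

variable {s}

theorem Reaches.eq_of_symm_eq_none {w v : S} (h : s.Reaches w v) (hv : s.symm v = none) :
    w = v := by
  rcases Relation.ReflTransGen.cases_tail h with rfl | ⟨b, -, hb⟩
  · rfl
  · rw [s.eq_some_iff.2 hb] at hv
    simp at hv

theorem Reaches.eq_of_eq_none {w v : S} (h : s.Reaches w v) (hw : s w = none) : w = v := by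
  rcases Relation.ReflTransGen.cases_head h with rfl | ⟨b, hb, -⟩
  · rfl
  · rw [hw] at hb
    simp at hb

theorem Reaches.right_unique {w v v' : S} (h : s.Reaches w v) (h' : s.Reaches w v')
    (hv : s v = none) (hv' : s v' = none) : v = v' := by
  have hu : Relator.RightUnique (fun a b => s a = some b) :=
    fun a b c hb hc => Option.some.inj (Eq.trans (Eq.symm hb) hc)
  rcases Relation.ReflTransGen.total_of_right_unique hu h h' with h | h
  · exact Reaches.eq_of_eq_none h hv
  · exact (Reaches.eq_of_eq_none h hv').symm

theorem Reaches.left_unique {w w' v : S} (h : s.Reaches w v) (h' : s.Reaches w' v)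
    (hw : s.symm w = none) (hw' : s.symm w' = none) : w = w' := by
  induction h with
  | refl => exact (h'.eq_of_symm_eq_none hw).symm
  | tail _ hb ih =>
    rcases Relation.ReflTransGen.cases_tail h' with rfl | ⟨b', h'', hb'⟩
    · rw [s.eq_some_iff.2 hb] at hw'
      simp at hw'
    · exact ih (s.inj hb hb' ▸ h'')

/-- If no start were reached backwards, taking predecessors would be an injective self-map of the
finite set of elements reaching `x`. By surjectivity `x` would itself be a predecessor, although it
has no successor. -/
theorem exists_reaches [Finite S] {x : S} (hx : s x = none) :
    ∃ w, s.symm w = none ∧ s.Reaches w x := by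
  by_contra! hno
  have hpred : ∀ t : {t // s.Reaches t x}, ∃ t' : {t // s.Reaches t x}, s t'.1 = some t.1 := by
    rintro ⟨t, ht⟩
    rcases h : s.symm t with _ | t'
    · exact absurd ht (hno t h)
    · have h' := s.eq_some_iff.1 h
      exact ⟨⟨t', .head h' ht⟩, h'⟩
  choose f hf using hpred
  have hinj : Function.Injective f := fun a b h => by
    have h1 := hf a
    rw [h, hf b] at h1
    exact Subtype.ext (Option.some.inj h1).symm
  obtain ⟨t, ht⟩ := Finite.injective_iff_surjective.1 hinj ⟨x, .refl⟩
  have := hf t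
  rw [ht, hx] at this
  simp at this

/-- The chains of a partial permutation can be closed to cycles by adding one element to each. -/
theorem exists_closure [Finite S] (s : S ≃. S) :
    ∃ ρ : Equiv.Perm (S ⊕ {w // s.symm w = none}),
      (∀ x y, ρ (Sum.inl x) = Sum.inl y ↔ s x = some y) ∧
      (∀ w, ρ (Sum.inr w) = Sum.inl w.1) ∧
      ∀ w w', ρ.SameCycle (Sum.inr w) (Sum.inr w') → w = w' := by
  -- The end of a chain is sent to the added element named after the start of this chain; everything
  -- else keeps its successor.
  have hex : ∀ x, ∃ t : S ⊕ {w // s.symm w = none}, (∀ y, t = Sum.inl y ↔ s x = some y) ∧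
      ∀ w, t = Sum.inr w → s x = none ∧ s.Reaches w.1 x := by
    intro x
    rcases h : s x with _ | y
    · obtain ⟨w, hw, hr⟩ := exists_reaches h
      exact ⟨Sum.inr ⟨w, hw⟩, by simp, by rintro _ ⟨⟩; exact ⟨rfl, hr⟩⟩
    · exact ⟨Sum.inl y, by simp, by simp⟩
  choose f hf hf' using hex
  have hinj : Function.Injective (Sum.elim f fun w : {w // s.symm w = none} => Sum.inl w.1) := by
    rintro (x | w) (y | v) h
    · simp only [Sum.elim_inl] at h
      rcases hx : f x with z | z
      · rw [s.inj ((hf x z).1 hx) ((hf y z).1 (h ▸ hx))]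
      · rw [(hf' x z hx).2.right_unique (hf' y z (h ▸ hx)).2 (hf' x z hx).1 (hf' y z (h ▸ hx)).1]
    · have := s.eq_some_iff.2 ((hf x v.1).1 h)
      rw [v.2] at this
      simp at this
    · have := s.eq_some_iff.2 ((hf y w.1).1 h.symm)
      rw [w.2] at this
      simp at this
    · exact congrArg Sum.inr (Subtype.ext (Sum.inl_injective h))
  refine ⟨Equiv.ofBijective _ (Finite.injective_iff_bijective.1 hinj), hf, fun w => rfl, ?_⟩
  intro w w' h
  have := Fintype.ofFinite (S ⊕ {w // s.symm w = none})
  have := Classical.decEq (S ⊕ {w // s.symm w = none})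
  obtain ⟨n, -, hn⟩ := h.exists_pow_eq'
  set ρ := Equiv.ofBijective _ (Finite.injective_iff_bijective.1 hinj)
  -- From an added element one runs through its own chain and returns, so no other added element is
  -- on the cycle.
  have key : ∀ n : ℕ, (ρ ^ n) (Sum.inr w) = Sum.inr w ∨
      ∃ v, (ρ ^ n) (Sum.inr w) = Sum.inl v ∧ s.Reaches w.1 v := by
    intro n
    induction n with
    | zero => exact .inl rfl
    | succ n ih =>
      rw [pow_succ', Equiv.Perm.mul_apply]
      rcases ih with h | ⟨v, h, hv⟩
      · rw [h]
        exact .inr ⟨w.1, rfl, .refl⟩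
      · rw [h]
        change f v = _ ∨ ∃ v', f v = _ ∧ _
        rcases hv' : f v with z | z
        · exact .inr ⟨z, rfl, hv.tail ((hf v z).1 hv')⟩
        · exact .inl (congrArg _ (Subtype.ext ((hf' v z hv').2.left_unique hv z.2 w.2)))
  rcases key n with h | ⟨v, h, -⟩
  · exact Sum.inr_injective (h.symm.trans hn)
  · rw [hn] at h
    simp at h

end PEquiv

/-! ### The stuffed Walsh map of a graph -/

section StuffedMap

variable {D : ℕ} {B : Bubble D} {Ω : B.Pairing} {M : CMap D} {cil : B.white → M.dart}
  (hM : M.RepresentsBubble B Ω cil) {Q X F : Type}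
  (e : X ≃ Q × B.white) (ρ : Equiv.Perm (X ⊕ F))

open Classical in
/-- The involution on the darts of `stuffedMap`. -/
noncomputable def stuffedInvolution {B : Bubble D} (cil : B.white → M.dart) (e : X ≃ Q × B.white) :
    (X ⊕ F) ⊕ (Q × M.dart) → (X ⊕ F) ⊕ (Q × M.dart)
  | Sum.inl (Sum.inl x) => Sum.inr ((e x).1, cil (e x).2)
  | Sum.inl (Sum.inr w) => Sum.inl (Sum.inr w)
  | Sum.inr c => if h : ∃ x, cil x = c.2 then Sum.inl (Sum.inl (e.symm (c.1, h.choose))) else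
      Sum.inr (c.1, M.α c.2)

open Classical in
/-- The colors of the darts of `stuffedMap`. -/
noncomputable def stuffedColor (Ω : B.Pairing) (cil : B.white → M.dart) (e : X ≃ Q × B.white) :
    (X ⊕ F) ⊕ (Q × M.dart) → Finset (Fin D)
  | Sum.inl (Sum.inl x) => {i | B.tau Ω i (e x).2 ≠ (e x).2}
  | Sum.inl (Sum.inr _) => Finset.univ
  | Sum.inr c => if h : ∃ x, cil x = c.2 then
      ({i | B.tau Ω i h.choose ≠ h.choose} : Finset (Fin D)) else M.color c.2

include hM

theorem stuffedInvolution_cil (q : Q) (x : B.white) :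
    stuffedInvolution (F := F) cil e (Sum.inr (q, cil x)) = Sum.inl (Sum.inl (e.symm (q, x))) := by
  have h : ∃ y, cil y = cil x := ⟨x, rfl⟩
  refine (dif_pos h).trans ?_
  rw [hM.cil_injective h.choose_spec]

theorem stuffedInvolution_of_not {m : M.dart} (q : Q) (h : ¬ M.IsCilium m) :
    stuffedInvolution (F := F) cil e (Sum.inr (q, m)) = Sum.inr (q, M.α m) :=
  dif_neg (by rwa [hM.isCilium_iff] at h)

theorem mem_stuffedColor_cil {i : Fin D} (q : Q) (x : B.white) :
    i ∈ stuffedColor (F := F) Ω cil e (Sum.inr (q, cil x)) ↔ B.tau Ω i x ≠ x := by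
  have h : ∃ y, cil y = cil x := ⟨x, rfl⟩
  unfold stuffedColor
  dsimp only
  rw [dif_pos h, hM.cil_injective h.choose_spec]
  simp

theorem stuffedColor_of_not {m : M.dart} (q : Q) (h : ¬ M.IsCilium m) :
    stuffedColor (F := F) Ω cil e (Sum.inr (q, m)) = M.color m :=
  dif_neg (by rwa [hM.isCilium_iff] at h)

/-- The map with blue submaps `M` indexed by `Q` and with the permutation `ρ` of the half-edges at
the black vertices (the elements of `X`, which lead to the cilia of the blue submaps) and of the
cilia (the elements of `F`). -/
noncomputable def stuffedMap [Finite Q] [Finite X] [Finite F] : WalshMap D where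
  dart := (X ⊕ F) ⊕ (Q × M.dart)
  finite_dart := have := M.finite_dart; inferInstance
  σ := Equiv.sumCongr ρ (Equiv.prodCongr (Equiv.refl _) M.σ)
  α := stuffedInvolution cil e
  α_invol := by
    rintro ((x | w) | ⟨q, m⟩)
    · refine (stuffedInvolution_cil hM e _ _).trans ?_
      simp
    · rfl
    · by_cases h : M.IsCilium m
      · obtain ⟨x, rfl⟩ := (hM.isCilium_iff m).1 h
        rw [stuffedInvolution_cil hM]
        simp [stuffedInvolution]
      · rw [stuffedInvolution_of_not hM _ _ h, stuffedInvolution_of_not hM _ _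
          (by rwa [CMap.isCilium_α]), M.α_invol]
  color := stuffedColor Ω cil e
  color_α := by
    have key : ∀ q x, stuffedColor (F := F) Ω cil e (Sum.inr (q, cil x)) =
        stuffedColor (F := F) Ω cil e (Sum.inl (Sum.inl (e.symm (q, x)))) := by
      intro q x
      ext i
      rw [mem_stuffedColor_cil hM]
      simp [stuffedColor]
    rintro ((x | w) | ⟨q, m⟩)
    · refine (key _ _).trans ?_
      simp
    · rfl
    · by_cases h : M.IsCilium m
      · obtain ⟨x, rfl⟩ := (hM.isCilium_iff m).1 h
        rw [stuffedInvolution_cil hM, key]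
      · rw [stuffedInvolution_of_not hM _ _ h, stuffedColor_of_not hM _ _ h,
          stuffedColor_of_not hM _ _ (by rwa [CMap.isCilium_α]), M.color_α]
  black := Set.range Sum.inl
  black_σ := by rintro (d | d) <;> simp

end StuffedMap

namespace stuffedMap

variable {D : ℕ} {B : Bubble D} {Ω : B.Pairing} {M : CMap D} {cil : B.white → M.dart}
  (hM : M.RepresentsBubble B Ω cil) {Q X F : Type} [Finite Q] [Finite X] [Finite F]
  (e : X ≃ Q × B.white) (ρ : Equiv.Perm (X ⊕ F))

/-- The half-edge of a pair at a black vertex. -/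
def blackDart (x : X) : (stuffedMap hM e ρ).dart := Sum.inl (Sum.inl x)

/-- A cilium. -/
def ciliumDart (w : F) : (stuffedMap hM e ρ).dart := Sum.inl (Sum.inr w)

/-- A dart of a blue submap. -/
def blueDart (q : Q) (m : M.dart) : (stuffedMap hM e ρ).dart := Sum.inr (q, m)

theorem dart_cases (d : (stuffedMap hM e ρ).dart) : (∃ x, d = blackDart hM e ρ x) ∨
    (∃ w, d = ciliumDart hM e ρ w) ∨ ∃ q m, d = blueDart hM e ρ q m := by
  rcases d with (x | w) | ⟨q, m⟩
  exacts [.inl ⟨x, rfl⟩, .inr (.inl ⟨w, rfl⟩), .inr (.inr ⟨q, m, rfl⟩)]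

theorem blackDart_injective : Function.Injective (blackDart hM e ρ) :=
  Sum.inl_injective.comp Sum.inl_injective

theorem blackDart_mem (x : X) : blackDart hM e ρ x ∈ (stuffedMap hM e ρ).black := ⟨_, rfl⟩

theorem ciliumDart_mem (w : F) : ciliumDart hM e ρ w ∈ (stuffedMap hM e ρ).black := ⟨_, rfl⟩

theorem blueDart_notMem (q : Q) (m : M.dart) :
    blueDart hM e ρ q m ∉ (stuffedMap hM e ρ).black := by
  rintro ⟨_, h⟩
  exact Sum.inl_ne_inr h

theorem α_blackDart (x : X) : (stuffedMap hM e ρ).α (blackDart hM e ρ x) =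
    blueDart hM e ρ (e x).1 (cil (e x).2) := rfl

theorem α_blueDart_cil (q : Q) (x : B.white) : (stuffedMap hM e ρ).α (blueDart hM e ρ q (cil x)) =
    blackDart hM e ρ (e.symm (q, x)) :=
  stuffedInvolution_cil hM e q x

theorem α_blueDart_of_not (q : Q) {m : M.dart} (h : ¬ M.IsCilium m) :
    (stuffedMap hM e ρ).α (blueDart hM e ρ q m) = blueDart hM e ρ q (M.α m) :=
  stuffedInvolution_of_not hM e q h

theorem α_blueDart_mem_iff (q : Q) {m : M.dart} :
    (stuffedMap hM e ρ).α (blueDart hM e ρ q m) ∈ (stuffedMap hM e ρ).black ↔ M.IsCilium m := by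
  by_cases h : M.IsCilium m
  · refine iff_of_true ?_ h
    obtain ⟨x, rfl⟩ := (hM.isCilium_iff m).1 h
    rw [α_blueDart_cil]
    exact blackDart_mem hM e ρ _
  · refine iff_of_false ?_ h
    rw [α_blueDart_of_not hM e ρ q h]
    exact blueDart_notMem hM e ρ _ _

theorem σ_blueDart (q : Q) (m : M.dart) :
    (stuffedMap hM e ρ).σ (blueDart hM e ρ q m) = blueDart hM e ρ q (M.σ m) := rfl

theorem mem_color_blueDart_cil {i : Fin D} (q : Q) (x : B.white) :
    i ∈ (stuffedMap hM e ρ).color (blueDart hM e ρ q (cil x)) ↔ B.tau Ω i x ≠ x :=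
  mem_stuffedColor_cil (F := F) hM e q x

theorem color_blueDart_of_not (q : Q) {m : M.dart} (h : ¬ M.IsCilium m) :
    (stuffedMap hM e ρ).color (blueDart hM e ρ q m) = M.color m :=
  stuffedColor_of_not (F := F) hM e q h

theorem isCilium_iff {d : (stuffedMap hM e ρ).dart} :
    (stuffedMap hM e ρ).IsCilium d ↔ ∃ w, d = ciliumDart hM e ρ w := by
  constructor
  · intro h
    rcases dart_cases hM e ρ d with ⟨x, rfl⟩ | hw | ⟨q, m, rfl⟩
    · exact absurd (h : _ = _).symm Sum.inl_ne_inr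
    · exact hw
    · by_cases hm : M.IsCilium m
      · have := (α_blueDart_mem_iff hM e ρ q).2 hm
        rw [show _ = _ from h] at this
        exact absurd this (blueDart_notMem hM e ρ q m)
      · have h' : _ = blueDart hM e ρ q m := h
        rw [α_blueDart_of_not hM e ρ q hm] at h'
        exact absurd (congrArg Prod.snd (Sum.inr_injective h')) hm
  · rintro ⟨w, rfl⟩
    rfl

/-- The inclusion of a copy of `M`. -/
noncomputable def copyHom (q : Q) : CMap.Hom M (stuffedMap hM e ρ).blueMap where
  toFun m := ⟨blueDart hM e ρ q m, blueDart_notMem hM e ρ q m⟩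
  map_σ m := rfl
  map_α m := by
    apply Subtype.ext
    by_cases h : M.IsCilium m
    · refine Eq.trans ?_ (congrArg Subtype.val
        (WalshMap.blueMap_α_of_mem ((α_blueDart_mem_iff hM e ρ q).2 h))).symm
      rw [show M.α m = m from h]
    · refine Eq.trans ?_ (WalshMap.blueMap_α_of_notMem
        (mt (α_blueDart_mem_iff hM e ρ q).1 h)).symm
      exact (α_blueDart_of_not hM e ρ q h).symm
  map_color m := by
    by_cases h : M.IsCilium m
    · refine (WalshMap.blueMap_color_of_mem ((α_blueDart_mem_iff hM e ρ q).2 h)).trans ?_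
      obtain ⟨x, rfl⟩ := (hM.isCilium_iff m).1 h
      rw [hM.color_cil]
    · refine (WalshMap.blueMap_color_of_notMem
        (mt (α_blueDart_mem_iff hM e ρ q).1 h)).trans ?_
      exact color_blueDart_of_not hM e ρ q h

theorem copyHom_val (q : Q) (m : M.dart) :
    ((copyHom hM e ρ q).toFun m).1 = blueDart hM e ρ q m := rfl

theorem copyHom_injective (q : Q) : Function.Injective (copyHom hM e ρ q).toFun := fun _ _ h =>
  congrArg Prod.snd (Sum.inr_injective (congrArg Subtype.val h))

theorem exists_copyHom_eq (d : (stuffedMap hM e ρ).blueMap.dart) :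
    ∃ q m, (copyHom hM e ρ q).toFun m = d := by
  obtain ⟨d, hd⟩ := d
  rcases dart_cases hM e ρ d with ⟨x, rfl⟩ | ⟨w, rfl⟩ | ⟨q, m, rfl⟩
  · exact absurd (blackDart_mem hM e ρ x) hd
  · exact absurd (ciliumDart_mem hM e ρ w) hd
  · exact ⟨q, m, rfl⟩

theorem comp_blueDart_eq (q : Q) (m m' : M.dart) :
    (stuffedMap hM e ρ).comp (blueDart hM e ρ q m) =
      (stuffedMap hM e ρ).comp (blueDart hM e ρ q m') := by
  refine CMap.eq_of_comp_eq (fun m => (stuffedMap hM e ρ).comp (blueDart hM e ρ q m))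
    (fun m => ?_) (fun m => ?_) (hM.connected m m')
  · rw [← σ_blueDart, CMap.comp_σ]
  · by_cases h : M.IsCilium m
    · rw [show M.α m = m from h]
    · rw [← α_blueDart_of_not hM e ρ q h, CMap.comp_α]

/-- The conditions on `ρ` say that no cilium is followed by a cilium or by itself, and that no black
vertex has two. Connectedness need only be tested on the half-edges at black vertices. -/
theorem isStuffed {p : ℕ} (hσ : ∀ w, ∃ x, ρ (Sum.inr w) = Sum.inl x)
    (hcyc : ∀ w w', ρ.SameCycle (Sum.inr w) (Sum.inr w') → w = w') (hF : Nat.card F = p)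
    (hX : Nonempty X)
    (hconn : ∀ x x', (stuffedMap hM e ρ).comp (blackDart hM e ρ x) =
      (stuffedMap hM e ρ).comp (blackDart hM e ρ x')) :
    (stuffedMap hM e ρ).IsStuffed M p where
  connected := by
    obtain ⟨x₀⟩ := hX
    have key : ∀ d, ∃ x, (stuffedMap hM e ρ).comp d =
        (stuffedMap hM e ρ).comp (blackDart hM e ρ x) := by
      intro d
      rcases dart_cases hM e ρ d with ⟨x, rfl⟩ | ⟨w, rfl⟩ | ⟨q, m, rfl⟩
      · exact ⟨x, rfl⟩
      · obtain ⟨x, hx⟩ := hσ w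
        refine ⟨x, ?_⟩
        rw [← CMap.comp_σ]
        exact congrArg _ (congrArg Sum.inl hx)
      · obtain ⟨y⟩ := B.nonempty_white Ω
        refine ⟨e.symm (q, y), ?_⟩
        rw [comp_blueDart_eq hM e ρ q m (cil y), ← CMap.comp_α, α_blueDart_cil]
    refine ⟨⟨blackDart hM e ρ x₀⟩, fun d d' => ?_⟩
    obtain ⟨x, hx⟩ := key d
    obtain ⟨x', hx'⟩ := key d'
    rw [hx, hx', hconn x x']
  bipartite d hd hc := by
    rcases dart_cases hM e ρ d with ⟨x, rfl⟩ | hw | ⟨q, m, rfl⟩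
    · rw [α_blackDart]
      exact blueDart_notMem hM e ρ _ _
    · exact absurd ((isCilium_iff hM e ρ).2 hw) hc
    · exact absurd hd (blueDart_notMem hM e ρ q m)
  submaps C := by
    obtain ⟨d, rfl⟩ : ∃ d, (stuffedMap hM e ρ).blueMap.comp d = C := Quotient.exists_rep C
    obtain ⟨q, m, rfl⟩ := exists_copyHom_eq hM e ρ d
    exact ⟨(copyHom hM e ρ q).toCompIso (copyHom_injective hM e ρ q) hM.connected _ m rfl⟩
  label d hd hα i := by
    obtain ⟨d, rfl⟩ : ∃ d' : (stuffedMap hM e ρ).blueMap.dart, d'.1 = d := ⟨⟨d, hd⟩, rfl⟩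
    obtain ⟨q, m, rfl⟩ := exists_copyHom_eq hM e ρ d
    rw [copyHom_val, α_blueDart_mem_iff, hM.isCilium_iff] at hα
    obtain ⟨x, rfl⟩ := hα
    rw [copyHom_val, mem_color_blueDart_cil, ← hM.label, ← copyHom_val]
    constructor
    · rintro ⟨m, hs, hm, hi⟩
      refine ⟨_, WalshMap.blueMap_sameCycle.1 ((copyHom hM e ρ q).sameCycle hs), ?_, ?_⟩
      · rwa [copyHom_val, α_blueDart_mem_iff]
      · rwa [copyHom_val, color_blueDart_of_not hM e ρ q hm]
    · rintro ⟨d, hs, hα, hi⟩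
      have hd := (WalshMap.black_iff_of_sameCycle hs).not.1 hd
      obtain ⟨d, rfl⟩ : ∃ d' : (stuffedMap hM e ρ).blueMap.dart, d'.1 = d := ⟨⟨d, hd⟩, rfl⟩
      obtain ⟨m, rfl, hs'⟩ := (copyHom hM e ρ q).exists_of_sameCycle
        (WalshMap.blueMap_sameCycle.2 hs)
      rw [copyHom_val, α_blueDart_mem_iff] at hα
      rw [copyHom_val, color_blueDart_of_not hM e ρ q hα] at hi
      exact ⟨m, hs', hα, hi⟩
  cilium_black d hd := by
    obtain ⟨w, rfl⟩ := (isCilium_iff hM e ρ).1 hd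
    exact ciliumDart_mem hM e ρ w
  cilium_unique d d' hd hd' hs := by
    obtain ⟨w, rfl⟩ := (isCilium_iff hM e ρ).1 hd
    obtain ⟨w', rfl⟩ := (isCilium_iff hM e ρ).1 hd'
    have := hcyc w w' (by
      obtain ⟨n, hn⟩ := CMap.iterate_of_sameCycle (M := (stuffedMap hM e ρ).toCMap) hs
      refine ⟨n, ?_⟩
      have key : ∀ n : ℕ, ((stuffedMap hM e ρ).σ ^ n) (ciliumDart hM e ρ w) =
          (Sum.inl ((ρ ^ n) (Sum.inr w)) : (X ⊕ F) ⊕ (Q × M.dart)) := by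
        intro n
        induction n with
        | zero => rfl
        | succ n ih =>
          rw [pow_succ', pow_succ', Equiv.Perm.mul_apply, Equiv.Perm.mul_apply, ih]
          rfl
      rw [key] at hn
      exact Sum.inl_injective hn)
    rw [this]
  cilium_ne d hd h := by
    obtain ⟨w, rfl⟩ := (isCilium_iff hM e ρ).1 hd
    obtain ⟨x, hx⟩ := hσ w
    have h' : ρ (Sum.inr w) = Sum.inr w := Sum.inl_injective h
    rw [hx] at h'
    exact Sum.inl_ne_inr h'
  cilium_color d hd := by
    obtain ⟨w, rfl⟩ := (isCilium_iff hM e ρ).1 hd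
    rfl
  card_cilia := by
    rw [← hF]
    refine (Nat.card_congr (Equiv.ofBijective
      (fun w => ⟨ciliumDart hM e ρ w, (isCilium_iff hM e ρ).2 ⟨w, rfl⟩⟩) ⟨?_, ?_⟩)).symm
    · intro w w' h
      exact Sum.inr_injective (Sum.inl_injective (congrArg Subtype.val h))
    · rintro ⟨d, hd⟩
      obtain ⟨w, rfl⟩ := (isCilium_iff hM e ρ).1 hd
      exact ⟨w, rfl⟩

/-- Pairs are the half-edges at black vertices. -/
noncomputable def pairEquiv : X ≃ (stuffedMap hM e ρ).BlackHalfEdge :=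
  Equiv.ofBijective (fun x => ⟨blackDart hM e ρ x, blackDart_mem hM e ρ x, fun h => by
      obtain ⟨w, hw⟩ := (isCilium_iff hM e ρ).1 h
      exact Sum.inl_ne_inr (Sum.inl_injective hw)⟩) <| by
    constructor
    · intro x y h
      exact blackDart_injective hM e ρ
        (congrArg (fun b : (stuffedMap hM e ρ).BlackHalfEdge => b.1) h)
    · rintro ⟨d, hd, hc⟩
      rcases dart_cases hM e ρ d with ⟨x, rfl⟩ | hw | ⟨q, m, rfl⟩
      · exact ⟨x, rfl⟩
      · exact absurd ((isCilium_iff hM e ρ).2 hw) hc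
      · exact absurd hd (blueDart_notMem hM e ρ q m)

theorem nextCilium_iff {i : Fin D} {x y : X} {d d' : (stuffedMap hM e ρ).blueMap.dart}
    (hd : d.1 = (stuffedMap hM e ρ).α (blackDart hM e ρ x))
    (hd' : d'.1 = (stuffedMap hM e ρ).α (blackDart hM e ρ y)) :
    (stuffedMap hM e ρ).blueMap.NextCilium i d d' ↔ e y = ((e x).1, B.tau Ω i (e x).2) := by
  obtain rfl : (copyHom hM e ρ (e x).1).toFun (cil (e x).2) = d := Subtype.ext hd.symm
  obtain rfl : (copyHom hM e ρ (e y).1).toFun (cil (e y).2) = d' := Subtype.ext hd'.symm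
  have h := (copyHom hM e ρ (e x).1).nextCilium (copyHom_injective hM e ρ _)
    (hM.next i (e x).2)
  constructor
  · intro h'
    have h1 := Sum.inr_injective (congrArg Subtype.val (h'.unique h))
    have h2 := congrArg Prod.fst h1
    have h3 := hM.cil_injective (congrArg Prod.snd h1)
    exact Prod.ext h2 h3
  · intro h'
    rw [h']
    exact h

end stuffedMap

/-- Every graph built from `B` and `Ω` is represented by a stuffed Walsh map. -/
theorem PairedGraph.IsBuiltFrom.exists_stuffed {D : ℕ} {B : Bubble D} {Ω : B.Pairing} {M : CMap D}
    {cil : B.white → M.dart} {p : ℕ} {G : PairedGraph D} (hG : G.IsBuiltFrom B Ω p)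
    (hM : M.RepresentsBubble B Ω cil) :
    ∃ W : WalshMap D, W.IsStuffed M p ∧ Nonempty (CoreCorrespondence G W) := by
  have := G.finite_white
  have : Finite G.Comp := by
    have := G.finite_black
    exact Quotient.finite _
  let f : ∀ C, G.CompIso B Ω C := fun C => (hG.comp_iso C).some
  -- A pair of `G` is named by its bubble and by its position in `B`, through one chosen isomorphism
  -- for each bubble.
  let e : G.white ≃ G.Comp × B.white :=
    (Equiv.sigmaFiberEquiv fun x => G.comp (Sum.inl x)).symm.trans
      ((Equiv.sigmaCongrRight fun C => (f C).white.symm).trans (Equiv.sigmaEquivProd _ _))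
  have he : ∀ i x y, e y = ((e x).1, B.tau Ω i (e x).2) ↔ G.edge i x = G.pairing y := by
    intro i x y
    obtain ⟨⟨C, x₀⟩, rfl⟩ := e.symm.surjective x
    rw [Equiv.apply_symm_apply, ← Equiv.eq_symm_apply]
    change y = ((f C).white (B.tau Ω i x₀)).1 ↔ G.edge i ((f C).white x₀).1 = _
    rw [← (f C).map_edge, ← B.pairing_tau Ω, (f C).map_pairing, G.pairing.apply_eq_iff_eq, eq_comm]
  -- The pair of the black end of an edge of color `0` is sent to the pair of its white end, which
  -- is the clockwise order at the black vertices.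
  let s : G.white ≃. G.white := G.pairing.toPEquiv.trans G.edge0.symm
  have hs : ∀ x y, s x = some y ↔ G.edge0 y = some (G.pairing x) := fun x y =>
    G.edge0.eq_some_iff
  obtain ⟨ρ, hρ, hρ', hcyc⟩ := s.exists_closure
  refine ⟨stuffedMap hM e ρ, stuffedMap.isStuffed hM e ρ (fun w => ⟨_, hρ' w⟩) hcyc ?_ ?_ ?_, ⟨?_⟩⟩
  -- A pair has no predecessor exactly if its white vertex is free, so there is one cilium for each
  -- free white vertex.
  · rw [← hG.graph.free_white]
    refine Nat.card_congr (Equiv.subtypeEquivRight fun x => ?_)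
    change _ ↔ G.edge0 x = none
    rw [Option.eq_none_iff_forall_ne_some, Option.eq_none_iff_forall_ne_some,
      ← G.pairing.forall_congr_right]
    refine forall_congr' fun y => not_congr ?_
    rw [s.eq_some_iff, hs]
  · obtain ⟨x | y⟩ := hG.graph.connected.1
    exacts [⟨x⟩, ⟨G.pairing.symm y⟩]
  · intro x x'
    refine hG.graph.connected.eq_of_invariant (Sum.elim
      (fun x => (stuffedMap hM e ρ).comp (stuffedMap.blackDart hM e ρ x))
      (fun y => (stuffedMap hM e ρ).comp (stuffedMap.blackDart hM e ρ (G.pairing.symm y))))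
      (fun i x => ?_) (fun x y h => ?_) (Sum.inl x) (Sum.inl x')
    · have h := (he i x (G.pairing.symm (G.edge i x))).2 (by simp)
      simp only [Sum.elim_inl, Sum.elim_inr]
      rw [← CMap.comp_α, stuffedMap.α_blackDart, h,
        ← CMap.comp_α (stuffedMap.blackDart hM e ρ x), stuffedMap.α_blackDart]
      exact stuffedMap.comp_blueDart_eq hM e ρ _ _ _
    · obtain ⟨z, rfl⟩ := G.pairing.surjective y
      simp only [Sum.elim_inl, Sum.elim_inr, Equiv.symm_apply_apply]
      rw [← CMap.comp_σ]
      exact congrArg _ (congrArg Sum.inl ((hρ z x).2 ((hs z x).2 h)))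
  · refine ⟨stuffedMap.pairEquiv hM e ρ, fun x y => ?_, fun i x y d d' hd hd' => ?_⟩
    · rw [← hs, ← hρ]
      exact Sum.inl_injective.eq_iff
    · rw [← he]
      exact stuffedMap.nextCilium_iff hM e ρ hd hd'

/-- The stuffed Walsh maps with submaps `M` represent the graphs built from `B` and `Ω`. -/
theorem CMap.RepresentsBubble.exists_representation {D : ℕ} {B : Bubble D} {Ω : B.Pairing}
    {M : CMap D} {cil : B.white → M.dart} (hM : M.RepresentsBubble B Ω cil) (p : ℕ) :
    ∃ Ψ : WalshClass M p → PairedGraphClass B Ω p,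
      Function.Surjective Ψ ∧ (M.IsSymmetric B Ω cil → Function.Bijective Ψ) ∧
      ∀ (G : {G : PairedGraph D // G.IsBuiltFrom B Ω p})
        (W : {W : WalshMap D // W.IsStuffed M p}),
        Ψ (Quotient.mk _ W) = Quotient.mk _ G ↔
          Nonempty (Correspondence B Ω M cil G.1 W.1) := by
  have hex : ∀ W : {W : WalshMap D // W.IsStuffed M p},
      ∃ G : {G : PairedGraph D // G.IsBuiltFrom B Ω p}, Nonempty (CoreCorrespondence G.1 W.1) := by
    rintro ⟨W, hW⟩
    obtain ⟨G, ⟨K⟩⟩ := hW.exists_core hM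
    exact ⟨⟨G, K.isBuiltFrom hM hW⟩, ⟨K⟩⟩
  choose g hg using hex
  -- Only the uniqueness of the graph of a given map is used here. Symmetry of `M` enters later, for
  -- injectivity.
  have hwd : ∀ W W' : {W : WalshMap D // W.IsStuffed M p}, (walshSetoid M p).r W W' →
      (Quotient.mk _ (g W) : PairedGraphClass B Ω p) = Quotient.mk _ (g W') := by
    rintro W W' ⟨φ⟩
    obtain ⟨K⟩ := hg W
    obtain ⟨K'⟩ := hg W'
    exact Quotient.sound ⟨(K.ofMapIso φ).isoOfSameMap W'.2 K'⟩
  have hiff : ∀ (G : {G : PairedGraph D // G.IsBuiltFrom B Ω p})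
      (W : {W : WalshMap D // W.IsStuffed M p}),
      (Quotient.mk _ (g W) : PairedGraphClass B Ω p) = Quotient.mk _ G ↔
        Nonempty (CoreCorrespondence G.1 W.1) := by
    intro G W
    obtain ⟨K⟩ := hg W
    constructor
    · intro h
      obtain ⟨φ⟩ := Quotient.exact h
      exact ⟨K.ofGraphIso φ⟩
    · rintro ⟨K'⟩
      exact Quotient.sound ⟨K.isoOfSameMap W.2 K'⟩
  have hsurj : Function.Surjective
      (Quotient.lift (s := walshSetoid M p) (fun W => Quotient.mk _ (g W)) hwd :
        WalshClass M p → PairedGraphClass B Ω p) := by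
    rintro ⟨G⟩
    obtain ⟨W, hW, hK⟩ := G.2.exists_stuffed hM
    exact ⟨Quotient.mk _ ⟨W, hW⟩, (hiff G ⟨W, hW⟩).2 hK⟩
  refine ⟨_, hsurj, fun hsymm => ⟨?_, hsurj⟩, fun G W => (hiff G W).trans
    ⟨fun ⟨K⟩ => ⟨K.toCorrespondence hM W.2⟩, fun ⟨Γ⟩ => ⟨Γ.toCore hM⟩⟩⟩
  rintro ⟨W⟩ ⟨W'⟩ h
  obtain ⟨K⟩ := (hiff (g W') W).1 h
  obtain ⟨K'⟩ := hg W'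
  exact Quotient.sound (K.nonempty_iso_of_same_graph K' hM W.2 W'.2 hsymm)

/-- From each corner at a vertex with edges of color `i`, the face of color `i` leads to a cilium. -/
def CMap.FacesMeetCilia {D : ℕ} (M : CMap D) : Prop :=
  ∀ (i : Fin D) (d : M.dart), (∃ d', M.σ.SameCycle d d' ∧ ¬ M.IsCilium d' ∧ i ∈ M.color d') →
    ∃ c, M.NextCilium i d c

/-! ### When all faces go along black vertices -/

namespace WalshMap.IsStuffed

variable {D : ℕ} {W : WalshMap D} {M : CMap D} {p : ℕ} (hW : W.IsStuffed M p) {i : Fin D}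
include hW

/-- By the labeling rule, an edge to a black vertex has no color that is not already on a blue edge
at the same vertex. -/
theorem exists_blue_of_mem_color {e e' : W.blueMap.dart} (hs : W.blueMap.σ.SameCycle e e')
    (hi : i ∈ W.color e'.1) : ∃ d : W.blueMap.dart, W.blueMap.σ.SameCycle e d ∧
      W.α d.1 ∉ W.black ∧ i ∈ W.color d.1 := by
  by_cases h : W.α e'.1 ∈ W.black
  · obtain ⟨d, hd, hα, hi'⟩ := (hW.label e'.1 e'.2 h i).1 hi
    obtain ⟨d, rfl⟩ : ∃ d' : W.blueMap.dart, d'.1 = d :=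
      ⟨⟨d, (black_iff_of_sameCycle hd).not.1 e'.2⟩, rfl⟩
    exact ⟨d, hs.trans (blueMap_sameCycle.2 hd), hα, hi'⟩
  · exact ⟨e', hs, h, hi⟩

/-- A face of color `i` changes vertices only along edges of color `i`, so every vertex on its way
has this color. Hence the edge to the black vertex at its end carries it, and the face of `W` really
crosses there. -/
theorem mem_color_of_nextCilium {e c : W.blueMap.dart} (h : W.blueMap.NextCilium i e c) :
    (∃ e', W.blueMap.σ.SameCycle e e' ∧ i ∈ W.color e'.1) → i ∈ W.color c.1 := by
  induction h with
  | here e h =>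
    rintro ⟨e', hs, hi⟩
    obtain ⟨d, hd, hα, hi'⟩ := hW.exists_blue_of_mem_color hs hi
    have h2 := hW.isCilium_blueMap_faceStep.1 h
    rw [blueMap_faceStep_of_mem h2]
    refine (hW.label _ (W.blueMap.σ e).2 h2 i).2 ⟨d.1, ?_, hα, hi'⟩
    rw [← blueMap_sameCycle, Equiv.Perm.sameCycle_apply_left]
    exact hd
  | step e c h _ ih =>
    rintro ⟨e', hs, hi⟩
    apply ih
    rw [hW.isCilium_blueMap_faceStep] at h
    by_cases hσ : i ∈ W.color (W.σ e.1)
    · refine ⟨_, Equiv.Perm.SameCycle.refl _ _, ?_⟩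
      rw [blueMap_faceStep_of_notMem h, CMap.faceStep, if_pos hσ, W.color_α]
      exact hσ
    · refine ⟨e', ?_, hi⟩
      have h2 : W.blueMap.faceStep i e = W.blueMap.σ e := by
        apply Subtype.ext
        rw [blueMap_faceStep_of_notMem h, CMap.faceStep, if_neg hσ]
        rfl
      rwa [h2, Equiv.Perm.sameCycle_apply_left]

/-- At a blue vertex with color `i`, the face is led to a cilium of its submap and from there to a
black vertex. At a blue vertex without this color, the face just turns around the vertex. -/
theorem allFacesMeetBlack (hM : M.FacesMeetCilia) : W.AllFacesMeetBlack := by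
  intro i F
  obtain ⟨d, rfl⟩ : ∃ d, W.face i d = F := Quotient.exists_rep F
  by_cases hd : d ∈ W.black
  · exact .inl ⟨d, hd, rfl⟩
  obtain ⟨e, rfl⟩ : ∃ e : W.blueMap.dart, e.1 = d := ⟨⟨d, hd⟩, rfl⟩
  by_cases hcol : ∃ e', W.blueMap.σ.SameCycle e e' ∧ i ∈ W.color e'.1
  · left
    obtain ⟨e', hs, hi⟩ := hcol
    obtain ⟨d, hs', hα, hi'⟩ := hW.exists_blue_of_mem_color hs hi
    obtain ⟨C, hC⟩ : ∃ C, W.blueMap.comp e = C := ⟨_, rfl⟩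
    obtain ⟨g⟩ := hW.submaps C
    obtain ⟨m, rfl⟩ : ∃ m, g.toHom.toFun m = e :=
      ⟨g.toEquiv.symm ⟨e, hC⟩, by simp [CMap.CompIso.toHom]⟩
    obtain ⟨m', rfl, hm'⟩ := g.toHom.exists_of_sameCycle hs'
    obtain ⟨c, hc⟩ := hM i m ⟨m', hm', by
      rwa [← g.toHom.isCilium_iff g.injective, hW.isCilium_blueMap], by
      rwa [← g.toHom.map_color, blueMap_color_of_notMem hα]⟩
    have hc' := g.toHom.nextCilium g.injective hc
    refine ⟨W.α (g.toHom.toFun c).1, (hW.isCilium_blueMap _).1 hc'.isCilium, ?_⟩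
    exact (hW.face_eq_of_nextCilium hc' (hW.mem_color_of_nextCilium hc' ⟨e', hs, hi⟩)).symm
  · right
    have key := fun d => CMap.eq_of_face_eq (M := W.toCMap) (i := i) (d' := d)
      (fun d => d ∉ W.black ∧ ∀ d', W.σ.SameCycle d d' → i ∉ W.color d') (fun d _ => by
        by_cases hi : i ∈ W.color (W.σ d)
        · have h : W.faceStep i d = W.α (W.σ d) := if_pos hi
          rw [h]
          refine propext (iff_of_false ?_ ?_)
          · rintro ⟨-, h⟩
            exact h _ (.refl _ _) (by rwa [W.color_α])
          · rintro ⟨-, h⟩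
            exact h _ (Equiv.Perm.sameCycle_apply_right.2 (.refl _ _)) hi
        · have h : W.faceStep i d = W.σ d := if_neg hi
          rw [h, W.black_σ]
          simp only [Equiv.Perm.sameCycle_apply_left]) (d := e.1)
    intro d hd
    rw [← key d hd.symm]
    refine ⟨e.2, fun d' hs hi => hcol ?_⟩
    obtain ⟨e', rfl⟩ : ∃ e' : W.blueMap.dart, e'.1 = d' :=
      ⟨⟨d', (black_iff_of_sameCycle hs).not.1 e.2⟩, rfl⟩
    exact ⟨e', blueMap_sameCycle.2 hs, hi⟩

end WalshMap.IsStuffed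

/-! ### Turning around a vertex from one dart of a color to the next -/

namespace CMap

variable {D : ℕ} {M : CMap D} {i : Fin D}

/-- `e` is the first dart with the color `i` after `d` around its vertex. -/
inductive NextColored (M : CMap D) (i : Fin D) : M.dart → M.dart → Prop
  | here (d : M.dart) (h : i ∈ M.color (M.σ d)) : NextColored M i d (M.σ d)
  | step (d e : M.dart) (h : i ∉ M.color (M.σ d)) (he : NextColored M i (M.σ d) e) :
      NextColored M i d e

namespace NextColored

theorem mem_color {d e : M.dart} (h : M.NextColored i d e) : i ∈ M.color e := by
  induction h with
  | here d h => exact h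
  | step d e h _ ih => exact ih

theorem sameCycle {d e : M.dart} (h : M.NextColored i d e) : M.σ.SameCycle d e := by
  induction h with
  | here d h => exact Equiv.Perm.sameCycle_apply_right.2 (.refl _ _)
  | step d e h _ ih => exact Equiv.Perm.sameCycle_apply_left.1 ih

theorem unique {d e e' : M.dart} (h : M.NextColored i d e) (h' : M.NextColored i d e') :
    e = e' := by
  induction h with
  | here d h =>
    cases h' with
    | here => rfl
    | step _ _ h2 _ => exact absurd h h2
  | step d e h _ ih =>
    cases h' with
    | here _ h2 => exact absurd h2 h
    | step _ _ _ h2 => exact ih h2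

theorem exists_of_sameCycle {d f : M.dart} (h : M.σ.SameCycle d f) (hf : i ∈ M.color f) :
    ∃ e, M.NextColored i d e := by
  -- Counting starts at `σ d`, because the search is strictly after `d`: if `f = d`, one full turn
  -- is made.
  obtain ⟨n, rfl⟩ := iterate_of_sameCycle (Equiv.Perm.sameCycle_apply_left.2 h)
  clear h
  induction n generalizing d with
  | zero => exact ⟨_, .here d hf⟩
  | succ n ih =>
    by_cases hd : i ∈ M.color (M.σ d)
    · exact ⟨_, .here d hd⟩
    · obtain ⟨e, he⟩ := ih (d := M.σ d) (by rwa [pow_succ, Equiv.Perm.mul_apply] at hf)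
      exact ⟨e, .step d e hd he⟩

/-- A set of darts which is closed under going to the next dart of color `i` contains all the darts
of color `i` of the vertices which it meets. -/
theorem mem_of_closed {S : Set M.dart} (hS : ∀ d ∈ S, ∀ e, M.NextColored i d e → e ∈ S)
    {d f : M.dart} (hd : d ∈ S) (h : M.σ.SameCycle d f) (hf : i ∈ M.color f) : f ∈ S := by
  -- The induction passes through darts without the color `i`, which need not be in `S`; it
  -- therefore only assumes that their next colored dart is.
  have key : ∀ n : ℕ, ∀ d : M.dart, (∀ e, M.NextColored i d e → e ∈ S) →
      i ∈ M.color ((M.σ ^ n) (M.σ d)) → (M.σ ^ n) (M.σ d) ∈ S := by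
    intro n
    induction n with
    | zero => exact fun d hd hn => hd _ (.here d hn)
    | succ n ih =>
      intro d hd hn
      rw [pow_succ, Equiv.Perm.mul_apply] at hn ⊢
      refine ih _ (fun e he => ?_) hn
      by_cases h : i ∈ M.color (M.σ d)
      · exact hS _ (hd _ (.here d h)) e he
      · exact hd _ (.step d e h he)
  obtain ⟨n, rfl⟩ := iterate_of_sameCycle (Equiv.Perm.sameCycle_apply_left.2 h)
  exact key n d (hS d hd) hf

/-- Every cilium carries the color `i`, so no cilium is among the darts skipped on the way. -/
theorem nextCilium {d e : M.dart} (h : M.NextColored i d e) (he : M.IsCilium e)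
    (hcol : ∀ c, M.IsCilium c → i ∈ M.color c) : M.NextCilium i d e := by
  induction h with
  | here d h =>
    refine .of_isCilium ?_ he
    rw [faceStep, if_pos h]
    exact he
  | step d e h _ ih =>
    have h1 : M.faceStep i d = M.σ d := if_neg h
    refine .step _ _ ?_ ?_ <;> rw [h1]
    exacts [mt (hcol _) h, ih he]

theorem nextCilium_trans {d e c : M.dart} (h : M.NextColored i d e) (he : ¬ M.IsCilium e)
    (hcol : ∀ c, M.IsCilium c → i ∈ M.color c) (hc : M.NextCilium i (M.α e) c) :
    M.NextCilium i d c := by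
  induction h with
  | here d h =>
    have h1 : M.faceStep i d = M.α (M.σ d) := if_pos h
    refine .step _ _ ?_ ?_ <;> rw [h1]
    exacts [by rwa [isCilium_α], hc]
  | step d e h _ ih =>
    have h1 : M.faceStep i d = M.σ d := if_neg h
    refine .step _ _ ?_ ?_ <;> rw [h1]
    exacts [mt (hcol _) h, ih he hc]

end NextColored

end CMap

/-! ### The full map of a bubble and the maps with removed edges -/

namespace BubbleDart

variable {D : ℕ} {B : Bubble D} {Ω : B.Pairing} {R : Fin D → Set B.white}

theorem ext_vertex_kind {d d' : BubbleDart B Ω R} (hv : d.vertex = d'.vertex)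
    (hk : d.kind = d'.kind) : d = d' := by
  rcases d with x | ⟨i, x, h⟩ | ⟨i, x, h⟩ <;> rcases d' with y | ⟨j, y, h'⟩ | ⟨j, y, h'⟩ <;>
    simp [vertex, kind] at hv hk <;> grind

/-- The colors of the darts of a given kind. -/
def kindColor : Option (Fin D × Bool) → Finset (Fin D)
  | none => Finset.univ
  | some k => {k.1}

theorem color_eq (d : BubbleDart B Ω R) : d.color = kindColor d.kind := by cases d <;> rfl

/-- The other end of an edge. -/
def kindShift (B : Bubble D) (Ω : B.Pairing) : Option (Fin D × Bool) → Equiv.Perm B.white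
  | none => Equiv.refl _
  | some (i, true) => B.tau Ω i
  | some (i, false) => (B.tau Ω i).symm

theorem vertex_flip (d : BubbleDart B Ω R) : d.flip.vertex = kindShift B Ω d.kind d.vertex := by
  cases d <;> rfl

theorem kind_flip (d : BubbleDart B Ω R) :
    d.flip.kind = d.kind.map fun k => (k.1, !k.2) := by
  cases d <;> rfl

theorem flip_eq_iff {d : BubbleDart B Ω R} : d.flip = d ↔ ∃ x, cilium x = d := by
  cases d <;> simp [flip]

theorem eq_of_mem_color {i : Fin D} {d : BubbleDart B Ω R} (h : i ∈ d.color) :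
    d = cilium d.vertex ∨ (∃ h, d = out i d.vertex h) ∨ ∃ h, d = inc i d.vertex h := by
  rcases d with x | ⟨j, x, hx⟩ | ⟨j, x, hx⟩
  · exact .inl rfl
  · obtain rfl := Finset.mem_singleton.1 h
    exact .inr (.inl ⟨hx, rfl⟩)
  · obtain rfl := Finset.mem_singleton.1 h
    exact .inr (.inr ⟨hx, rfl⟩)

end BubbleDart

namespace bubbleMap

variable {D : ℕ} {B : Bubble D} {Ω : B.Pairing} {R : Fin D → Set B.white}
  {σ : Equiv.Perm (BubbleDart B Ω R)} (hσ : IsRotation B Ω R σ) {i : Fin D}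

open BubbleDart

theorem isCilium_iff {d : BubbleDart B Ω R} :
    (bubbleMap B Ω R σ).IsCilium d ↔ ∃ x, cilium x = d :=
  flip_eq_iff

theorem mem_color_of_isCilium (c : (bubbleMap B Ω R σ).dart) (hc : (bubbleMap B Ω R σ).IsCilium c) :
    i ∈ (bubbleMap B Ω R σ).color c := by
  obtain ⟨x, rfl⟩ := isCilium_iff.1 hc
  exact Finset.mem_univ i

theorem not_isCilium_out {x : B.white} {h} : ¬ (bubbleMap B Ω R σ).IsCilium (out i x h) := by
  rw [isCilium_iff]; simp

theorem not_isCilium_inc {x : B.white} {h} : ¬ (bubbleMap B Ω R σ).IsCilium (inc i x h) := by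
  rw [isCilium_iff]; simp

section Next

variable {x : B.white}

local notation "𝓜" => bubbleMap B Ω R σ

include hσ

theorem nextColored_cases {d e : BubbleDart B Ω R} (h : CMap.NextColored 𝓜 i d e) :
    e = cilium d.vertex ∨ (∃ h, e = out i d.vertex h) ∨ ∃ h, e = inc i d.vertex h := by
  have hv : d.vertex = e.vertex := (hσ.1 d e).1 h.sameCycle
  rw [hv]
  exact eq_of_mem_color h.mem_color

theorem exists_nextColored (i : Fin D) (d : BubbleDart B Ω R) :
    ∃ e, CMap.NextColored 𝓜 i d e :=
  CMap.NextColored.exists_of_sameCycle (M := 𝓜) (f := cilium d.vertex) ((hσ.1 _ _).2 rfl)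
    (Finset.mem_univ i)

/-- The darts of color `i` of a vertex are contained in each set closed under going to the next. -/
theorem mem_of_closed {S : Set (BubbleDart B Ω R)} {d f : BubbleDart B Ω R} (hd : d ∈ S)
    (hS : ∀ d ∈ S, ∃ e ∈ S, CMap.NextColored 𝓜 i d e)
    (hv : d.vertex = f.vertex) (hf : i ∈ f.color) : f ∈ S := by
  refine CMap.NextColored.mem_of_closed (M := 𝓜) (i := i) (fun d hd e he => ?_) hd
    ((hσ.1 _ _).2 hv) hf
  obtain ⟨e', he', h⟩ := hS d hd
  rwa [he.unique h]

/-- Ingoing darts are followed by ingoing darts or by the cilium, which excludes the outgoing dart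
of color `i`. The dart cannot be its own successor, since the cilium also carries `i`. -/
theorem nextColored_inc (h) : CMap.NextColored 𝓜 i (inc i x h) (cilium x) := by
  obtain ⟨e, he⟩ := exists_nextColored hσ i (inc i x h)
  have hnone : ∀ d : BubbleDart B Ω R, d.kind = none → i ∈ d.color := fun d hd => by
    rw [color_eq, hd]
    exact Finset.mem_univ i
  have key : ∀ d e : CMap.dart 𝓜, CMap.NextColored 𝓜 i d e →
      (∃ j, BubbleDart.kind d = some (j, false)) →
      BubbleDart.kind e = none ∨ ∃ j, BubbleDart.kind e = some (j, false) := by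
    intro d e he
    induction he with
    | here d h => exact fun ⟨j, hj⟩ => hσ.2 d j hj
    | step d e h _ ih =>
      rintro ⟨j, hj⟩
      rcases hσ.2 d j hj with h' | h'
      · exact absurd (hnone (σ d) h') h
      · exact ih h'
  rcases nextColored_cases hσ he with rfl | ⟨h', rfl⟩ | ⟨h', rfl⟩
  · exact he
  · have := key _ _ he ⟨i, rfl⟩
    simp [kind] at this
  · exfalso
    have := mem_of_closed hσ (S := {inc i x h}) (f := cilium x) rfl
      (fun d hd => ⟨_, rfl, by rw [Set.mem_singleton_iff.1 hd]; exact he⟩) rfl (Finset.mem_univ i)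
    simp at this

/-- A vertex has at most three darts of color `i`, and they form one cycle. Any other successor of
the cilium would close the cycle without the outgoing dart. -/
theorem nextColored_cilium (h) : CMap.NextColored 𝓜 i (cilium x) (out i x h) := by
  obtain ⟨e, he⟩ := exists_nextColored hσ i (cilium x)
  rcases nextColored_cases hσ he with rfl | ⟨h', rfl⟩ | ⟨h', rfl⟩
  · have := mem_of_closed hσ (S := {cilium x}) (f := out i x h) rfl
      (fun d hd => ⟨_, rfl, by rw [Set.mem_singleton_iff.1 hd]; exact he⟩) rfl
      (Finset.mem_singleton_self i)
    simp at this
  · exact he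
  · have := mem_of_closed hσ (i := i) (S := {cilium x, inc i x h'}) (d := cilium x)
      (f := out i x h) (.inl rfl) (by
        rintro d (rfl | rfl)
        · exact ⟨_, .inr rfl, he⟩
        · exact ⟨_, .inl rfl, nextColored_inc hσ h'⟩) rfl (Finset.mem_singleton_self i)
    simp at this

theorem nextColored_cilium_of_mem (hx : x ∈ R i) (h) :
    CMap.NextColored 𝓜 i (cilium x) (inc i x h) := by
  obtain ⟨e, he⟩ := exists_nextColored hσ i (cilium x)
  rcases nextColored_cases hσ he with rfl | ⟨h', rfl⟩ | ⟨h', rfl⟩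
  · have := mem_of_closed hσ (S := {cilium x}) (f := inc i x h) rfl
      (fun d hd => ⟨_, rfl, by rw [Set.mem_singleton_iff.1 hd]; exact he⟩) rfl
      (Finset.mem_singleton_self i)
    simp at this
  · exact absurd hx h'.2
  · exact he

theorem nextColored_cilium_of_fixed (hx : B.tau Ω i x = x) :
    CMap.NextColored 𝓜 i (cilium x) (cilium x) := by
  obtain ⟨e, he⟩ := exists_nextColored hσ i (cilium x)
  rcases nextColored_cases hσ he with rfl | ⟨h', rfl⟩ | ⟨h', rfl⟩
  · exact he
  · exact absurd hx h'.1
  · exact absurd hx h'.1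

/-- The cilium is followed by the outgoing dart; if this were followed by the cilium, the cycle
would miss the ingoing dart. -/
theorem nextColored_out (h) (h') : CMap.NextColored 𝓜 i (out i x h) (inc i x h') := by
  obtain ⟨e, he⟩ := exists_nextColored hσ i (out i x h)
  rcases nextColored_cases hσ he with rfl | ⟨h', rfl⟩ | ⟨h', rfl⟩
  · have := mem_of_closed hσ (i := i) (S := {cilium x, out i x h}) (d := cilium x)
      (f := inc i x h') (.inl rfl) (by
        rintro d (rfl | rfl)
        · exact ⟨_, .inr rfl, nextColored_cilium hσ h⟩
        · exact ⟨_, .inl rfl, he⟩) rfl (Finset.mem_singleton_self i)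
    simp at this
  · have := mem_of_closed hσ (S := {out i x h}) (f := cilium x) rfl
      (fun d hd => ⟨_, rfl, by rw [Set.mem_singleton_iff.1 hd]; exact he⟩) rfl
      (Finset.mem_univ i)
    simp at this
  · exact he

theorem nextColored_out_of_mem (h) (hx : (B.tau Ω i).symm x ∈ R i) :
    CMap.NextColored 𝓜 i (out i x h) (cilium x) := by
  obtain ⟨e, he⟩ := exists_nextColored hσ i (out i x h)
  rcases nextColored_cases hσ he with rfl | ⟨h', rfl⟩ | ⟨h', rfl⟩
  · exact he
  · have := mem_of_closed hσ (S := {out i x h}) (f := cilium x) rfl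
      (fun d hd => ⟨_, rfl, by rw [Set.mem_singleton_iff.1 hd]; exact he⟩) rfl
      (Finset.mem_univ i)
    simp at this
  · exact absurd hx h'.2

theorem nextCilium_inc (h) : CMap.NextCilium 𝓜 i (inc i x h) (cilium x) :=
  (nextColored_inc hσ h).nextCilium (isCilium_iff.2 ⟨x, rfl⟩) mem_color_of_isCilium

/-- The next cilium if the outgoing edge of color `i` is present. -/
theorem nextCilium_cilium (hx : B.tau Ω i x ≠ x) (hR : x ∉ R i) :
    CMap.NextCilium 𝓜 i (cilium x) (cilium (B.tau Ω i x)) :=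
  (nextColored_cilium hσ ⟨hx, hR⟩).nextCilium_trans not_isCilium_out mem_color_of_isCilium
    (nextCilium_inc hσ _)

theorem nextCilium_cilium_of_fixed (hx : B.tau Ω i x = x) :
    CMap.NextCilium 𝓜 i (cilium x) (cilium (B.tau Ω i x)) := by
  rw [hx]
  exact (nextColored_cilium_of_fixed hσ hx).nextCilium (isCilium_iff.2 ⟨x, rfl⟩)
    mem_color_of_isCilium

end Next

section Represents

variable (hR : ∀ i, ∀ x ∈ R i, B.tau Ω i x ≠ x)
  (hR' : ∀ i, ∀ x ∈ R i, ∀ y ∈ R i, (B.tau Ω i).SameCycle x y → x = y)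

include hR hR' in
-- At most one edge of a cycle is removed, so where the outgoing edge is missing the ingoing one
-- remains.
theorem symm_notMem {x : B.white} (hx : x ∈ R i) : (B.tau Ω i).symm x ∉ R i := by
  intro h
  have := hR' i _ h x hx (Equiv.Perm.sameCycle_symm_apply_left.2 (.refl _ _))
  exact hR i x hx (((B.tau Ω i).symm_apply_eq.1 this).symm)

include hσ hR hR' in
/-- The faces of color `i` inside a cut cycle lead to the cilium after the removed edge. -/
theorem nextCilium_chain {x : B.white} (hx : x ∈ R i) (n : ℕ) :
    ∀ y, y = (B.tau Ω i ^ n) (B.tau Ω i x) →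
      (∀ h, CMap.NextCilium (bubbleMap B Ω R σ) i (out i y h) (cilium (B.tau Ω i x))) ∧
      (y ∈ R i → CMap.NextCilium (bubbleMap B Ω R σ) i (cilium y) (cilium (B.tau Ω i x))) := by
  -- The cut cycle is a path from `τ i x` to `x`. Its face is followed backwards, from `y` to its
  -- predecessor, and ends at `τ i x`, where the ingoing edge is missing. Each step of the induction
  -- shifts the starting point forward by one.
  have base : (∀ h, CMap.NextCilium (bubbleMap B Ω R σ) i (out i (B.tau Ω i x) h)
      (cilium (B.tau Ω i x))) ∧ (B.tau Ω i x ∈ R i → CMap.NextCilium (bubbleMap B Ω R σ) i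
        (cilium (B.tau Ω i x)) (cilium (B.tau Ω i x))) := by
    refine ⟨fun h => ?_, fun h => ?_⟩
    · exact (nextColored_out_of_mem hσ h (by simpa using hx)).nextCilium
        (isCilium_iff.2 ⟨_, rfl⟩) mem_color_of_isCilium
    · refine absurd ?_ (hR i x hx)
      exact hR' i _ h x hx (Equiv.Perm.sameCycle_apply_left.2 (.refl _ _))
  induction n with
  | zero =>
    rintro _ rfl
    exact base
  | succ n ih =>
    rintro _ rfl
    obtain ⟨y, hy⟩ : ∃ y, y = (B.tau Ω i ^ n) (B.tau Ω i x) := ⟨_, rfl⟩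
    obtain ⟨h1, h2⟩ := ih y hy
    rw [pow_succ', Equiv.Perm.mul_apply, ← hy]
    have hs : (B.tau Ω i).SameCycle x y := by
      rw [hy, Equiv.Perm.sameCycle_pow_right, Equiv.Perm.sameCycle_apply_right]
    -- If `y` is the start of a removed edge, then `y = x` and the cycle has been run through once:
    -- the next point is `τ i x` again.
    by_cases hyR : y ∈ R i
    · rw [← hR' i x hx y hyR hs]
      exact base
    · have hne : B.tau Ω i y ≠ y := fun h => hR i x hx (hs.apply_eq_self_iff.2 h)
      have hinc : B.tau Ω i (B.tau Ω i y) ≠ B.tau Ω i y ∧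
          (B.tau Ω i).symm (B.tau Ω i y) ∉ R i :=
        ⟨fun e => hne ((B.tau Ω i).injective e), by rwa [Equiv.symm_apply_apply]⟩
      have hα : (bubbleMap B Ω R σ).α (inc i (B.tau Ω i y) hinc) = out i y ⟨hne, hyR⟩ := by
        refine ext_vertex_kind ?_ rfl
        exact (B.tau Ω i).symm_apply_apply y
      refine ⟨fun h => ?_, fun h => ?_⟩
      · exact (nextColored_out hσ h hinc).nextCilium_trans not_isCilium_inc mem_color_of_isCilium
          (hα ▸ h1 _)
      · exact (nextColored_cilium_of_mem hσ h hinc).nextCilium_trans not_isCilium_inc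
          mem_color_of_isCilium (hα ▸ h1 _)

include hσ in
theorem comp_eq_cilium (d : BubbleDart B Ω R) :
    (bubbleMap B Ω R σ).comp d = (bubbleMap B Ω R σ).comp (cilium d.vertex) :=
  CMap.comp_eq_of_sameCycle (M := bubbleMap B Ω R σ) ((hσ.1 _ _).2 rfl)

theorem exists_pow_of_sameCycle {x y : B.white} (h : (B.tau Ω i).SameCycle x y) :
    ∃ n : ℕ, y = (B.tau Ω i ^ n) x := by
  have := B.finite_white
  have := Fintype.ofFinite B.white
  have := Classical.decEq B.white
  obtain ⟨n, -, hn⟩ := h.exists_pow_eq'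
  exact ⟨n, hn.symm⟩

include hσ hR hR' in
-- It suffices that at most one edge is removed from each cycle, so this covers both the full map
-- and the cut maps.
theorem representsBubble : (bubbleMap B Ω R σ).RepresentsBubble B Ω cilium where
  cil_injective x y h := by injection h
  isCilium_iff d := isCilium_iff
  color_cil x := rfl
  exists_comp_eq d := ⟨BubbleDart.vertex d, comp_eq_cilium hσ d⟩
  label x i := by
    constructor
    · rintro ⟨d, hs, hd, hi⟩
      have hv : x = BubbleDart.vertex d := (hσ.1 _ _).1 hs
      rcases eq_of_mem_color hi with h | ⟨h, -⟩ | ⟨h, -⟩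
      · exact absurd (isCilium_iff.2 ⟨_, h.symm⟩) hd
      · rw [hv]; exact h.1
      · rw [hv]; exact h.1
    · intro hx
      by_cases hxR : x ∈ R i
      · exact ⟨inc i x ⟨hx, symm_notMem hR hR' hxR⟩, (hσ.1 _ _).2 rfl, not_isCilium_inc,
          Finset.mem_singleton_self i⟩
      · exact ⟨out i x ⟨hx, hxR⟩, (hσ.1 _ _).2 rfl, not_isCilium_out,
          Finset.mem_singleton_self i⟩
  next i x := by
    by_cases hx : B.tau Ω i x = x
    · exact nextCilium_cilium_of_fixed hσ hx
    by_cases hxR : x ∈ R i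
    · obtain ⟨n, hn⟩ := exists_pow_of_sameCycle
        (Equiv.Perm.sameCycle_apply_left.2 (Equiv.Perm.SameCycle.refl (B.tau Ω i) x))
      exact (nextCilium_chain hσ hR hR' hxR n x hn).2 hxR
    · exact nextCilium_cilium hσ hx hxR

/-- Here a removed edge is needed in every nontrivial cycle: an uncut cycle has a side along which
only ingoing and outgoing darts alternate. -/
theorem facesMeetCilia (hσ : IsRotation B Ω R σ) (hcut : IsCut B Ω R) :
    (bubbleMap B Ω R σ).FacesMeetCilia := by
  intro i d _
  have hR : ∀ i, ∀ x ∈ R i, B.tau Ω i x ≠ x := fun i => (hcut i).1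
  have hR' : ∀ i, ∀ x ∈ R i, ∀ y ∈ R i, (B.tau Ω i).SameCycle x y → x = y :=
    fun i x hx y hy h => ((hcut i).2 x (hR i x hx)).unique ⟨.refl _ _, hx⟩ ⟨h, hy⟩
  obtain ⟨e, he⟩ := exists_nextColored hσ i d
  rcases nextColored_cases hσ he with rfl | ⟨h, rfl⟩ | ⟨h, rfl⟩
  · exact ⟨_, he.nextCilium (isCilium_iff.2 ⟨_, rfl⟩) mem_color_of_isCilium⟩
  · exact ⟨_, he.nextCilium_trans not_isCilium_out mem_color_of_isCilium
      (nextCilium_inc hσ _)⟩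
  · obtain ⟨x, ⟨hs, hx⟩, -⟩ := (hcut i).2 _ h.1
    obtain ⟨n, hn⟩ := exists_pow_of_sameCycle (Equiv.Perm.sameCycle_apply_left.2
      (Equiv.Perm.sameCycle_symm_apply_right.2 hs.symm))
    exact ⟨_, he.nextCilium_trans not_isCilium_inc mem_color_of_isCilium
      ((nextCilium_chain hσ hR hR' hx n _ hn).1 _)⟩

/-- A dart is determined by its vertex and its kind; an automorphism moves the vertex and keeps the
kind. -/
theorem isSymmetric (hσ : IsRotation B Ω R σ) (hsymm : IsSymmRotation B Ω R σ) :
    (bubbleMap B Ω R σ).IsSymmetric B Ω cilium := by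
  intro f hf
  obtain ⟨hfR, hfσ⟩ := hsymm f hf
  have htau' : ∀ i x, f ((B.tau Ω i).symm x) = (B.tau Ω i).symm (f x) := fun i x => by
    rw [Equiv.eq_symm_apply, ← hf.map_tau, Equiv.apply_symm_apply]
  have hne : ∀ i x, B.tau Ω i x ≠ x → B.tau Ω i (f x) ≠ f x := fun i x hx h => by
    rw [← hf.map_tau] at h
    exact hx (f.injective h)
  have hex : ∀ d : BubbleDart B Ω R, ∃ d' : BubbleDart B Ω R,
      d'.vertex = f d.vertex ∧ d'.kind = d.kind := by
    rintro (x | ⟨i, x, h⟩ | ⟨i, x, h⟩)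
    · exact ⟨cilium (f x), rfl, rfl⟩
    · exact ⟨out i (f x) ⟨hne i x h.1, by rw [hfR]; exact h.2⟩, rfl, rfl⟩
    · exact ⟨inc i (f x) ⟨hne i x h.1, by rw [← htau', hfR]; exact h.2⟩, rfl, rfl⟩
  choose φ hv hk using hex
  have hshift : ∀ k x, f (kindShift B Ω k x) = kindShift B Ω k (f x) := by
    rintro (_ | ⟨i, _ | _⟩) x
    exacts [rfl, htau' i x, hf.map_tau i x]
  have hσv : ∀ d, (σ d).vertex = d.vertex := fun d =>
    (hσ.1 _ _).1 (Equiv.Perm.sameCycle_apply_left.2 (.refl _ _))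
  have h1 : ∀ d, φ (σ d) = σ (φ d) := fun d => by
    refine ext_vertex_kind ?_ ?_
    · rw [hv, hσv, hσv, hv]
    · rw [hk, hfσ d (φ d) (hv d) (hk d)]
  have h2 : ∀ d, φ d.flip = (φ d).flip := fun d => by
    refine ext_vertex_kind ?_ ?_
    · rw [hv, vertex_flip, vertex_flip, hv, hk, hshift]
    · rw [hk, kind_flip, kind_flip, hk]
  have h3 : ∀ d, (φ d).color = d.color := fun d => by rw [color_eq, hk, ← color_eq]
  exact ⟨⟨φ, h1, h2, h3⟩, fun x => ext_vertex_kind (hv _) (hk _)⟩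

end Represents

end bubbleMap

/-! ### The reduced map with stars -/

namespace StarDart

variable {D : ℕ} {B : Bubble D} {Ω : B.Pairing}

theorem ext_vertex_kind {d d' : StarDart B Ω} (hv : d.vertex = d'.vertex)
    (hk : d.kind = d'.kind) : d = d' := by
  rcases d with x | ⟨i, x, h⟩ <;> rcases d' with y | ⟨j, y, h'⟩ <;>
    simp [vertex, kind] at hv hk <;> grind

end StarDart

namespace starMap

variable {D : ℕ} {B : Bubble D} {Ω : B.Pairing} {σ : Equiv.Perm (StarDart B Ω)}
  {i : Fin D} {x : B.white}

open StarDart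

local notation "𝓜" => starMap B Ω σ

/-- A dart at a ciliated vertex. -/
def outer (_σ : Equiv.Perm (StarDart B Ω)) (d : StarDart B Ω) : CMap.dart (starMap B Ω _σ) :=
  Sum.inl d

/-- A dart at the center of a star. -/
def center (_σ : Equiv.Perm (StarDart B Ω)) (i : Fin D) (x : B.white) (h : B.tau Ω i x ≠ x) :
    CMap.dart (starMap B Ω _σ) := Sum.inr ⟨(i, x), h⟩

theorem isCilium_outer {d : StarDart B Ω} : CMap.IsCilium 𝓜 (outer σ d) ↔ ∃ x, cilium x = d := by
  rcases d with x | ⟨i, x, h⟩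
  · exact iff_of_true rfl ⟨x, rfl⟩
  · refine iff_of_false (fun h => Sum.inr_ne_inl (h : _ = _)) (by simp)

theorem not_isCilium_center {h : B.tau Ω i x ≠ x} : ¬ CMap.IsCilium 𝓜 (center σ i x h) :=
  fun h => Sum.inl_ne_inr (h : _ = _)

theorem not_isCilium_leaf {h : B.tau Ω i x ≠ x} :
    ¬ CMap.IsCilium 𝓜 (outer σ (leaf i x h)) := by
  rw [isCilium_outer]; simp

theorem dart_cases (d : CMap.dart 𝓜) :
    (∃ d', d = outer σ d') ∨ ∃ i x h, d = center σ i x h := by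
  rcases d with d | ⟨⟨i, x⟩, h⟩
  exacts [.inl ⟨d, rfl⟩, .inr ⟨i, x, h, rfl⟩]

theorem isCilium_iff {d : CMap.dart 𝓜} : CMap.IsCilium 𝓜 d ↔ ∃ x, outer σ (cilium x) = d := by
  rcases dart_cases d with ⟨d, rfl⟩ | ⟨i, x, h, rfl⟩
  · rw [isCilium_outer]
    exact exists_congr fun x => Sum.inl_injective.eq_iff.symm
  · refine iff_of_false not_isCilium_center ?_
    rintro ⟨x, hx⟩
    exact Sum.inl_ne_inr hx

theorem mem_color_of_isCilium (c : CMap.dart 𝓜) (hc : CMap.IsCilium 𝓜 c) :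
    i ∈ CMap.color 𝓜 c := by
  obtain ⟨x, rfl⟩ := isCilium_iff.1 hc
  exact Finset.mem_univ i

theorem nextColored_center {h : B.tau Ω i x ≠ x} : CMap.NextColored 𝓜 i (center σ i x h)
    (center σ i (B.tau Ω i x) fun e => h ((B.tau Ω i).injective e)) :=
  .here _ (Finset.mem_singleton_self i)

theorem mem_color_center {j : Fin D} {h : B.tau Ω i x ≠ x} :
    j ∈ CMap.color 𝓜 (center σ i x h) ↔ j = i :=
  Finset.mem_singleton

theorem eq_of_sameCycle_center {j : Fin D} {h : B.tau Ω i x ≠ x} {d : CMap.dart 𝓜}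
    (hs : (CMap.σ 𝓜).SameCycle (center σ i x h) d) (hd : j ∈ CMap.color 𝓜 d) : j = i := by
  have := CMap.eq_of_sameCycle (M := 𝓜)
    (Sum.elim (fun _ => none) fun c => some c.1.1) (by rintro (d | c) <;> rfl) hs
  rcases dart_cases d with ⟨d, rfl⟩ | ⟨k, y, h', rfl⟩
  · exact absurd this nofun
  · rw [mem_color_center] at hd
    rw [hd]
    exact (Option.some.inj this).symm

variable (hσ : IsStarRotation B Ω σ)
include hσ

theorem vertex_σ (d : StarDart B Ω) : (σ d).vertex = d.vertex :=
  (hσ _ _).1 (Equiv.Perm.sameCycle_apply_left.2 (.refl _ _))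

theorem sameCycle_outer_iff {d : StarDart B Ω} {e : CMap.dart 𝓜} :
    (CMap.σ 𝓜).SameCycle (outer σ d) e ↔ ∃ d', e = outer σ d' ∧ d.vertex = d'.vertex := by
  constructor
  · intro hs
    have := CMap.eq_of_sameCycle (M := 𝓜)
      (Sum.elim (fun d => some (vertex d)) fun _ => none) (by
        rintro (d | c)
        · exact congrArg some (vertex_σ hσ d)
        · rfl) hs
    rcases dart_cases e with ⟨d', rfl⟩ | ⟨k, y, h', rfl⟩
    · exact ⟨d', rfl, Option.some.inj this⟩
    · exact absurd this nofun
  · rintro ⟨d', rfl, hv⟩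
    have := StarDart.finite (B := B) (Ω := Ω)
    have := Fintype.ofFinite (StarDart B Ω)
    have := Classical.decEq (StarDart B Ω)
    obtain ⟨n, -, rfl⟩ := ((hσ d d').2 hv).exists_pow_eq'
    refine ⟨n, ?_⟩
    rw [zpow_natCast]
    clear hv
    induction n with
    | zero => rfl
    | succ n ih => rw [pow_succ', pow_succ', Equiv.Perm.mul_apply, ih]; rfl

theorem nextColored_cases {d : StarDart B Ω} {e : CMap.dart 𝓜}
    (h : CMap.NextColored 𝓜 i (outer σ d) e) :
    e = outer σ (cilium d.vertex) ∨ ∃ h, e = outer σ (leaf i d.vertex h) := by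
  obtain ⟨d', rfl, hv⟩ := (sameCycle_outer_iff hσ).1 h.sameCycle
  have hc := h.mem_color
  rw [hv]
  rcases d' with y | ⟨j, y, h'⟩
  · exact .inl rfl
  · obtain rfl := Finset.mem_singleton.1 hc
    exact .inr ⟨h', rfl⟩

theorem exists_nextColored (i : Fin D) (d : StarDart B Ω) :
    ∃ e, CMap.NextColored 𝓜 i (outer σ d) e :=
  CMap.NextColored.exists_of_sameCycle (f := outer σ (cilium d.vertex))
    ((sameCycle_outer_iff hσ).2 ⟨_, rfl, rfl⟩) (Finset.mem_univ i)

/-- A dart of color `i` that came next after itself would be the only one at its vertex. -/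
theorem not_nextColored_self {d d' : StarDart B Ω} (hv : d.vertex = d'.vertex)
    (hi : i ∈ CMap.color 𝓜 (outer σ d')) (hne : d ≠ d') :
    ¬ CMap.NextColored 𝓜 i (outer σ d) (outer σ d) := by
  intro h
  have := CMap.NextColored.mem_of_closed (M := 𝓜) (i := i) (S := {outer σ d})
    (d := outer σ d) (f := outer σ d')
    (fun e he e' he' => by
      rw [Set.mem_singleton_iff.1 he] at he'
      exact he'.unique h) rfl ((sameCycle_outer_iff hσ).2 ⟨_, rfl, hv⟩) hi
  exact hne (Sum.inl_injective (Set.mem_singleton_iff.1 this)).symm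

theorem nextCilium_leaf {h : B.tau Ω i x ≠ x} :
    CMap.NextCilium 𝓜 i (outer σ (leaf i x h)) (outer σ (cilium x)) := by
  obtain ⟨e, he⟩ := exists_nextColored hσ i (leaf i x h)
  rcases nextColored_cases hσ he with rfl | ⟨h', rfl⟩
  · exact he.nextCilium (isCilium_iff.2 ⟨_, rfl⟩) mem_color_of_isCilium
  · exact absurd he (not_nextColored_self hσ (d' := cilium x) rfl (Finset.mem_univ i) (by simp))

/-- Around the center the dart of `x` is followed by that of `τ i x`. Its edge leads to the vertex
of `τ i x`, where the cilium is the only other dart with the color `i`. -/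
theorem nextCilium_center {h : B.tau Ω i x ≠ x} :
    CMap.NextCilium 𝓜 i (center σ i x h) (outer σ (cilium (B.tau Ω i x))) :=
  nextColored_center.nextCilium_trans not_isCilium_center mem_color_of_isCilium
    (nextCilium_leaf hσ)

theorem comp_outer (d : StarDart B Ω) :
    CMap.comp 𝓜 (outer σ d) = CMap.comp 𝓜 (outer σ (cilium d.vertex)) :=
  CMap.comp_eq_of_sameCycle ((sameCycle_outer_iff hσ).2 ⟨_, rfl, rfl⟩)

theorem representsBubble :
    (starMap B Ω σ).RepresentsBubble B Ω fun x => Sum.inl (StarDart.cilium x) where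
  cil_injective x y h := by
    have := Sum.inl_injective h
    injection this
  isCilium_iff d := isCilium_iff
  color_cil x := rfl
  exists_comp_eq d := by
    rcases dart_cases d with ⟨d, rfl⟩ | ⟨i, x, h, rfl⟩
    · exact ⟨d.vertex, comp_outer hσ d⟩
    · exact ⟨B.tau Ω i x, (nextCilium_center hσ).comp_eq.symm⟩
  label x i := by
    constructor
    · rintro ⟨d, hs, hd, hi⟩
      obtain ⟨d, rfl, hv⟩ := (sameCycle_outer_iff hσ (d := cilium x)).1 hs
      rcases d with y | ⟨j, y, h⟩
      · exact absurd (isCilium_iff.2 ⟨_, rfl⟩) hd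
      · obtain rfl := Finset.mem_singleton.1 hi
        obtain rfl : x = y := hv
        exact h
    · intro h
      exact ⟨outer σ (leaf i x h), (sameCycle_outer_iff hσ (d := cilium x)).2 ⟨_, rfl, rfl⟩,
        not_isCilium_leaf, Finset.mem_singleton_self i⟩
  next i x := by
    obtain ⟨e, he⟩ := exists_nextColored hσ i (cilium x)
    by_cases hx : B.tau Ω i x = x
    · rcases nextColored_cases hσ he with rfl | ⟨h', rfl⟩
      · rw [hx]
        exact he.nextCilium (isCilium_iff.2 ⟨_, rfl⟩) mem_color_of_isCilium
      · exact absurd hx h'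
    · rcases nextColored_cases hσ he with rfl | ⟨h', rfl⟩
      · exact absurd he (not_nextColored_self hσ (d' := leaf i x hx) rfl
          (Finset.mem_singleton_self i) (by simp))
      · exact he.nextCilium_trans not_isCilium_leaf mem_color_of_isCilium
          (nextCilium_center hσ (h := h'))

theorem facesMeetCilia : (starMap B Ω σ).FacesMeetCilia := by
  rintro i d ⟨d', hs, -, hi⟩
  rcases dart_cases d with ⟨d, rfl⟩ | ⟨j, x, h, rfl⟩
  · obtain ⟨e, he⟩ := exists_nextColored hσ i d
    rcases nextColored_cases hσ he with rfl | ⟨h', rfl⟩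
    · exact ⟨_, he.nextCilium (isCilium_iff.2 ⟨_, rfl⟩) mem_color_of_isCilium⟩
    · exact ⟨_, he.nextCilium_trans not_isCilium_leaf mem_color_of_isCilium
        (nextCilium_center hσ (h := h'))⟩
  · obtain rfl := eq_of_sameCycle_center hs hi
    exact ⟨_, nextCilium_center hσ⟩

theorem isSymmetric (hsymm : IsSymmStarRotation B Ω σ) :
    (starMap B Ω σ).IsSymmetric B Ω fun x => Sum.inl (StarDart.cilium x) := by
  intro f hf
  have hne : ∀ i x, B.tau Ω i x ≠ x → B.tau Ω i (f x) ≠ f x := fun i x hx h => by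
    rw [← hf.map_tau] at h
    exact hx (f.injective h)
  have hex : ∀ d : StarDart B Ω, ∃ d' : StarDart B Ω,
      d'.vertex = f d.vertex ∧ d'.kind = d.kind := by
    rintro (x | ⟨i, x, h⟩)
    · exact ⟨cilium (f x), rfl, rfl⟩
    · exact ⟨leaf i (f x) (hne i x h), rfl, rfl⟩
  choose φ hv hk using hex
  have h1 : ∀ d, φ (σ d) = σ (φ d) := fun d => by
    refine ext_vertex_kind ?_ ?_
    · rw [hv, vertex_σ hσ, vertex_σ hσ, hv]
    · rw [hk, hsymm f hf d (φ d) (hv d) (hk d)]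
  have hc : ∀ x, φ (cilium x) = cilium (f x) := fun x => ext_vertex_kind (hv _) (hk _)
  have hl : ∀ i x h, φ (leaf i x h) = leaf i (f x) (hne i x h) := fun i x h =>
    ext_vertex_kind (hv _) (hk _)
  refine ⟨⟨Sum.map φ fun c => ⟨(c.1.1, f c.1.2), hne _ _ c.2⟩, ?_, ?_, ?_⟩,
    fun x => congrArg Sum.inl (hc x)⟩
  · rintro (d | ⟨⟨i, x⟩, h⟩)
    · exact congrArg Sum.inl (h1 d)
    · exact congrArg Sum.inr (Subtype.ext (Prod.ext rfl (hf.map_tau i x)))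
  · rintro ((x | ⟨i, x, h⟩) | ⟨⟨i, x⟩, h⟩)
    · change Sum.inl (φ (cilium x)) = (starMap B Ω σ).α (Sum.inl (φ (cilium x)))
      rw [hc]
      rfl
    · change _ = (starMap B Ω σ).α (Sum.inl (φ (leaf i x h)))
      rw [hl]
      rfl
    · exact congrArg Sum.inl (hl i x h)
  · rintro ((x | ⟨i, x, h⟩) | ⟨⟨i, x⟩, h⟩)
    · change (starMap B Ω σ).color (Sum.inl (φ (cilium x))) = _
      rw [hc]
      rfl
    · change (starMap B Ω σ).color (Sum.inl (φ (leaf i x h))) = _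
      rw [hl]
      rfl
    · rfl

end starMap

/-- Arranging the fibers of a map `v` cyclically, in the order of a rank which is injective on each
fiber: each fiber is a cycle, the successor has the next larger rank, or the smallest one. -/
theorem exists_perm_of_rank {A V : Type*} [Finite A] (v : A → V) (r : A → ℕ)
    (hinj : ∀ d d', v d = v d' → r d = r d' → d = d') :
    ∃ σ : Equiv.Perm A, (∀ d d', σ.SameCycle d d' ↔ v d = v d') ∧
      (∀ d, r d < r (σ d) ∨ ∀ e, v e = v d → r (σ d) ≤ r e) ∧
      ∀ d d', r d = r d' → (∀ e, v e = v d → ∃ e', v e' = v d' ∧ r e' = r e) →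
        (∀ e, v e = v d' → ∃ e', v e' = v d ∧ r e' = r e) → r (σ d) = r (σ d') := by
  -- The successor is the element of the fiber with the next larger rank; at the largest rank it is
  -- the element with the smallest.
  have key : ∀ d, ∃ s, v s = v d ∧
      ((r d < r s ∧ ∀ e, v e = v d → r d < r e → r s ≤ r e) ∨
        (∀ e, v e = v d → r e ≤ r d) ∧ ∀ e, v e = v d → r s ≤ r e) := by
    intro d
    by_cases h : ∃ e, v e = v d ∧ r d < r e
    · obtain ⟨s, hs, hmin⟩ := Set.exists_min_image {e | v e = v d ∧ r d < r e} r
        (Set.toFinite _) h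
      exact ⟨s, hs.1, .inl ⟨hs.2, fun e he he' => hmin e ⟨he, he'⟩⟩⟩
    · push Not at h
      obtain ⟨s, hs, hmin⟩ := Set.exists_min_image {e | v e = v d} r (Set.toFinite _) ⟨d, rfl⟩
      exact ⟨s, hs, .inr ⟨h, hmin⟩⟩
  choose s hv hs using key
  have hle : ∀ d d', s d = s d' → r d ≤ r d' := by
    intro d d' h
    have hvv : v d = v d' := by rw [← hv d, h, hv d']
    by_contra! hlt
    rcases hs d with ⟨h1, -⟩ | ⟨-, h2⟩
    · rcases hs d' with ⟨-, h4⟩ | ⟨-, h4⟩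
      · exact absurd (h4 d hvv hlt) (by rw [← h]; omega)
      · exact absurd (h4 d hvv) (by rw [← h]; omega)
    · rcases hs d' with ⟨h3, -⟩ | ⟨h3, -⟩
      · exact absurd (h2 d' hvv.symm) (by rw [h]; omega)
      · exact absurd (h3 d hvv) (by omega)
  have hsinj : Function.Injective s := fun d d' h =>
    hinj d d' (by rw [← hv d, h, hv d']) ((hle _ _ h).antisymm (hle _ _ h.symm))
  refine ⟨Equiv.ofBijective s (Finite.injective_iff_bijective.1 hsinj), ?_, ?_, ?_⟩
  · set σ : Equiv.Perm A := Equiv.ofBijective s (Finite.injective_iff_bijective.1 hsinj)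
    -- Every element of a fiber is on the cycle of the minimal one: stepping back lowers the rank
    -- until the minimum is reached.
    have hmin : ∀ n d m, r d = n → v m = v d → (∀ e, v e = v d → r m ≤ r e) →
        σ.SameCycle m d := by
      intro n
      induction n using Nat.strong_induction_on with
      | _ n ih =>
        intro d m hn hm hle
        obtain ⟨e, rfl⟩ := σ.surjective d
        have hve : v (σ e) = v e := hv e
        rcases hs e with ⟨h1, -⟩ | ⟨-, h2⟩
        · refine (ih (r e) (hn ▸ h1) e m rfl (hm.trans hve) fun x hx => ?_).trans
            (Equiv.Perm.sameCycle_apply_right.2 (.refl _ _))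
          exact hle x (hx.trans hve.symm)
        · rw [hinj m (σ e) hm ((hle _ rfl).antisymm (h2 m (hm.trans hve)))]
    intro d d'
    constructor
    · rintro h
      have := Fintype.ofFinite A
      have := Classical.decEq A
      obtain ⟨n, -, rfl⟩ := h.exists_pow_eq'
      induction n with
      | zero => rfl
      | succ n ih =>
        rw [pow_succ', Equiv.Perm.mul_apply]
        exact (ih ⟨n, rfl⟩).trans (hv _).symm
    · intro h
      obtain ⟨m, hm, hle⟩ := Set.exists_min_image {e | v e = v d} r (Set.toFinite _) ⟨d, rfl⟩
      exact (hmin _ d m rfl hm hle).symm.trans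
        (hmin _ d' m rfl (hm.trans h) fun e he => hle e (he.trans h.symm))
  · intro d
    exact (hs d).imp And.left And.right
  -- The rank of the successor depends only on the rank of the element and on the set of ranks in
  -- its fiber. One inequality is enough, by exchanging the two fibers.
  · have main : ∀ d d', r d = r d' → (∀ e, v e = v d → ∃ e', v e' = v d' ∧ r e' = r e) →
        (∀ e, v e = v d' → ∃ e', v e' = v d ∧ r e' = r e) → r (s d) ≤ r (s d') := by
      intro d d' hr h1 h2
      obtain ⟨e, he, her⟩ := h2 _ (hv d')
      obtain ⟨e', he', her'⟩ := h1 _ (hv d)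
      rcases hs d with ⟨h3, h4⟩ | ⟨h3, h4⟩
      · rcases hs d' with ⟨h5, -⟩ | ⟨h5, -⟩
        · exact her ▸ h4 e he (by omega)
        · exact absurd (h5 e' he') (by omega)
      · exact her ▸ h4 e he
    exact fun d d' hr h1 h2 => (main d d' hr h1 h2).antisymm (main d' d hr.symm h2 h1)

/-! ### Existence of admissible and symmetric choices -/

section Rotations

variable {D : ℕ} {B : Bubble D} {Ω : B.Pairing} {R : Fin D → Set B.white}

/-- The position of a kind of dart: the cilium, then the outgoing, then the ingoing darts. -/
def BubbleDart.kindRank : Option (Fin D × Bool) → ℕ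
  | none => 0
  | some (i, true) => 1 + i
  | some (i, false) => 1 + D + i

theorem BubbleDart.kindRank_injective : Function.Injective (kindRank (D := D)) := by
  rintro (_ | ⟨i, _ | _⟩) (_ | ⟨j, _ | _⟩) h <;> simp only [kindRank] at h <;>
    first | rfl | omega | (obtain rfl : i = j := Fin.ext (by omega)); rfl

/-- The position of a kind of dart: the cilium, then the colors. -/
def StarDart.kindRank : Option (Fin D) → ℕ
  | none => 0
  | some i => 1 + i

theorem StarDart.kindRank_injective : Function.Injective (kindRank (D := D)) := by
  rintro (_ | i) (_ | j) h <;> simp only [kindRank] at h <;>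
    first | rfl | omega | (obtain rfl : i = j := Fin.ext (by omega)); rfl

variable (B Ω R) in
-- All vertices use the same order of the kinds. If the removed edges are preserved, an automorphism
-- takes a vertex to one with the same kinds of darts, so the successors also have the same kinds.
theorem exists_isRotation : ∃ σ, IsRotation B Ω R σ ∧
    ((∀ f, B.IsPairAut Ω f → ∀ i x, f x ∈ R i ↔ x ∈ R i) → IsSymmRotation B Ω R σ) := by
  have := BubbleDart.finite (B := B) (Ω := Ω) (R := R)
  obtain ⟨σ, h1, h2, h3⟩ := exists_perm_of_rank (A := BubbleDart B Ω R) BubbleDart.vertex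
    (fun d => BubbleDart.kindRank d.kind)
    fun d d' h h' => BubbleDart.ext_vertex_kind h (BubbleDart.kindRank_injective h')
  refine ⟨σ, ⟨h1, fun d i hd => ?_⟩, fun hR f hf => ⟨hR f hf, fun d d' hv hk => ?_⟩⟩
  · rcases h2 d with h | h
    · rw [hd] at h
      rcases hk : (σ d).kind with _ | ⟨j, _ | _⟩
      · exact .inl rfl
      · exact .inr ⟨j, rfl⟩
      · rw [hk] at h
        simp only [BubbleDart.kindRank] at h
        omega
    -- After the last dart the order wraps around to the smallest rank, which is the rank `0` of the
    -- cilium.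
    · have := h (.cilium d.vertex) rfl
      exact .inl (BubbleDart.kindRank_injective (Nat.le_zero.1 this))
  · have hf' : ∀ i x, B.tau Ω i (f x) = f x ↔ B.tau Ω i x = x := fun i x => by
      rw [← hf.map_tau, f.apply_eq_iff_eq]
    have hs : ∀ i x, (B.tau Ω i).symm (f x) = f ((B.tau Ω i).symm x) := fun i x => by
      rw [Equiv.symm_apply_eq, ← hf.map_tau, Equiv.apply_symm_apply]
    refine BubbleDart.kindRank_injective (h3 d' d (congrArg _ hk) (fun e he => ?_) fun e he => ?_)
    · rw [hv] at he
      rcases e with x | ⟨i, x, h⟩ | ⟨i, x, h⟩ <;> obtain rfl : x = _ := he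
      · exact ⟨.cilium d.vertex, rfl, rfl⟩
      · exact ⟨.out i d.vertex (by rwa [Ne, hf', hR f hf] at h), rfl, rfl⟩
      · exact ⟨.inc i d.vertex (by rwa [Ne, hf', hs, hR f hf] at h), rfl, rfl⟩
    · rw [hv]
      rcases e with x | ⟨i, x, h⟩ | ⟨i, x, h⟩ <;> obtain rfl : x = _ := he
      · exact ⟨.cilium (f d.vertex), rfl, rfl⟩
      · exact ⟨.out i (f d.vertex) (by rwa [Ne, hf', hR f hf]), rfl, rfl⟩
      · exact ⟨.inc i (f d.vertex) (by rwa [Ne, hf', hs, hR f hf]), rfl, rfl⟩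

variable (B Ω) in
theorem exists_isStarRotation : ∃ σ, IsStarRotation B Ω σ ∧ IsSymmStarRotation B Ω σ := by
  have := StarDart.finite (B := B) (Ω := Ω)
  obtain ⟨σ, h1, -, h3⟩ := exists_perm_of_rank (A := StarDart B Ω) StarDart.vertex
    (fun d => StarDart.kindRank d.kind)
    fun d d' h h' => StarDart.ext_vertex_kind h (StarDart.kindRank_injective h')
  refine ⟨σ, h1, fun f hf d d' hv hk => ?_⟩
  have hf' : ∀ i x, B.tau Ω i (f x) = f x ↔ B.tau Ω i x = x := fun i x => by
    rw [← hf.map_tau, f.apply_eq_iff_eq]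
  refine StarDart.kindRank_injective (h3 d' d (congrArg _ hk) (fun e he => ?_) fun e he => ?_)
  · rw [hv] at he
    rcases e with x | ⟨i, x, h⟩ <;> obtain rfl : x = _ := he
    · exact ⟨.cilium d.vertex, rfl, rfl⟩
    · exact ⟨.leaf i d.vertex (by rwa [Ne, hf'] at h), rfl, rfl⟩
  · rw [hv]
    rcases e with x | ⟨i, x, h⟩ <;> obtain rfl : x = _ := he
    · exact ⟨.cilium (f d.vertex), rfl, rfl⟩
    · exact ⟨.leaf i (f d.vertex) (by rwa [Ne, hf']), rfl, rfl⟩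

variable (B Ω) in
-- In each nontrivial cycle, the edge going out of a chosen representative is removed.
theorem exists_isCut : ∃ R, IsCut B Ω R := by
  let rep i x := (Quotient.mk (Equiv.Perm.SameCycle.setoid (B.tau Ω i)) x).out
  have hrep : ∀ i x, (B.tau Ω i).SameCycle (rep i x) x := fun i x =>
    Quotient.mk_out (s := Equiv.Perm.SameCycle.setoid (B.tau Ω i)) x
  have hrep' : ∀ i x y, (B.tau Ω i).SameCycle x y → rep i x = rep i y := fun i x y h =>
    congrArg Quotient.out (Quotient.sound (s := Equiv.Perm.SameCycle.setoid (B.tau Ω i)) h)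
  refine ⟨fun i => {x | B.tau Ω i x ≠ x ∧ rep i x = x}, fun i => ⟨fun x hx => hx.1, fun x hx => ?_⟩⟩
  refine ⟨rep i x, ⟨(hrep i x).symm, fun h => hx ?_, hrep' i _ _ (hrep i x)⟩, ?_⟩
  · exact (hrep i x).apply_eq_self_iff.1 h
  · rintro y ⟨hy, -, hy'⟩
    rw [hrep' i x y hy, hy']

end Rotations

/-! ### Forgetting the pairing -/

section ForgetPairing

variable {D : ℕ}

theorem ColoredGraph.Iso.comp_eq {G H : ColoredGraph D} (F : G.Iso H) {u v : G.Vertex}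
    (h : G.comp u = G.comp v) :
    H.comp (Sum.map F.white F.black u) = H.comp (Sum.map F.white F.black v) := by
  refine Relation.EqvGen.apply_eq (fun u => H.comp (Sum.map F.white F.black u)) ?_
    (Quotient.exact h)
  rintro _ _ ⟨i, x, rfl, rfl⟩
  refine Quotient.sound (.rel _ _ ⟨i, F.white x, rfl, ?_⟩)
  rw [← F.map_edge]
  rfl

/-- A graph built from `B` carries a pairing induced by `Ω`. -/
theorem ColoredGraph.IsBuiltFrom.exists_pairing {G : ColoredGraph D} {B : Bubble D} {p : ℕ}
    (hG : G.IsBuiltFrom B p) (Ω : B.Pairing) :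
    ∃ π : G.white ≃ G.black, (PairedGraph.mk G π).IsBuiltFrom B Ω p := by
  have f : ∀ C, G.CompIso B C := fun C => (hG.comp_iso C).some
  -- On each bubble, `Ω` is transported by the chosen isomorphism; the bubbles partition the
  -- vertices.
  let π : G.white ≃ G.black := (Equiv.sigmaFiberEquiv fun x => G.comp (Sum.inl x)).symm.trans
    ((Equiv.sigmaCongrRight fun C => (f C).white.symm.trans (Ω.trans (f C).black)).trans
      (Equiv.sigmaFiberEquiv fun y => G.comp (Sum.inr y)))
  refine ⟨π, hG, fun C => ⟨⟨f C, fun y => ?_⟩⟩⟩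
  have hπ : ∀ C (x : {x // G.comp (Sum.inl x) = C}),
      π x.1 = ((f C).black (Ω ((f C).white.symm x))).1 := by
    rintro _ ⟨x, rfl⟩
    rfl
  exact ((hπ C _).trans (by rw [Equiv.symm_apply_apply])).symm

theorem forgetPairing_surjective (B : Bubble D) (Ω : B.Pairing) (p : ℕ) :
    Function.Surjective (forgetPairing B Ω p) := by
  rintro ⟨⟨G, hG⟩⟩
  obtain ⟨π, hπ⟩ := hG.exists_pairing Ω
  exact ⟨Quotient.mk _ ⟨_, hπ⟩, rfl⟩

/-- If `Ω` is invariant, every isomorphism of graphs preserves the induced pairings. -/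
theorem PairedGraph.IsBuiltFrom.map_pairing {B : Bubble D} {Ω : B.Pairing} {p : ℕ}
    (hΩ : Ω.IsInvariant) {G H : PairedGraph D} (hG : G.IsBuiltFrom B Ω p)
    (hH : H.IsBuiltFrom B Ω p) (F : G.toColoredGraph.Iso H.toColoredGraph) (x : G.white) :
    F.black (G.pairing x) = H.pairing (F.white x) := by
  obtain ⟨f⟩ := hG.comp_iso (G.comp (Sum.inl x))
  obtain ⟨g⟩ := hH.comp_iso (H.comp (Sum.inl (F.white x)))
  have := B.finite_white
  have := B.finite_black
  have ha : ∀ y, ∃ z, (g.white z).1 = F.white (f.white y).1 := fun y =>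
    ⟨g.white.symm ⟨_, F.comp_eq (f.white y).2⟩, by rw [Equiv.apply_symm_apply]⟩
  have hb : ∀ y, ∃ z, (g.black z).1 = F.black (f.black y).1 := fun y =>
    ⟨g.black.symm ⟨_, F.comp_eq (f.black y).2⟩, by rw [Equiv.apply_symm_apply]⟩
  -- Together, `a` and `b` are the comparison of `f` followed by `F` with `g`. They form an
  -- automorphism of `B`, to which the invariance of `Ω` applies.
  choose a ha using ha
  choose b hb using hb
  have ha' : Function.Injective a := fun y z h => f.white.injective (Subtype.ext
    (F.white.injective (by rw [← ha, h, ha])))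
  have hb' : Function.Injective b := fun y z h => f.black.injective (Subtype.ext
    (F.black.injective (by rw [← hb, h, hb])))
  have key := hΩ (.ofBijective a (Finite.injective_iff_bijective.1 ha'))
    (.ofBijective b (Finite.injective_iff_bijective.1 hb')) (fun i y => by
      refine g.black.injective (Subtype.ext ?_)
      rw [g.map_edge]
      exact (hb _).trans (by rw [f.map_edge, F.map_edge]; exact congrArg _ (ha y).symm))
  obtain ⟨y, hy⟩ := f.white.surjective ⟨x, rfl⟩
  have hx : (f.white y).1 = x := congrArg Subtype.val hy
  have h1 : b (Ω y) = Ω (a y) := key y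
  rw [← hx, ← f.map_pairing, ← hb, h1, g.map_pairing, ha]

theorem forgetPairing_injective {B : Bubble D} {Ω : B.Pairing} (hΩ : Ω.IsInvariant) (p : ℕ) :
    Function.Injective (forgetPairing B Ω p) := by
  rintro ⟨⟨G, hG⟩⟩ ⟨⟨H, hH⟩⟩ h
  obtain ⟨F⟩ := Quotient.exact h
  exact Quotient.sound ⟨⟨F, hG.map_pairing hΩ hH F⟩⟩

end ForgetPairing

theorem mainTheorem1 {D : ℕ} (hD : 2 ≤ D) (B : Bubble D) (Ω : B.Pairing) (p : ℕ) :
    -- each graph built from `B` carries a pairing induced by `Ω`, unique if `Ω` is invariant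
    (Function.Surjective (forgetPairing B Ω p) ∧
      (Ω.IsInvariant → Function.Bijective (forgetPairing B Ω p))) ∧
    -- the bijection with the stuffed Walsh maps of the map of `(B, Ω)`
    ((∃ σ, IsRotation B Ω (noCut B) σ ∧ IsSymmRotation B Ω (noCut B) σ) ∧
      ∀ σ, IsRotation B Ω (noCut B) σ → IsSymmRotation B Ω (noCut B) σ →
        ∃ Φ : PairedGraphClass B Ω p ≃ WalshClass (bubbleMap B Ω (noCut B) σ) p,
          ∀ (G : {G : PairedGraph D // G.IsBuiltFrom B Ω p})
            (W : {W : WalshMap D // W.IsStuffed (bubbleMap B Ω (noCut B) σ) p}),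
            Φ (Quotient.mk _ G) = Quotient.mk _ W ↔
              Nonempty (Correspondence B Ω (bubbleMap B Ω (noCut B) σ)
                BubbleDart.cilium G.1 W.1)) ∧
    -- the reduced maps obtained by removing an edge of each cycle of each color
    ((∃ R, IsCut B Ω R) ∧
      ∀ R, IsCut B Ω R → (∃ σ, IsRotation B Ω R σ) ∧
        ∀ σ, IsRotation B Ω R σ →
          (∀ W : WalshMap D, W.IsStuffed (bubbleMap B Ω R σ) p → W.AllFacesMeetBlack) ∧
          ∃ Ψ : WalshClass (bubbleMap B Ω R σ) p → PairedGraphClass B Ω p,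
            Function.Surjective Ψ ∧
            (IsSymmRotation B Ω R σ → Function.Bijective Ψ) ∧
            ∀ (G : {G : PairedGraph D // G.IsBuiltFrom B Ω p})
              (W : {W : WalshMap D // W.IsStuffed (bubbleMap B Ω R σ) p}),
              Ψ (Quotient.mk _ W) = Quotient.mk _ G ↔
                Nonempty (Correspondence B Ω (bubbleMap B Ω R σ) BubbleDart.cilium G.1 W.1)) ∧
    -- the reduced maps obtained by replacing the cycles of each color by stars
    ((∃ σ, IsStarRotation B Ω σ ∧ IsSymmStarRotation B Ω σ) ∧
      ∀ σ, IsStarRotation B Ω σ →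
        (∀ W : WalshMap D, W.IsStuffed (starMap B Ω σ) p → W.AllFacesMeetBlack) ∧
        ∃ Ψ : WalshClass (starMap B Ω σ) p → PairedGraphClass B Ω p,
          Function.Surjective Ψ ∧
          (IsSymmStarRotation B Ω σ → Function.Bijective Ψ) ∧
          ∀ (G : {G : PairedGraph D // G.IsBuiltFrom B Ω p})
            (W : {W : WalshMap D // W.IsStuffed (starMap B Ω σ) p}),
            Ψ (Quotient.mk _ W) = Quotient.mk _ G ↔
              Nonempty (Correspondence B Ω (starMap B Ω σ)
                (fun x => Sum.inl (StarDart.cilium x)) G.1 W.1)) := by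
  refine ⟨⟨forgetPairing_surjective B Ω p, fun h =>
    ⟨forgetPairing_injective h p, forgetPairing_surjective B Ω p⟩⟩, ⟨?_, fun σ hσ hsymm => ?_⟩,
    ⟨exists_isCut B Ω, fun R hR => ⟨(exists_isRotation B Ω R).imp fun _ h => h.1, fun σ hσ => ?_⟩⟩,
    exists_isStarRotation B Ω, fun σ hσ => ?_⟩
  · obtain ⟨σ, hσ, h⟩ := exists_isRotation B Ω (noCut B)
    exact ⟨σ, hσ, h fun _ _ _ _ => Iff.rfl⟩
  -- No edge is removed, so the conditions on removed edges are vacuous.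
  · have hM := bubbleMap.representsBubble hσ (fun _ _ h => h.elim) (fun _ _ h => h.elim)
    obtain ⟨Ψ, -, hbij, hΨ⟩ := hM.exists_representation p
    refine ⟨(Equiv.ofBijective Ψ (hbij (bubbleMap.isSymmetric hσ hsymm))).symm, fun G W => ?_⟩
    exact (Equiv.symm_apply_eq _).trans (eq_comm.trans (hΨ G W))
  · have hM := bubbleMap.representsBubble hσ (fun i => (hR i).1) fun i x hx y hy h =>
      ((hR i).2 x ((hR i).1 x hx)).unique ⟨.refl _ _, hx⟩ ⟨h, hy⟩
    obtain ⟨Ψ, hsurj, hbij, hΨ⟩ := hM.exists_representation p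
    exact ⟨fun W hW => hW.allFacesMeetBlack (bubbleMap.facesMeetCilia hσ hR), Ψ, hsurj,
      fun h => hbij (bubbleMap.isSymmetric hσ h), hΨ⟩
  · obtain ⟨Ψ, hsurj, hbij, hΨ⟩ := (starMap.representsBubble hσ).exists_representation p
    exact ⟨fun W hW => hW.allFacesMeetBlack (starMap.facesMeetCilia hσ), Ψ, hsurj,
      fun h => hbij (starMap.isSymmetric hσ h), hΨ⟩
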